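/- Let $\underline\lambda=(\lambda_n)_{n\ge1}$ be a sequence in $\mathbb C\setminus\{0\}$, let $E_\lambda(z)=\lambda e^z$, and let $\underline a=(a_n)_{n\ge1}$, $\underline b=(b_n)_{n\ge1}$ be real sequences with $0<a_n<b_n$. Put $$I_{\underline a}^{\underline b}(E_{\underline\lambda})=\{z\in\mathbb C:\ a_n\le|E_{\lambda_n}\circ\cdots\circ E_{\lambda_1}(z)|\le b_n\text{ for all sufficiently large }n\},\qquad \Delta_n=\log\frac{b_n}{a_n}.$$ For every $q\in(0,1)$ and every $\Delta>0$ there is a constant $a=a(q,\Delta)$ such that the following holds for all such $\underline\lambda,\underline a,\underline b$. Assume that (a) $\underline a,\underline b$ are admissible with constant $q$, that is, for all sufficiently large $n$, $a_{n+1}\le|\lambda_{n+1}|e^{qa_n}$ and $b_{n+1}\ge|\lambda_{n+1}|e^{-qa_n}$; (b) $(a_1\cdots a_n)^{1/n}\to\infty$ as $n\to\infty$; (c) $\Delta_n>\Delta$ for every $n\ge1$; (d) $\liminf_{n\to\infty}a_n>a$. For $x=(x_1,x_2,\ldots)\in[a_1,b_1]\times[a_2,b_2]\times\cdots$ let $$\phi_n(x)=\frac{\log\big(\min(\Delta_2,x_1)\cdots\min(\Delta_n,x_{n-1})\big)}{\log(x_1\cdots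 x_n)-\log\min(\Delta_{n+1},x_n)},\qquad \psi_n(x)=\frac{\log\big(\min(\Delta_2,x_1)\cdots\min(\Delta_{n+1},x_n)\big)}{\log(x_1\cdots x_n)}$$ (the denominators are positive for all large $n$). Then $$1+\inf_x\liminf_{n\to\infty}\phi_n(x)\ \le\ \dim_H I_{\underline a}^{\underline b}(E_{\underline\lambda})\ \le\ 1+\sup_x\liminf_{n\to\infty}\phi_n(x),$$ $$1+\inf_x\limsup_{n\to\infty}\psi_n(x)\ \le\ \dim_P I_{\underline a}^{\underline b}(E_{\underline\lambda})\ \le\ 1+\sup_x\limsup_{n\to\infty}\psi_n(x),$$ where $\dim_H$ and $\dim_P$ denote Hausdorff and packing dimension and the infima and suprema are over all $x\in[a_1,b_1]\times[a_2,b_2]\times\cdots$. -/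

import Mathlib

open Filter Topology
open scoped ENNReal NNReal

/-! ### Packing dimension -/

/-- Upper box (Minkowski) dimension
`limsup_{ε → 0+} log N(A, ε) / (-log ε)`, where `N(A, ε)` is the least number of closed balls of
radius `ε` with centres in `A` which cover `A` (infinite if there is no finite cover).
With this convention the empty set has dimension `0`. -/
noncomputable def upperBoxDim {X : Type*} [MetricSpace X] (A : Set X) : ℝ≥0∞ :=
  limsup (fun ε : ℝ≥0 =>
    (ENNReal.log ((Metric.coveringNumber ε A : ℕ∞) : ℝ≥0∞) /
      ((-Real.log (ε : ℝ) : ℝ) : EReal)).toENNReal) (𝓝[>] (0 : ℝ≥0))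

/-- Packing dimension (in the sense of Tricot): the infimum, over all countable covers of `A`,
of the supremum of the upper box dimensions of the members of the cover. -/
noncomputable def packingDim {X : Type*} [MetricSpace X] (A : Set X) : ℝ≥0∞ :=
  ⨅ (F : ℕ → Set X) (_ : A ⊆ ⋃ i, F i), ⨆ i, upperBoxDim (F i)

/-! ### Non-autonomous exponential iteration

All sequences are indexed by `n = 1, 2, 3, …`; their value at `0` plays no role. -/

/-- `nonautExp lam n = E_{lam n} ∘ ⋯ ∘ E_{lam 1}`, where `E_c z = c * exp z`. -/
noncomputable def nonautExp (lam : ℕ → ℂ) : ℕ → ℂ → ℂ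
  | 0, z => z
  | n + 1, z => lam (n + 1) * Complex.exp (nonautExp lam n z)

/-- The points `z` with `a n ≤ |E_{lam n} ∘ ⋯ ∘ E_{lam 1} (z)| ≤ b n` for all large `n`. -/
def escapeRateSet (lam : ℕ → ℂ) (a b : ℕ → ℝ) : Set ℂ :=
  {z | ∀ᶠ n in atTop, a n ≤ ‖nonautExp lam n z‖ ∧ ‖nonautExp lam n z‖ ≤ b n}

/-- The normalized modulus `Δ_n = log (b n / a n)` of the annulus `a n ≤ |z| ≤ b n`. -/
noncomputable def annulusModulus (a b : ℕ → ℝ) (n : ℕ) : ℝ := Real.log (b n / a n)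

/-- Admissibility of `a`, `b` (with respect to `lam`) with the constant `q`. -/
def IsAdmissible (lam : ℕ → ℂ) (a b : ℕ → ℝ) (q : ℝ) : Prop :=
  ∀ᶠ n in atTop,
    a (n + 1) ≤ ‖lam (n + 1)‖ * Real.exp (q * a n) ∧
    ‖lam (n + 1)‖ * Real.exp (-(q * a n)) ≤ b (n + 1)

/-- The sequences `x` in `[a 1, b 1] × [a 2, b 2] × ⋯`. -/
def seqBox (a b : ℕ → ℝ) : Set (ℕ → ℝ) :=
  {x | ∀ n, 1 ≤ n → x n ∈ Set.Icc (a n) (b n)}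

/-- `φ_n(x)`: the numerator is `log (min(Δ_2, x_1) ⋯ min(Δ_n, x_{n-1}))`, the denominator is
`log (x_1 ⋯ x_n) - log min(Δ_{n+1}, x_n)`. -/
noncomputable def phiRatio (a b : ℕ → ℝ) (n : ℕ) (x : ℕ → ℝ) : ℝ :=
  Real.log (∏ k ∈ Finset.Ico 1 n, min (annulusModulus a b (k + 1)) (x k)) /
    (Real.log (∏ k ∈ Finset.Icc 1 n, x k) -
      Real.log (min (annulusModulus a b (n + 1)) (x n)))

/-- `ψ_n(x)`: the numerator is `log (min(Δ_2, x_1) ⋯ min(Δ_{n+1}, x_n))`, the denominator is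
`log (x_1 ⋯ x_n)`. -/
noncomputable def psiRatio (a b : ℕ → ℝ) (n : ℕ) (x : ℕ → ℝ) : ℝ :=
  Real.log (∏ k ∈ Finset.Icc 1 n, min (annulusModulus a b (k + 1)) (x k)) /
    Real.log (∏ k ∈ Finset.Icc 1 n, x k)

/-!
Along the orbit of `z` write `x_n = |E_{λ_n} ∘ ⋯ ∘ E_{λ_1} (z)|`, and `P_n = x_1 ⋯ x_n` for the size
of the derivative of the `n`-th iterate. Cut the plane into cells of bounded size. The points with
the same itinerary as `z` up to time `n` form a set of diameter about `1 / P_n`. Its image at time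
`n + 1` has diameter about `x_{n+1}` and is confined to a vertical strip of width `Δ_{n+2}` by the
annulus that follows. So the set is effectively a rectangle with sides `1 / P_n` and
`min(Δ_{n+2}, x_{n+1}) / P_{n+1}`, whose points have about `x_{n+1} * min(Δ_{n+2}, x_{n+1})`
different itineraries up to time `n + 1`.

For the upper bounds, give each class the weight that is shared equally among its continuations;
covering the rectangles by squares and optimising over `n` gives the bounds by `φ_n` and `ψ_n`. For
the lower bounds, admissibility and a large `a` provide in each such strip a family of fundamental
boxes of `exp` of about the maximal cardinality; the tree of boxes carries the measure shared
equally among the children, to which the mass distribution principle applies. Both estimates lose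
factors `K ^ n`, which do not affect the exponents since `P_n` grows superexponentially.
-/

/-! ### Superexponential sequences and dimensions -/

section Dimension

open MeasureTheory Set Metric

/-- A positive sequence that eventually dominates every geometric sequence. -/
structure IsSuperexponential (G : ℕ → ℝ) : Prop where
  pos : ∀ n, 0 < G n
  eventually_pow_le : ∀ B : ℝ, ∀ᶠ n in atTop, B ^ n ≤ G n

namespace IsSuperexponential

variable {G : ℕ → ℝ} (hG : IsSuperexponential G)
include hG

lemma tendsto_one_div : Tendsto (fun n => 1 / G n) atTop (𝓝 0) := by
  have hG' : Tendsto G atTop atTop :=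
    tendsto_atTop_mono' atTop (hG.eventually_pow_le 2)
      (tendsto_pow_atTop_atTop_of_one_lt one_lt_two)
  exact hG'.inv_tendsto_atTop.congr fun n => (one_div (G n)).symm

lemma eventually_pow_le_rpow {B ε : ℝ} (hB : 0 < B) (hε : 0 < ε) :
    ∀ᶠ n in atTop, B ^ n ≤ G n ^ ε := by
  filter_upwards [hG.eventually_pow_le (B ^ (1 / ε))] with n hn
  have hroot : ((B ^ (1 / ε)) ^ n) ^ ε = B ^ n := by
    rw [← Real.rpow_natCast, ← Real.rpow_natCast, ← Real.rpow_mul hB.le, ← Real.rpow_mul hB.le]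
    congr 1
    field_simp
  rw [← hroot]
  gcongr

lemma exists_pow_le_mul_rpow {B ε : ℝ} (hB : 0 < B) (hε : 0 < ε) :
    ∃ C : ℝ, 0 < C ∧ ∀ n, B ^ n ≤ C * G n ^ ε := by
  have hev : ∀ᶠ n in atTop, B ^ n / G n ^ ε ≤ 1 := by
    filter_upwards [hG.eventually_pow_le_rpow hB hε] with n hn
    rwa [div_le_one (Real.rpow_pos_of_pos (hG.pos n) ε)]
  obtain ⟨C, hC⟩ := (isBoundedUnder_of_eventually_le hev).bddAbove_range
  refine ⟨max C 1, by positivity, fun n => ?_⟩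
  rw [← div_le_iff₀ (Real.rpow_pos_of_pos (hG.pos n) ε)]
  exact (hC ⟨n, rfl⟩).trans (le_max_left _ _)

lemma exists_pow_le_mul_rpow_neg {B ε : ℝ} (hB : 0 < B) (hε : 0 < ε) :
    ∃ C : ℝ, 0 < C ∧ ∀ n r, 0 < r → r ≤ 1 / G n → B ^ n ≤ C * r ^ (-ε) := by
  obtain ⟨C, hC, hBC⟩ := hG.exists_pow_le_mul_rpow hB hε
  refine ⟨C, hC, fun n r hr hrG => (hBC n).trans ?_⟩
  have hGr : G n ≤ r⁻¹ := by rwa [le_inv_comm₀ (hG.pos n) hr, ← one_div]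
  rw [Real.rpow_neg hr.le, ← Real.inv_rpow hr.le]
  have := (hG.pos n).le
  gcongr

end IsSuperexponential

lemma log_div_neg_log_le_iff {N : ℝ≥0∞} {r d : ℝ} (hr₀ : 0 < r) (hr₁ : r < 1) :
    ENNReal.log N / ((-Real.log r : ℝ) : EReal) ≤ d ↔ N ≤ ENNReal.ofReal (r ^ (-d)) := by
  have hlog : 0 < -Real.log r := neg_pos.2 (Real.log_neg hr₀ hr₁)
  rw [EReal.div_le_iff_le_mul (by exact_mod_cast hlog) (EReal.coe_ne_top _),
    ← ENNReal.log_le_log_iff, ENNReal.log_ofReal_of_pos (by positivity), Real.log_rpow hr₀,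
    ← EReal.coe_mul, neg_mul_comm, mul_comm]

lemma eventually_coe_lt_nhdsGT_zero {δ : ℝ} (hδ : 0 < δ) : ∀ᶠ r : ℝ≥0 in 𝓝[>] 0, (r : ℝ) < δ :=
  ((NNReal.continuous_coe.tendsto 0).mono_left nhdsWithin_le_nhds).eventually (gt_mem_nhds hδ)

section UpperBoxDim

variable {X : Type*} [MetricSpace X] {F : Set X}

lemma upperBoxDim_le_of_coveringNumber_le {C d d' : ℝ} (hd : d < d')
    (h : ∀ᶠ r : ℝ≥0 in 𝓝[>] 0,
      ((coveringNumber r F : ℕ∞) : ℝ≥0∞) ≤ ENNReal.ofReal (C * (r : ℝ) ^ (-d))) :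
    upperBoxDim F ≤ ENNReal.ofReal d' := by
  have hsmall : ∀ᶠ r : ℝ≥0 in 𝓝[>] 0, C * (r : ℝ) ^ (d' - d) ≤ 1 := by
    have hcoe : Tendsto (fun r : ℝ≥0 => (r : ℝ)) (𝓝[>] 0) (𝓝 0) :=
      (NNReal.continuous_coe.tendsto 0).mono_left nhdsWithin_le_nhds
    have hlim := (hcoe.rpow_const (p := d' - d) (Or.inr (by linarith))).const_mul C
    rw [Real.zero_rpow (by linarith), mul_zero] at hlim
    exact (hlim.eventually (gt_mem_nhds zero_lt_one)).mono fun _ => le_of_lt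
  refine limsup_le_of_le (by isBoundedDefault) ?_
  filter_upwards [h, hsmall, eventually_coe_lt_nhdsGT_zero one_pos, self_mem_nhdsWithin]
    with r hN hCr hr₁ (hr₀ : (0 : ℝ) < r)
  have hpow : C * (r : ℝ) ^ (-d) ≤ (r : ℝ) ^ (-d') := by
    have hsplit : (r : ℝ) ^ (-d) = (r : ℝ) ^ (d' - d) * (r : ℝ) ^ (-d') := by
      rw [← Real.rpow_add hr₀]
      ring_nf
    rw [hsplit, ← mul_assoc]
    exact mul_le_of_le_one_left (by positivity) hCr
  have hdiv := (log_div_neg_log_le_iff hr₀ hr₁).2 (hN.trans (ENNReal.ofReal_le_ofReal hpow))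
  simpa using EReal.toENNReal_le_toENNReal hdiv

lemma upperBoxDim_le_of_externalCoveringNumber_le {C d d' : ℝ} (hd : d < d')
    (h : ∀ᶠ r : ℝ≥0 in 𝓝[>] 0,
      ((externalCoveringNumber r F : ℕ∞) : ℝ≥0∞) ≤ ENNReal.ofReal (C * (r : ℝ) ^ (-d))) :
    upperBoxDim F ≤ ENNReal.ofReal d' := by
  refine upperBoxDim_le_of_coveringNumber_le (C := C * 2 ^ d) hd ?_
  have hhalf : Tendsto (fun r : ℝ≥0 => r / 2) (𝓝[>] 0) (𝓝[>] 0) := by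
    refine tendsto_nhdsWithin_iff.2 ⟨?_, ?_⟩
    · simpa using ((tendsto_id (α := ℝ≥0)).div_const 2).mono_left
        (nhdsWithin_le_nhds (a := (0 : ℝ≥0)) (s := Ioi 0))
    · filter_upwards [self_mem_nhdsWithin] with r (hr : 0 < r)
      exact half_pos hr
  filter_upwards [hhalf.eventually h] with r hr
  calc ((coveringNumber r F : ℕ∞) : ℝ≥0∞)
      = ((coveringNumber (2 * (r / 2)) F : ℕ∞) : ℝ≥0∞) := by rw [mul_div_cancel₀ _ two_ne_zero]
    _ ≤ ((externalCoveringNumber (r / 2) F : ℕ∞) : ℝ≥0∞) := by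
        exact_mod_cast coveringNumber_two_mul_le_externalCoveringNumber _ _
    _ ≤ ENNReal.ofReal (C * ((r / 2 : ℝ≥0) : ℝ) ^ (-d)) := hr
    _ = ENNReal.ofReal (C * 2 ^ d * (r : ℝ) ^ (-d)) := by
        rw [NNReal.coe_div, NNReal.coe_ofNat, Real.div_rpow r.coe_nonneg zero_le_two,
          Real.rpow_neg zero_le_two, div_inv_eq_mul]
        ring_nf

lemma eventually_coveringNumber_le_of_upperBoxDim_lt {d : ℝ}
    (h : upperBoxDim F < ENNReal.ofReal d) :
    ∀ᶠ r : ℝ≥0 in 𝓝[>] 0,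
      ((coveringNumber r F : ℕ∞) : ℝ≥0∞) ≤ ENNReal.ofReal ((r : ℝ) ^ (-d)) := by
  filter_upwards [eventually_lt_of_limsup_lt h, eventually_coe_lt_nhdsGT_zero one_pos,
    self_mem_nhdsWithin] with r hlt hr₁ (hr₀ : (0 : ℝ) < r)
  rw [← log_div_neg_log_le_iff hr₀ hr₁]
  by_contra! hgt
  exact hlt.not_ge (by simpa using EReal.toENNReal_le_toENNReal hgt.le)

end UpperBoxDim

lemma dimH_le_of_ball_covers {Z : Type*} [MetricSpace Z] {F : Set Z} {s : ℝ} (hs : 0 ≤ s)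
    {C : ℝ≥0∞} (hC : C ≠ ∞)
    (h : ∀ ε : ℝ, 0 < ε → ∃ B : Set (Z × ℝ), B.Countable ∧ (∀ p ∈ B, 0 ≤ p.2 ∧ p.2 ≤ ε) ∧
      F ⊆ ⋃ p ∈ B, closedBall p.1 p.2 ∧ ∑' p : B, ENNReal.ofReal ((2 * p.1.2) ^ s) ≤ C) :
    dimH F ≤ ENNReal.ofReal s := by
  borelize Z
  choose B hcount hrad hcov hsum using fun n : ℕ => h ((1 / 2) ^ n) (by positivity)
  have hdiam : ∀ n (p : B n), ediam (closedBall p.1.1 p.1.2) ≤ ENNReal.ofReal (2 * p.1.2) := by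
    intro n p
    rw [← closedEBall_ofReal (hrad n p p.2).1, ENNReal.ofReal_mul zero_le_two]
    simpa using ediam_closedEBall_le (x := p.1.1) (r := ENNReal.ofReal p.1.2)
  have hscale : Tendsto (fun n : ℕ => ENNReal.ofReal (2 * (1 / 2) ^ n)) atTop (𝓝 0) := by
    have : Tendsto (fun n : ℕ => 2 * (1 / 2 : ℝ) ^ n) atTop (𝓝 (2 * 0)) :=
      (tendsto_pow_atTop_nhds_zero_of_lt_one (by norm_num) (by norm_num)).const_mul 2
    simpa using ENNReal.tendsto_ofReal this
  have := fun n => (hcount n).to_subtype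
  have hmeas :
      μH[s] F ≤ liminf (fun n => ∑' p : B n, ediam (closedBall p.1.1 p.1.2) ^ s) atTop := by
    refine Measure.hausdorffMeasure_le_liminf_tsum s F _ hscale _ ?_ ?_
    · refine Eventually.of_forall fun n p => (hdiam n p).trans (ENNReal.ofReal_le_ofReal ?_)
      linarith [(hrad n p p.2).2]
    · exact Eventually.of_forall fun n => (hcov n).trans (biUnion_eq_iUnion _ _).subset
  have hle : ∀ n, ∑' p : B n, ediam (closedBall p.1.1 p.1.2) ^ s ≤ C := fun n =>
    (ENNReal.tsum_le_tsum fun p => by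
      rw [← ENNReal.ofReal_rpow_of_nonneg (by linarith [(hrad n p p.2).1]) hs]
      exact ENNReal.rpow_le_rpow (hdiam n p) hs).trans (hsum n)
  have hfin : μH[((⟨s, hs⟩ : ℝ≥0) : ℝ)] F ≠ ∞ :=
    ne_top_of_le_ne_top hC <| hmeas.trans <| liminf_le_of_le (by isBoundedDefault) fun b hb =>
      let ⟨n, hn⟩ := hb.exists
      hn.trans (hle n)
  refine (dimH_le_of_hausdorffMeasure_ne_top hfin).trans (le_of_eq ?_)
  rw [ENNReal.ofReal, Real.toNNReal_of_nonneg hs]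
  rfl

lemma externalCoveringNumber_le_of_ball_cover {Z : Type*} [PseudoMetricSpace Z] {F : Set Z}
    {r : ℝ≥0} {B : Set (Z × ℝ)} (hr : ∀ p ∈ B, p.2 = r) (hF : F ⊆ ⋃ p ∈ B, closedBall p.1 p.2) :
    externalCoveringNumber r F ≤ B.encard := by
  refine (IsCover.externalCoveringNumber_le_encard (C := Prod.fst '' B) ?_).trans
    (encard_image_le _ _)
  rw [isCover_iff_subset_iUnion_closedBall]
  intro z hz
  obtain ⟨p, hp, hzp⟩ := mem_iUnion₂.1 (hF hz)
  exact mem_iUnion₂.2 ⟨p.1, mem_image_of_mem _ hp, hr p hp ▸ hzp⟩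

end Dimension

/-! ### Dimension bounds from covers by classes -/

section ClassCover

open MeasureTheory Set Metric

/-- A model of a set `F` that is resolved at finer and finer levels `n ≥ n₀`: the class of `z ∈ F`
at level `n`, formed by the points with the same value of `τ n`, is covered like a rectangle with
sides `1 / P n z` and `w n z`, and carries the weight `1 / (P n z * M n z)`, the sum of the weights
of the classes being bounded. All estimates are up to factors `K ^ n`, which are harmless because
`P n z` is at least the superexponential `G n`. -/
structure IsClassCover {Z T : Type*} [PseudoMetricSpace Z] (F : Set Z) (τ : ℕ → Z → T)
    (P M w : ℕ → Z → ℝ) (G : ℕ → ℝ) (K : ℝ) (n₀ : ℕ) : Prop where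
  one_le : 1 ≤ K
  growth : IsSuperexponential G
  le_scale : ∀ n, n₀ ≤ n → ∀ z ∈ F, G n ≤ P n z
  width_pos : ∀ n, n₀ ≤ n → ∀ z ∈ F, 0 < w n z
  width_le : ∀ n, n₀ ≤ n → ∀ z ∈ F, w n z ≤ 1 / P n z
  mass_pos : ∀ n, n₀ ≤ n → ∀ z ∈ F, 0 < M n z
  sum_weight_le : ∀ n, n₀ ≤ n → ∀ S : Finset Z, (S : Set Z) ⊆ F → InjOn (τ n) S →
    ∑ z ∈ S, 1 / (P n z * M n z) ≤ K ^ n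
  exists_cover : ∀ n, n₀ ≤ n → ∀ z ∈ F, ∀ r : ℝ, 0 < r → ∃ C : Finset Z,
    {z' ∈ F | τ n z' = τ n z} ⊆ ⋃ c ∈ C, closedBall c r ∧
    (C.card : ℝ) ≤ K ^ n * (1 / (P n z * r) + 1) * (w n z / r + 1)

namespace IsClassCover

section PseudoMetric

variable {Z T : Type*} [PseudoMetricSpace Z] {F : Set Z} {τ : ℕ → Z → T} {P M w : ℕ → Z → ℝ}
  {G : ℕ → ℝ} {K : ℝ} {n₀ : ℕ} (h : IsClassCover F τ P M w G K n₀)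
include h

lemma mono {F' : Set Z} {n₁ : ℕ} (hF : F' ⊆ F) (hn : n₀ ≤ n₁) :
    IsClassCover F' τ P M w G K n₁ where
  one_le := h.one_le
  growth := h.growth
  le_scale n hn₁ z hz := h.le_scale n (hn.trans hn₁) z (hF hz)
  width_pos n hn₁ z hz := h.width_pos n (hn.trans hn₁) z (hF hz)
  width_le n hn₁ z hz := h.width_le n (hn.trans hn₁) z (hF hz)
  mass_pos n hn₁ z hz := h.mass_pos n (hn.trans hn₁) z (hF hz)
  sum_weight_le n hn₁ S hS hinj := h.sum_weight_le n (hn.trans hn₁) S (hS.trans hF) hinj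
  exists_cover n hn₁ z hz r hr := by
    obtain ⟨C, hcov, hcard⟩ := h.exists_cover n (hn.trans hn₁) z (hF hz) r hr
    exact ⟨C, fun z' hz' => hcov ⟨hF hz'.1, hz'.2⟩, hcard⟩

lemma scale_pos {n : ℕ} (hn : n₀ ≤ n) {z : Z} (hz : z ∈ F) : 0 < P n z :=
  (h.growth.pos n).trans_le (h.le_scale n hn z hz)

lemma one_div_scale_le {n : ℕ} (hn : n₀ ≤ n) {z : Z} (hz : z ∈ F) : 1 / P n z ≤ 1 / G n :=
  one_div_le_one_div_of_le (h.growth.pos n) (h.le_scale n hn z hz)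

lemma exists_le_lt_one_div_scale {z : Z} (hz : z ∈ F) {r : ℝ} (hr : 0 < r) (hr₀ : r < 1 / P n₀ z) :
    ∃ n, n₀ ≤ n ∧ 1 / P (n + 1) z ≤ r ∧ r < 1 / P n z := by
  by_contra! hne
  have hlt : ∀ n, n₀ ≤ n → r < 1 / P n z := fun n hn => by
    induction n, hn using Nat.le_induction with
    | base => exact hr₀
    | succ n hn ih => exact not_le.1 fun hle => absurd ih (hne n hn hle).not_gt
  obtain ⟨n, hn, hGr⟩ := ((eventually_ge_atTop n₀).and
    (h.growth.tendsto_one_div.eventually (gt_mem_nhds hr))).exists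
  exact (hlt n hn).not_ge ((h.one_div_scale_le hn hz).trans hGr.le)

lemma tsum_weight_le {n : ℕ} (hn : n₀ ≤ n) {A : Set T} (rep : A → Z) (hrepF : ∀ t, rep t ∈ F)
    (hrepτ : ∀ t, τ n (rep t) = t) :
    ∑' t : A, ENNReal.ofReal (1 / (P n (rep t) * M n (rep t))) ≤ ENNReal.ofReal (K ^ n) := by
  classical
  rw [ENNReal.tsum_eq_iSup_sum]
  refine iSup_le fun s => ?_
  have hinj : Function.Injective rep := fun t t' htt => Subtype.ext <| by
    rw [← hrepτ t, htt, hrepτ t']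
  have hmem : ((s.image rep : Finset Z) : Set Z) ⊆ F := by
    rw [Finset.coe_image]
    exact image_subset_iff.2 fun t _ => hrepF t
  rw [← ENNReal.ofReal_sum_of_nonneg fun t _ => by
      have := h.scale_pos hn (hrepF t)
      have := h.mass_pos n hn _ (hrepF t)
      positivity,
    ← Finset.sum_image (f := fun z => 1 / (P n z * M n z)) hinj.injOn]
  refine ENNReal.ofReal_le_ofReal (h.sum_weight_le n hn _ hmem ?_)
  rw [Finset.coe_image]
  rintro _ ⟨t, -, rfl⟩ _ ⟨t', -, rfl⟩ htt
  rw [hrepτ, hrepτ] at htt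
  rw [Subtype.ext htt]

lemma exists_ball_cover [Countable T] {n : ℕ} (hn : n₀ ≤ n) {S : Set Z} (hS : S ⊆ F) {ρ : Z → ℝ}
    (hρ : ∀ z ∈ S, 0 < ρ z) {f : ℝ → ℝ} (hf₀ : ∀ z ∈ S, 0 ≤ f (ρ z)) {κ : ℝ} (hκ : 0 ≤ κ)
    (hf : ∀ z ∈ S, K ^ n * (1 / (P n z * ρ z) + 1) * (w n z / ρ z + 1) * f (ρ z) ≤
      κ * (1 / (P n z * M n z))) :
    ∃ B : Set (Z × ℝ), B.Countable ∧ (∀ p ∈ B, ∃ z ∈ S, p.2 = ρ z) ∧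
      S ⊆ ⋃ p ∈ B, closedBall p.1 p.2 ∧
      ∑' p : B, ENNReal.ofReal (f p.1.2) ≤ ENNReal.ofReal (κ * K ^ n) := by
  classical
  choose rep hrepS hrepτ using fun t : τ n '' S => t.2
  choose C hcov hcard using fun t =>
    h.exists_cover n hn (rep t) (hS (hrepS t)) (ρ (rep t)) (hρ _ (hrepS t))
  let B : τ n '' S → Finset (Z × ℝ) := fun t => (C t).image fun c => (c, ρ (rep t))
  have hsum : ∀ t, ∑' p : (B t : Set (Z × ℝ)), ENNReal.ofReal (f p.1.2) ≤
      ENNReal.ofReal κ * ENNReal.ofReal (1 / (P n (rep t) * M n (rep t))) := fun t =>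
    calc ∑' p : (B t : Set (Z × ℝ)), ENNReal.ofReal (f p.1.2)
        = ∑ p ∈ B t, ENNReal.ofReal (f p.2) :=
          Finset.tsum_subtype' (B t) fun p : Z × ℝ => ENNReal.ofReal (f p.2)
      _ = ENNReal.ofReal ((C t).card * f (ρ (rep t))) := by
          rw [Finset.sum_image fun c _ c' _ hcc => (Prod.ext_iff.1 hcc).1]
          simp only [Finset.sum_const, nsmul_eq_mul]
          rw [ENNReal.ofReal_mul (Nat.cast_nonneg _), ENNReal.ofReal_natCast]
      _ ≤ ENNReal.ofReal (κ * (1 / (P n (rep t) * M n (rep t)))) :=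
          ENNReal.ofReal_le_ofReal <|
            (mul_le_mul_of_nonneg_right (hcard t) (hf₀ _ (hrepS t))).trans (hf _ (hrepS t))
      _ = _ := ENNReal.ofReal_mul hκ
  refine ⟨⋃ t, B t, countable_iUnion fun t => (B t).countable_toSet, ?_, fun z hz => ?_, ?_⟩
  · intro p hp
    obtain ⟨t, hpt⟩ := mem_iUnion.1 hp
    obtain ⟨c, -, rfl⟩ := Finset.mem_image.1 (Finset.mem_coe.1 hpt)
    exact ⟨rep t, hrepS t, rfl⟩
  · let t : τ n '' S := ⟨τ n z, mem_image_of_mem _ hz⟩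
    obtain ⟨c, hc, hzc⟩ := mem_iUnion₂.1 (hcov t ⟨hS hz, (hrepτ t).symm⟩)
    exact mem_iUnion₂.2 ⟨(c, ρ (rep t)),
      mem_iUnion.2 ⟨t, Finset.mem_coe.2 (Finset.mem_image_of_mem _ hc)⟩, hzc⟩
  · calc ∑' p : ⋃ t, (B t : Set (Z × ℝ)), ENNReal.ofReal (f p.1.2)
        ≤ ∑' t, ∑' p : (B t : Set (Z × ℝ)), ENNReal.ofReal (f p.1.2) :=
          ENNReal.tsum_iUnion_le_tsum (fun p : Z × ℝ => ENNReal.ofReal (f p.2)) _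
      _ ≤ ∑' t, ENNReal.ofReal κ * ENNReal.ofReal (1 / (P n (rep t) * M n (rep t))) :=
          ENNReal.tsum_le_tsum hsum
      _ ≤ ENNReal.ofReal κ * ENNReal.ofReal (K ^ n) := by
          rw [ENNReal.tsum_mul_left]
          gcongr
          exact h.tsum_weight_le hn rep (fun t => hS (hrepS t)) hrepτ
      _ = ENNReal.ofReal (κ * K ^ n) := (ENNReal.ofReal_mul hκ).symm

lemma exists_ball_cover_of_levels [Countable T] {N : ℕ} (hN : n₀ ≤ N) {S : ℕ → Set Z}
    (hS : ∀ n, S n ⊆ F) (hFS : ∀ z ∈ F, ∃ n, N ≤ n ∧ z ∈ S n) {ρ : ℕ → Z → ℝ}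
    (hρ : ∀ n, N ≤ n → ∀ z ∈ S n, 0 < ρ n z) {f : ℝ → ℝ}
    (hf₀ : ∀ n, N ≤ n → ∀ z ∈ S n, 0 ≤ f (ρ n z)) {D : ℝ} (hD : 0 ≤ D)
    (hf : ∀ n, N ≤ n → ∀ z ∈ S n,
      K ^ n * (1 / (P n z * ρ n z) + 1) * (w n z / ρ n z + 1) * f (ρ n z) ≤
        D * ((2 * K) ^ n)⁻¹ * (1 / (P n z * M n z))) :
    ∃ B : Set (Z × ℝ), B.Countable ∧ (∀ p ∈ B, ∃ n, N ≤ n ∧ ∃ z ∈ S n, p.2 = ρ n z) ∧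
      F ⊆ ⋃ p ∈ B, closedBall p.1 p.2 ∧
      ∑' p : B, ENNReal.ofReal (f p.1.2) ≤ ENNReal.ofReal (2 * D) := by
  have hK : 0 < K := one_pos.trans_le h.one_le
  have hlevel : ∀ m, N ≤ N + m := fun m => Nat.le_add_right N m
  choose B hcount hrad hcov hsum using fun m => h.exists_ball_cover (hN.trans (hlevel m))
    (hS (N + m)) (hρ _ (hlevel m)) (hf₀ _ (hlevel m))
    (mul_nonneg hD (inv_nonneg.2 (by positivity))) (hf _ (hlevel m))
  have hgeom : ∀ m, ENNReal.ofReal (D * ((2 * K) ^ (N + m))⁻¹ * K ^ (N + m)) ≤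
      ENNReal.ofReal D * 2⁻¹ ^ m := fun m => by
    have hle : D * ((2 * K) ^ (N + m))⁻¹ * K ^ (N + m) ≤ D * (2⁻¹ : ℝ) ^ m := by
      rw [mul_pow, mul_inv, mul_assoc, inv_mul_cancel_right₀ (by positivity), ← inv_pow]
      exact mul_le_mul_of_nonneg_left
        (pow_le_pow_of_le_one (by norm_num) (by norm_num) (Nat.le_add_left m N)) hD
    refine (ENNReal.ofReal_le_ofReal hle).trans (le_of_eq ?_)
    rw [ENNReal.ofReal_mul hD, ENNReal.ofReal_pow (by norm_num),
      ENNReal.ofReal_inv_of_pos two_pos, ENNReal.ofReal_ofNat]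
  refine ⟨⋃ m, B m, countable_iUnion hcount, fun p hp => ?_, fun z hz => ?_, ?_⟩
  · obtain ⟨m, hm⟩ := mem_iUnion.1 hp
    exact ⟨N + m, hlevel m, hrad m p hm⟩
  · obtain ⟨n, hn, hzn⟩ := hFS z hz
    obtain ⟨m, rfl⟩ := Nat.exists_eq_add_of_le hn
    obtain ⟨p, hp, hzp⟩ := mem_iUnion₂.1 (hcov m hzn)
    exact mem_iUnion₂.2 ⟨p, mem_iUnion.2 ⟨m, hp⟩, hzp⟩
  · calc ∑' p : ⋃ m, B m, ENNReal.ofReal (f p.1.2)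
        ≤ ∑' m, ∑' p : B m, ENNReal.ofReal (f p.1.2) :=
          ENNReal.tsum_iUnion_le_tsum (fun p : Z × ℝ => ENNReal.ofReal (f p.2)) B
      _ ≤ ∑' m : ℕ, ENNReal.ofReal D * 2⁻¹ ^ m :=
          ENNReal.tsum_le_tsum fun m => (hsum m).trans (hgeom m)
      _ = ENNReal.ofReal (2 * D) := by
          rw [ENNReal.tsum_mul_left, ENNReal.tsum_geometric, ENNReal.one_sub_inv_two, inv_inv,
            mul_comm, ENNReal.ofReal_mul zero_le_two, ENNReal.ofReal_ofNat]

end PseudoMetric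

lemma card_mul_rpow_le {n : ℕ} {P M w K C t t' : ℝ} (hK : 0 < K) (hP : 0 < P) (hw : 0 < w)
    (hwP : w ≤ 1 / P) (hM : 0 < M) (hMw : M ≤ w ^ (-t))
    (hC : (2 * K ^ 2) ^ n ≤ C * w ^ (-(t' - t))) :
    K ^ n * (1 / (P * w) + 1) * (w / w + 1) * (2 * w) ^ (1 + t') ≤
      4 * 2 ^ (1 + t') * C * ((2 * K) ^ n)⁻¹ * (1 / (P * M)) := by
  have hratio : 1 ≤ 1 / (P * w) := by
    rw [le_div_iff₀ (by positivity)]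
    rw [le_div_iff₀ hP] at hwP
    linarith
  have hwM : w ^ t ≤ 1 / M := by
    rwa [le_one_div (by positivity) hM, one_div, ← Real.rpow_neg hw.le]
  have hCw : w ^ (t' - t) * (2 * K ^ 2) ^ n ≤ C := by
    rw [Real.rpow_neg hw.le, ← div_eq_mul_inv, le_div_iff₀ (by positivity)] at hC
    linarith
  have hsplit : (2 * w) ^ (1 + t') = 2 ^ (1 + t') * (w * (w ^ (t' - t) * w ^ t)) := by
    rw [Real.mul_rpow zero_le_two hw.le, ← Real.rpow_add hw, sub_add_cancel, Real.rpow_add hw,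
      Real.rpow_one]
  calc K ^ n * (1 / (P * w) + 1) * (w / w + 1) * (2 * w) ^ (1 + t')
      ≤ K ^ n * (1 / (P * w) + 1 / (P * w)) * (1 + 1) *
        (2 ^ (1 + t') * (w * (w ^ (t' - t) * (1 / M)))) := by
        rw [div_self hw.ne', hsplit]
        gcongr
    _ = 4 * 2 ^ (1 + t') * (w ^ (t' - t) * (2 * K ^ 2) ^ n) * ((2 * K) ^ n)⁻¹ *
        (1 / (P * M)) := by
        rw [show (2 * K ^ 2) ^ n = (2 * K) ^ n * K ^ n by rw [← mul_pow]; ring]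
        field_simp
        ring
    _ ≤ _ := by gcongr

lemma card_le_of_between {n : ℕ} {P M w P' M' K t r : ℝ} (hK : 0 < K) (hP : 0 < P)
    (hP' : 0 < P') (hM : 0 < M) (hr : 0 < r) (hw : 0 < w) (hrP : r < 1 / P) (hrP' : 1 / P' ≤ r)
    (ht₀ : 0 ≤ t) (ht₁ : t ≤ 1) (hMP : M ≤ P ^ t) (hMP' : M' ≤ P' ^ t) (hwM : w * M = M' / P') :
    K ^ n * (1 / (P * r) + 1) * (w / r + 1) ≤ 4 * K ^ n * r ^ (-(1 + t)) * (1 / (P * M)) := by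
  have hratio : 1 ≤ 1 / (P * r) := by
    rw [le_div_iff₀ (by positivity)]
    rw [lt_div_iff₀ hP] at hrP
    linarith
  have hMr : M ≤ r ^ (-t) := by
    refine hMP.trans ?_
    rw [Real.rpow_neg hr.le, ← Real.inv_rpow hr.le]
    refine Real.rpow_le_rpow hP.le ?_ ht₀
    rw [le_inv_comm₀ hP hr]
    simpa using hrP.le
  have hwMr : w * M / r ≤ r ^ (-t) :=
    calc w * M / r ≤ (1 / P') ^ (1 - t) / r := by
          rw [hwM, one_div, Real.inv_rpow hP'.le, ← Real.rpow_neg hP'.le, neg_sub,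
            Real.rpow_sub hP', Real.rpow_one]
          gcongr
      _ ≤ r ^ (1 - t) / r := by gcongr
      _ = r ^ (-t) := by
          rw [← Real.rpow_sub_one hr.ne']
          ring_nf
  have hsplit : r ^ (-(1 + t)) = r ^ (-t) / r := by
    rw [← Real.rpow_sub_one hr.ne']
    ring_nf
  calc K ^ n * (1 / (P * r) + 1) * (w / r + 1)
      ≤ K ^ n * (1 / (P * r) + 1 / (P * r)) * (w / r + 1) := by gcongr
    _ = 2 * K ^ n / r * (1 / (P * M)) * (w * M / r + M) := by
        field_simp
        ring
    _ ≤ 2 * K ^ n / r * (1 / (P * M)) * (r ^ (-t) + r ^ (-t)) := by gcongr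
    _ = _ := by
        rw [hsplit]
        ring

section Metric

variable {Z T : Type*} [MetricSpace Z] [Countable T] {F : Set Z} {τ : ℕ → Z → T}
  {P M w : ℕ → Z → ℝ} {G : ℕ → ℝ} {K t t' : ℝ} {n₀ : ℕ} (h : IsClassCover F τ P M w G K n₀)
include h

theorem dimH_le (htt : t < t') (ht' : 0 < t') (hF : ∀ z ∈ F, ∃ᶠ n in atTop, M n z ≤ w n z ^ (-t)) :
    dimH F ≤ ENNReal.ofReal (1 + t') := by
  have hK : 0 < K := one_pos.trans_le h.one_le
  obtain ⟨c, hc₀, hc⟩ := h.growth.exists_pow_le_mul_rpow_neg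
    (B := 2 * K ^ 2) (by positivity) (sub_pos.2 htt)
  refine dimH_le_of_ball_covers (by linarith)
    (C := ENNReal.ofReal (2 * (4 * 2 ^ (1 + t') * c))) ENNReal.ofReal_ne_top fun ε hε => ?_
  obtain ⟨N, hN⟩ := eventually_atTop.1
    ((eventually_ge_atTop n₀).and (h.growth.tendsto_one_div.eventually (gt_mem_nhds hε)))
  have hN₀ : ∀ {n}, N ≤ n → n₀ ≤ n := fun hn => (hN _ hn).1
  have hwG : ∀ {n z}, N ≤ n → z ∈ F → w n z ≤ 1 / G n := fun hn hz =>
    (h.width_le _ (hN₀ hn) _ hz).trans (h.one_div_scale_le (hN₀ hn) hz)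
  obtain ⟨B, hcount, hrad, hcov, hsum⟩ := h.exists_ball_cover_of_levels (N := N) (hN₀ le_rfl)
    (S := fun n => {z ∈ F | M n z ≤ w n z ^ (-t)}) (fun n => sep_subset _ _)
    (fun z hz => (frequently_atTop.1 (hF z hz) N).imp fun n hn => ⟨hn.1, hz, hn.2⟩)
    (ρ := w) (fun n hn z hz => h.width_pos n (hN₀ hn) z hz.1) (f := fun ρ => (2 * ρ) ^ (1 + t'))
    (fun n hn z hz => by
      have := h.width_pos n (hN₀ hn) z hz.1
      positivity) (D := 4 * 2 ^ (1 + t') * c) (by positivity)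
    (fun n hn z hz => card_mul_rpow_le hK (h.scale_pos (hN₀ hn) hz.1)
      (h.width_pos n (hN₀ hn) z hz.1) (h.width_le n (hN₀ hn) z hz.1)
      (h.mass_pos n (hN₀ hn) z hz.1) hz.2
      (hc n _ (h.width_pos n (hN₀ hn) z hz.1) (hwG hn hz.1)))
  refine ⟨B, hcount, fun p hp => ?_, hcov, hsum⟩
  obtain ⟨n, hn, z, hz, hpz⟩ := hrad p hp
  rw [hpz]
  exact ⟨(h.width_pos n (hN₀ hn) z hz.1).le, (hwG hn hz.1).trans (hN n hn).2.le⟩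

theorem upperBoxDim_le {L : ℝ}
    (hwM : ∀ n, n₀ ≤ n → ∀ z ∈ F, w n z * M n z = M (n + 1) z / P (n + 1) z)
    (ht₀ : 0 ≤ t) (ht₁ : t ≤ 1) (htt : t < t') (hMP : ∀ n, n₀ ≤ n → ∀ z ∈ F, M n z ≤ P n z ^ t)
    (hL : ∀ z ∈ F, P n₀ z ≤ L) :
    upperBoxDim F ≤ ENNReal.ofReal (1 + t') := by
  have hK : 0 < K := one_pos.trans_le h.one_le
  obtain ⟨ε, hε, htε⟩ : ∃ ε, 0 < ε ∧ t + ε < t' := ⟨(t' - t) / 2, by linarith, by linarith⟩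
  obtain ⟨c, hc₀, hc⟩ := h.growth.exists_pow_le_mul_rpow_neg (B := 2 * K ^ 2) (by positivity) hε
  refine upperBoxDim_le_of_externalCoveringNumber_le (C := 8 * c) (d := 1 + t + ε) (by linarith) ?_
  filter_upwards [eventually_coe_lt_nhdsGT_zero (δ := 1 / max L 1) (by positivity),
    self_mem_nhdsWithin] with r hrL (hr : (0 : ℝ) < r)
  have hcard : ∀ n, n₀ ≤ n → ∀ z ∈ {z ∈ F | 1 / P (n + 1) z ≤ r ∧ r < 1 / P n z},
      K ^ n * (1 / (P n z * r) + 1) * (w n z / r + 1) * 1 ≤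
        4 * c * (r : ℝ) ^ (-(1 + t + ε)) * ((2 * K) ^ n)⁻¹ * (1 / (P n z * M n z)) := by
    rintro n hn z ⟨hz, hrP', hrP⟩
    have hP := h.scale_pos hn hz
    have hM := h.mass_pos n hn z hz
    have hKn : K ^ n ≤ c * (r : ℝ) ^ (-ε) * ((2 * K) ^ n)⁻¹ := by
      rw [← div_eq_mul_inv, le_div_iff₀ (by positivity), ← mul_pow,
        show K * (2 * K) = 2 * K ^ 2 by ring]
      exact hc n r hr (hrP.le.trans (h.one_div_scale_le hn hz))
    calc K ^ n * (1 / (P n z * r) + 1) * (w n z / r + 1) * 1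
        ≤ 4 * K ^ n * (r : ℝ) ^ (-(1 + t)) * (1 / (P n z * M n z)) := by
          rw [mul_one]
          exact card_le_of_between hK hP (h.scale_pos (hn.trans n.le_succ) hz) hM hr
            (h.width_pos n hn z hz) hrP hrP' ht₀ ht₁ (hMP n hn z hz)
            (hMP _ (hn.trans n.le_succ) z hz) (hwM n hn z hz)
      _ ≤ 4 * (c * (r : ℝ) ^ (-ε) * ((2 * K) ^ n)⁻¹) * (r : ℝ) ^ (-(1 + t)) *
          (1 / (P n z * M n z)) := by gcongr
      _ = _ := by
          rw [show -(1 + t + ε) = -(1 + t) + -ε by ring, Real.rpow_add hr]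
          ring
  have hlevel : ∀ z ∈ F, ∃ n, n₀ ≤ n ∧ z ∈ {z ∈ F | 1 / P (n + 1) z ≤ r ∧ r < 1 / P n z} :=
    fun z hz => by
      have hPL : P n₀ z ≤ max L 1 := (hL z hz).trans (le_max_left L 1)
      obtain ⟨n, hn, hrn⟩ := h.exists_le_lt_one_div_scale hz hr
        (hrL.trans_le (one_div_le_one_div_of_le (h.scale_pos le_rfl hz) hPL))
      exact ⟨n, hn, hz, hrn⟩
  obtain ⟨B, -, hrad, hcov, hsum⟩ := h.exists_ball_cover_of_levels le_rfl
    (fun n => sep_subset _ _) hlevel (ρ := fun _ _ => r) (fun _ _ _ _ => hr) (f := fun _ => 1)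
    (fun _ _ _ _ => zero_le_one) (by positivity) hcard
  have hr' : ∀ p ∈ B, p.2 = r := fun p hp => (hrad p hp).elim fun _ ⟨_, _, _, hp⟩ => hp
  calc ((externalCoveringNumber r F : ℕ∞) : ℝ≥0∞) ≤ ((B.encard : ℕ∞) : ℝ≥0∞) := by
        exact_mod_cast externalCoveringNumber_le_of_ball_cover hr' hcov
    _ = ∑' _ : B, ENNReal.ofReal 1 := by rw [ENNReal.ofReal_one, ENNReal.tsum_set_one]
    _ ≤ ENNReal.ofReal (2 * (4 * c * (r : ℝ) ^ (-(1 + t + ε)))) := hsum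
    _ = ENNReal.ofReal (8 * c * (r : ℝ) ^ (-(1 + t + ε))) := by ring_nf

end Metric

end IsClassCover

end ClassCover

/-! ### Dimension bounds from measures -/

section MassDistribution

open MeasureTheory Set Metric

lemma measure_inter_le_mul_ediam_rpow {Z : Type*} [PseudoMetricSpace Z] [MeasurableSpace Z]
    {μ : Measure Z} {E S : Set Z} {C d r₀ : ℝ} (hC : 0 ≤ C) (hd : 0 < d) (hr₀ : 0 < r₀)
    (h : ∀ z ∈ E, ∀ r, 0 < r → r ≤ r₀ → μ (closedBall z r) ≤ ENNReal.ofReal (C * r ^ d))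
    (hS : ediam S ≤ ENNReal.ofReal r₀) : μ (S ∩ E) ≤ ENNReal.ofReal C * ediam S ^ d := by
  rcases (S ∩ E).eq_empty_or_nonempty with hempty | ⟨z, hzS, hzE⟩
  · simp only [hempty, measure_empty, zero_le]
  have hball : ∀ r : ℝ, 0 < r → r ≤ r₀ → ediam S ≤ ENNReal.ofReal r →
      μ (S ∩ E) ≤ ENNReal.ofReal (C * r ^ d) := fun r hr hr' hSr =>
    (measure_mono fun y hy => by
      rw [mem_closedBall, dist_edist]
      exact ENNReal.toReal_le_of_le_ofReal hr.le
        ((edist_le_ediam_of_mem hy.1 hzS).trans hSr)).trans (h z hzE r hr hr')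
  rcases eq_or_ne (ediam S) 0 with hzero | hne
  · have hlim : Tendsto (fun r : ℝ => ENNReal.ofReal (C * r ^ d)) (𝓝[>] 0) (𝓝 0) := by
      have hpow : Tendsto (fun r : ℝ => C * r ^ d) (𝓝[>] 0) (𝓝 (C * (0 : ℝ) ^ d)) :=
        ((tendsto_id.mono_left nhdsWithin_le_nhds).rpow_const (Or.inr hd.le)).const_mul C
      rw [Real.zero_rpow hd.ne', mul_zero] at hpow
      simpa using ENNReal.tendsto_ofReal hpow
    rw [hzero, ENNReal.zero_rpow_of_pos hd, mul_zero]
    refine ge_of_tendsto hlim ?_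
    filter_upwards [self_mem_nhdsWithin, Ioo_mem_nhdsGT hr₀] with r hr hr'
    exact hball r hr hr'.2.le (hzero.trans_le zero_le)
  · have hfin : ediam S ≠ ∞ := ne_top_of_le_ne_top ENNReal.ofReal_ne_top hS
    have hpos : 0 < (ediam S).toReal := ENNReal.toReal_pos hne hfin
    refine (hball _ hpos (ENNReal.toReal_le_of_le_ofReal hr₀.le hS)
      (ENNReal.ofReal_toReal hfin).ge).trans (le_of_eq ?_)
    rw [ENNReal.ofReal_mul hC, ← ENNReal.ofReal_rpow_of_pos hpos, ENNReal.ofReal_toReal hfin]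

lemma measure_le_mul_hausdorffMeasure {Z : Type*} [MetricSpace Z] [MeasurableSpace Z]
    [BorelSpace Z] {μ : Measure Z} {E : Set Z} {C d r₀ : ℝ} (hC : 0 < C) (hd : 0 < d)
    (hr₀ : 0 < r₀)
    (h : ∀ z ∈ E, ∀ r, 0 < r → r ≤ r₀ → μ (closedBall z r) ≤ ENNReal.ofReal (C * r ^ d)) :
    μ E ≤ ENNReal.ofReal C * μH[d] E := by
  have hle : OuterMeasure.restrict E μ.toOuterMeasure ≤
      OuterMeasure.mkMetric (ENNReal.ofReal C • fun δ : ℝ≥0∞ => δ ^ d) :=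
    OuterMeasure.le_mkMetric _ _ (ENNReal.ofReal r₀) (by simpa using hr₀) fun S hS => by
      rw [OuterMeasure.restrict_apply]
      exact measure_inter_le_mul_ediam_rpow hC.le hd hr₀ h hS
  rw [OuterMeasure.mkMetric_smul _ ENNReal.ofReal_ne_top (by simpa using hC)] at hle
  have hE := hle E
  rw [OuterMeasure.restrict_apply, inter_self, _root_.smul_apply, smul_eq_mul,
    ← Measure.mkMetric_toOuterMeasure] at hE
  exact hE

lemma measure_le_coveringNumber_mul {Z : Type*} [PseudoMetricSpace Z] [MeasurableSpace Z]
    {μ : Measure Z} {F S : Set Z} {r : ℝ≥0} {m : ℝ≥0∞} (hSF : S ⊆ F)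
    (hcov : coveringNumber r F ≠ ⊤) (h : ∀ z ∈ S, μ (closedBall z (2 * r)) ≤ m) :
    μ S ≤ ((coveringNumber r F : ℕ∞) : ℝ≥0∞) * m := by
  obtain ⟨D, -, hDfin, hDF, hDcard⟩ := exists_set_encard_eq_coveringNumber hcov
  rw [isCover_iff_subset_iUnion_closedBall] at hDF
  have hball : ∀ y, μ (closedBall y r ∩ S) ≤ m := fun y => by
    rcases (closedBall y r ∩ S).eq_empty_or_nonempty with hempty | ⟨z, hzy, hzS⟩
    · simp only [hempty, measure_empty, zero_le]
    refine (measure_mono fun x hx => ?_).trans (h z hzS)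
    rw [mem_closedBall, two_mul]
    exact (dist_triangle_right x z y).trans (add_le_add hx.1 hzy)
  calc μ S ≤ μ (⋃ y ∈ hDfin.toFinset, closedBall y r ∩ S) := measure_mono fun z hz => by
        obtain ⟨y, hy, hzy⟩ := mem_iUnion₂.1 (hDF (hSF hz))
        exact mem_iUnion₂.2 ⟨y, hDfin.mem_toFinset.2 hy, hzy, hz⟩
    _ ≤ ∑ y ∈ hDfin.toFinset, μ (closedBall y r ∩ S) := measure_biUnion_finset_le _ _
    _ ≤ ∑ _y ∈ hDfin.toFinset, m := Finset.sum_le_sum fun y _ => hball y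
    _ = ((coveringNumber r F : ℕ∞) : ℝ≥0∞) * m := by
        rw [Finset.sum_const, nsmul_eq_mul, ← hDcard, hDfin.encard_eq_coe_toFinset_card,
          ENat.toENNReal_coe]

lemma exists_dyadic_scale {r : ℝ} (hr₀ : 0 < r) {N : ℕ} (hr : r < (1 / 2) ^ N) :
    ∃ j, N ≤ j ∧ 2 * (1 / 2) ^ j ≤ r ∧ r ≤ 4 * (1 / 2) ^ j := by
  have hr₁ : r ≤ 1 := hr.le.trans (pow_le_one₀ (by norm_num) (by norm_num))
  obtain ⟨k, hk, hk'⟩ :=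
    exists_nat_pow_near_of_lt_one hr₀ hr₁ (one_half_pos (α := ℝ)) one_half_lt_one
  have hNk : N < k + 1 :=
    (pow_lt_pow_iff_right_of_lt_one₀ one_half_pos one_half_lt_one).1 (hk.trans hr)
  refine ⟨k + 2, by omega, ?_, ?_⟩
  · rw [pow_succ]
    linarith
  · rw [pow_add]
    linarith

lemma tendsto_dyadic_scale : Tendsto (fun j : ℕ => (1 / 2 : ℝ≥0) ^ j) atTop (𝓝[>] 0) :=
  tendsto_nhdsWithin_iff.2 ⟨NNReal.tendsto_pow_atTop_nhds_zero_of_lt_one (half_lt_self one_pos),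
    Eventually.of_forall fun j => mem_Ioi.2 (by positivity)⟩

lemma measure_eq_zero_of_upperBoxDim_lt {Z : Type*} [MetricSpace Z] [MeasurableSpace Z]
    {μ : Measure Z} {E F : Set Z} {C d d' : ℝ} (hC : 0 ≤ C) (hd : 0 ≤ d) (hdd : d' < d)
    (hEF : E ⊆ F) (hF : upperBoxDim F < ENNReal.ofReal d')
    (h : ∀ z ∈ E, ∀ ρ, 0 < ρ → ∃ r, 0 < r ∧ r < ρ ∧
      μ (closedBall z r) ≤ ENNReal.ofReal (C * r ^ d)) : μ E = 0 := by
  let s : ℕ → ℝ≥0 := fun j => (1 / 2) ^ j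
  let S : ℕ → Set Z := fun j =>
    {z ∈ E | μ (closedBall z (2 * s j)) ≤ ENNReal.ofReal (C * (4 * s j) ^ d)}
  have hs : ∀ j, (0 : ℝ) < s j := fun j => by positivity
  have hs' : ∀ j, (s j : ℝ) = (1 / 2) ^ j := fun j => by simp [s]
  obtain ⟨J, hJ⟩ := eventually_atTop.1
    (tendsto_dyadic_scale.eventually (eventually_coveringNumber_le_of_upperBoxDim_lt hF))
  have hS : ∀ j, J ≤ j →
      μ (S j) ≤ ENNReal.ofReal (C * 4 ^ d) * ENNReal.ofReal ((1 / 2) ^ (d - d')) ^ j := by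
    intro j hj
    have hN : ((coveringNumber (s j) F : ℕ∞) : ℝ≥0∞) ≤ ENNReal.ofReal ((s j : ℝ) ^ (-d')) :=
      hJ j hj
    have hfin : coveringNumber (s j) F ≠ ⊤ := fun htop => by simp [htop] at hN
    calc μ (S j)
        ≤ ((coveringNumber (s j) F : ℕ∞) : ℝ≥0∞) * ENNReal.ofReal (C * (4 * s j) ^ d) :=
          measure_le_coveringNumber_mul ((sep_subset _ _).trans hEF) hfin fun z hz => hz.2
      _ ≤ ENNReal.ofReal ((s j : ℝ) ^ (-d')) * ENNReal.ofReal (C * (4 * s j) ^ d) := by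
          gcongr
      _ = _ := by
          have hpow : ((1 / 2 : ℝ) ^ (d - d')) ^ j = (s j : ℝ) ^ (-d') * (s j : ℝ) ^ d := by
            rw [← Real.rpow_add (hs j), hs', neg_add_eq_sub]
            exact Real.rpow_pow_comm (by norm_num) _ _
          rw [← ENNReal.ofReal_pow (by positivity), ← ENNReal.ofReal_mul (by positivity),
            ← ENNReal.ofReal_mul (by positivity), hpow, Real.mul_rpow (by norm_num) (hs j).le]
          ring_nf
  have hlim : E ⊆ limsup (fun j => S (j + J)) atTop := fun z hz => by
    rw [mem_limsup_iff_frequently_mem, frequently_atTop]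
    intro N
    obtain ⟨r, hr, hrN, hzr⟩ := h z hz ((1 / 2) ^ (N + J)) (by positivity)
    obtain ⟨j, hNj, hjr, hrj⟩ := exists_dyadic_scale hr hrN
    rw [← hs'] at hjr hrj
    refine ⟨j - J, by omega, ?_⟩
    rw [Nat.sub_add_cancel (by omega)]
    refine ⟨hz, (measure_mono (closedBall_subset_closedBall hjr)).trans
      (hzr.trans (ENNReal.ofReal_le_ofReal ?_))⟩
    gcongr
  refine measure_mono_null hlim (measure_limsup_atTop_eq_zero (ne_top_of_le_ne_top ?_
    (ENNReal.tsum_le_tsum fun j => hS (j + J) (Nat.le_add_left J j))))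
  have hlt : ENNReal.ofReal ((1 / 2 : ℝ) ^ (d - d')) < 1 :=
    ENNReal.ofReal_lt_one.2 (Real.rpow_lt_one (by norm_num) (by norm_num) (by linarith))
  simp_rw [pow_add]
  rw [ENNReal.tsum_mul_left, ENNReal.tsum_mul_right, ENNReal.tsum_geometric]
  have := (tsub_pos_of_lt hlt).ne'
  finiteness

lemma le_packingDim_of_measure {Z : Type*} [MetricSpace Z] [MeasurableSpace Z]
    {μ : Measure Z} {E A : Set Z} {C d d' : ℝ} (hC : 0 ≤ C) (hd : 0 ≤ d) (hdd : d' < d)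
    (hEA : E ⊆ A) (hE : μ E ≠ 0)
    (h : ∀ z ∈ E, ∀ ρ, 0 < ρ → ∃ r, 0 < r ∧ r < ρ ∧
      μ (closedBall z r) ≤ ENNReal.ofReal (C * r ^ d)) :
    ENNReal.ofReal d' ≤ packingDim A := by
  refine le_iInf₂ fun F hF => ?_
  by_contra! hlt
  have hnull : ∀ i, μ (F i ∩ E) = 0 := fun i =>
    measure_eq_zero_of_upperBoxDim_lt hC hd hdd inter_subset_left
      ((le_iSup (fun i => upperBoxDim (F i)) i).trans_lt hlt) fun z hz => h z hz.2
  refine hE (measure_mono_null (fun z hz => ?_) (measure_iUnion_null hnull))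
  obtain ⟨i, hi⟩ := mem_iUnion.1 (hF (hEA hz))
  exact mem_iUnion.2 ⟨i, hi, hz⟩

end MassDistribution

section BallMass

open MeasureTheory Set Metric

/-- A mass distribution `μ` on `E` that is resolved at levels `n ≥ n₀`: at level `n` the point `z`
lies in a piece shaped like a rectangle with sides `1 / P n z` and `w n z`, which is divided into
squares of side `1 / P (n + 1) z` and mass `1 / (P (n + 1) z * M (n + 1) z)`; the field
`measure_closedBall_le` counts the squares met by a ball. All estimates are up to factors `K ^ n`,
which are harmless because `P n z` is at least the superexponential `G n`. -/
structure IsMassDistribution {Z : Type*} [PseudoMetricSpace Z] [MeasurableSpace Z] (μ : Measure Z)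
    (E : Set Z) (P M w : ℕ → Z → ℝ) (G : ℕ → ℝ) (K : ℝ) (n₀ : ℕ) : Prop where
  one_le : 1 ≤ K
  growth : IsSuperexponential G
  measure_ne_zero : μ E ≠ 0
  le_scale : ∀ n, n₀ ≤ n → ∀ z ∈ E, G n ≤ P n z
  scale_le_mul_succ : ∀ n, n₀ ≤ n → ∀ z ∈ E, P n z ≤ K * P (n + 1) z
  width_pos : ∀ n, n₀ ≤ n → ∀ z ∈ E, 0 < w n z
  one_div_le : ∀ n, n₀ ≤ n → ∀ z ∈ E, 1 / K ≤ w n z * P (n + 1) z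
  mass_pos : ∀ n, n₀ ≤ n → ∀ z ∈ E, 0 < M n z
  width_mul_mass : ∀ n, n₀ ≤ n → ∀ z ∈ E, w n z * M n z = M (n + 1) z / P (n + 1) z
  measure_closedBall_le : ∀ n, n₀ ≤ n → ∀ z ∈ E, ∀ r, 0 < r → K ^ n * r ≤ 1 / P n z →
    μ (closedBall z r) ≤ ENNReal.ofReal (K ^ n * (1 + P (n + 1) z * r) *
      (1 + min (P (n + 1) z * r) (w n z * P (n + 1) z)) / (P (n + 1) z * M (n + 1) z))

lemma rpow_mul_min_div_le {r w t : ℝ} (hr : 0 < r) (hw : 0 < w) (ht₀ : 0 ≤ t) (ht₁ : t ≤ 1) :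
    w ^ t * (min r w / w) ≤ r ^ t := by
  rcases le_total r w with hrw | hwr
  · have hpow : w ^ (t - 1) ≤ r ^ (t - 1) :=
      Real.rpow_le_rpow_of_nonpos hr hrw (by linarith)
    calc w ^ t * (min r w / w) = w ^ (t - 1) * r := by
          rw [min_eq_left hrw, Real.rpow_sub_one hw.ne']
          ring
      _ ≤ r ^ (t - 1) * r := by gcongr
      _ = r ^ t := by rw [Real.rpow_sub_one hr.ne', div_mul_cancel₀ _ hr.ne']
  · rw [min_eq_right hwr, div_self hw.ne', mul_one]
    exact Real.rpow_le_rpow hw.le hwr ht₀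

lemma one_add_le_two_mul_of_one_le_mul {A y : ℝ} (hA : 1 ≤ A) (hy : 0 ≤ y) (h : 1 ≤ A * y) :
    1 + y ≤ 2 * (A * y) := by
  linarith [le_mul_of_one_le_left hy hA]

lemma square_count_mul_mass_le_of_width {n : ℕ} {K M w P' M' t r : ℝ} (hK : 1 ≤ K) (hP' : 0 < P')
    (hM : 0 < M) (hr : 0 < r) (hw : 0 < w) (hKr : 1 / P' < K ^ (n + 1) * r)
    (hwP : 1 / K ≤ w * P') (hwM : w * M = M' / P') (ht₀ : 0 ≤ t) (ht₁ : t ≤ 1)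
    (hMw : w ^ (-t) ≤ K ^ n * M) :
    K ^ n * (1 + P' * r) * (1 + min (P' * r) (w * P')) / (P' * M') ≤
      4 * K ^ 2 * (K ^ 4) ^ n * r ^ (1 + t) := by
  have hK₀ : 0 < K := one_pos.trans_le hK
  have hKn : 1 ≤ K ^ (n + 1) := one_le_pow₀ hK
  have hM' : M' = w * M * P' := ((eq_div_iff hP'.ne').1 hwM).symm
  have hmin : min (P' * r) (w * P') = P' * min r w := by
    rw [mul_comm w, mul_min_of_nonneg _ _ hP'.le]
  have hminpos : 0 < min r w := lt_min hr hw
  have hlong : 1 ≤ K ^ (n + 1) * (P' * r) := by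
    rw [div_lt_iff₀ hP'] at hKr
    linarith
  have hshort : 1 ≤ K ^ (n + 1) * (P' * min r w) := by
    rw [← hmin, mul_min_of_nonneg _ _ (by positivity)]
    refine le_min hlong ?_
    rw [div_le_iff₀' hK₀] at hwP
    refine hwP.trans ?_
    gcongr
    exact le_self_pow₀ hK n.succ_ne_zero
  have hMt : 1 / M ≤ K ^ n * w ^ t := by
    rw [Real.rpow_neg hw.le, inv_le_iff_one_le_mul₀ (by positivity)] at hMw
    rw [div_le_iff₀ hM]
    linarith
  calc K ^ n * (1 + P' * r) * (1 + min (P' * r) (w * P')) / (P' * M')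
      ≤ K ^ n * (2 * (K ^ (n + 1) * (P' * r))) * (2 * (K ^ (n + 1) * (P' * min r w))) /
          (P' * M') := by
        have : 0 ≤ P' * M' := by
          rw [hM']
          positivity
        rw [hmin]
        gcongr
        · exact one_add_le_two_mul_of_one_le_mul hKn (by positivity) hlong
        · exact one_add_le_two_mul_of_one_le_mul hKn (by positivity) hshort
    _ = 4 * (K ^ n * K ^ (n + 1) * K ^ (n + 1)) * r * (min r w / w) * (1 / M) := by
        rw [hM']
        field_simp
        ring
    _ ≤ 4 * (K ^ n * K ^ (n + 1) * K ^ (n + 1)) * r * (min r w / w) * (K ^ n * w ^ t) := by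
        gcongr
    _ = 4 * K ^ 2 * (K ^ 4) ^ n * r * (w ^ t * (min r w / w)) := by ring
    _ ≤ 4 * K ^ 2 * (K ^ 4) ^ n * r * r ^ t := by
        gcongr
        exact rpow_mul_min_div_le hr hw ht₀ ht₁
    _ = 4 * K ^ 2 * (K ^ 4) ^ n * r ^ (1 + t) := by
        rw [Real.rpow_add hr, Real.rpow_one]
        ring

lemma square_count_mul_mass_le_of_scale {n : ℕ} {K P' M' m t r : ℝ} (hK : 1 ≤ K) (hP' : 0 < P')
    (hM' : 0 < M') (hm : 0 ≤ m) (hr : r = 1 / (K ^ (n + 1) * P')) (ht₁ : t ≤ 1)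
    (hPM : P' ^ t ≤ K ^ (n + 1) * M') :
    K ^ n * (1 + P' * r) * (1 + min (P' * r) m) / (P' * M') ≤
      4 * (K ^ 4) ^ (n + 1) * r ^ (1 + t) := by
  have : 0 < K := one_pos.trans_le hK
  have hr₀ : 0 < r := by
    rw [hr]
    positivity
  have hPr : P' * r ≤ 1 := by
    rw [hr, mul_one_div, div_le_one (by positivity)]
    exact le_mul_of_one_le_left hP'.le (one_le_pow₀ hK)
  have hmin : min (P' * r) m ≤ 1 := (min_le_left _ _).trans hPr
  have hinv : P'⁻¹ = K ^ (n + 1) * r := by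
    rw [hr]
    field_simp
  have hMt : 1 / M' ≤ K ^ (n + 1) * P'⁻¹ ^ t := by
    rw [Real.inv_rpow hP'.le, div_le_iff₀ hM', mul_right_comm, ← div_eq_mul_inv,
      one_le_div (by positivity)]
    exact hPM
  have hPt : P'⁻¹ ^ t ≤ K ^ (n + 1) * r ^ t := by
    rw [hinv, Real.mul_rpow (by positivity) hr₀.le]
    gcongr
    exact Real.rpow_le_self_of_one_le (one_le_pow₀ hK) ht₁
  calc K ^ n * (1 + P' * r) * (1 + min (P' * r) m) / (P' * M')
      ≤ K ^ (n + 1) * (1 + 1) * (1 + 1) / (P' * M') := by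
        have : 0 ≤ min (P' * r) m := le_min (by positivity) hm
        gcongr
        exact n.le_succ
    _ = 4 * K ^ (n + 1) * P'⁻¹ * (1 / M') := by
        field_simp
        ring
    _ ≤ 4 * K ^ (n + 1) * (K ^ (n + 1) * r) * (K ^ (n + 1) * (K ^ (n + 1) * r ^ t)) := by
        rw [hinv] at hMt hPt ⊢
        gcongr
        refine hMt.trans ?_
        gcongr
    _ = 4 * (K ^ 4) ^ (n + 1) * r ^ (1 + t) := by
        rw [Real.rpow_add hr₀, Real.rpow_one]
        ring

namespace IsMassDistribution

section PseudoMetric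

variable {Z : Type*} [PseudoMetricSpace Z] [MeasurableSpace Z] {μ : Measure Z} {E : Set Z}
  {P M w : ℕ → Z → ℝ} {G : ℕ → ℝ} {K t t' : ℝ} {n₀ : ℕ}
  (h : IsMassDistribution μ E P M w G K n₀)
include h

lemma scale_pos {n : ℕ} (hn : n₀ ≤ n) {z : Z} (hz : z ∈ E) : 0 < P n z :=
  (h.growth.pos n).trans_le (h.le_scale n hn z hz)

lemma one_div_scale_le {n : ℕ} (hn : n₀ ≤ n) {z : Z} (hz : z ∈ E) : 1 / P n z ≤ 1 / G n :=
  one_div_le_one_div_of_le (h.growth.pos n) (h.le_scale n hn z hz)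

lemma exists_le_one_div_scale_lt {j : ℕ} (hj : n₀ ≤ j) {z : Z} (hz : z ∈ E) {r : ℝ} (hr : 0 < r)
    (hjr : K ^ j * r ≤ 1 / P j z) :
    ∃ n, j ≤ n ∧ K ^ n * r ≤ 1 / P n z ∧ 1 / P (n + 1) z < K ^ (n + 1) * r := by
  by_contra! hne
  have hle : ∀ n, j ≤ n → K ^ n * r ≤ 1 / P n z := fun n hn => by
    induction n, hn using Nat.le_induction with
    | base => exact hjr
    | succ n hn ih => exact hne n hn ih
  obtain ⟨n, hn, hGr⟩ := ((eventually_ge_atTop j).and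
    (h.growth.tendsto_one_div.eventually (gt_mem_nhds hr))).exists
  refine (le_mul_of_one_le_left hr.le (one_le_pow₀ h.one_le)).not_gt
    (((hle n hn).trans (h.one_div_scale_le (hj.trans hn) hz)).trans_lt hGr)

lemma exists_measure_closedBall_le (ht₀ : 0 ≤ t) (ht₁ : t ≤ 1) (htt : t' < t) :
    ∃ C, 0 < C ∧ ∀ z ∈ E, ∀ j, n₀ ≤ j → (∀ n, j ≤ n → w n z ^ (-t) ≤ K ^ n * M n z) →
      ∀ r, 0 < r → K ^ j * r ≤ 1 / P j z →
        μ (closedBall z r) ≤ ENNReal.ofReal (C * r ^ (1 + t')) := by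
  have hK : 0 < K := one_pos.trans_le h.one_le
  obtain ⟨c, hc₀, hc⟩ := h.growth.exists_pow_le_mul_rpow_neg (B := K ^ 4) (by positivity)
    (sub_pos.2 htt)
  refine ⟨4 * K ^ 2 * c, by positivity, fun z hz j hj hwM r hr hjr => ?_⟩
  obtain ⟨n, hjn, hrn, hrn'⟩ := h.exists_le_one_div_scale_lt hj hz hr hjr
  have hn : n₀ ≤ n := hj.trans hjn
  have hrG : r ≤ 1 / G n := (le_mul_of_one_le_left hr.le (one_le_pow₀ h.one_le)).trans
    (hrn.trans (h.one_div_scale_le hn hz))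
  refine (h.measure_closedBall_le n hn z hz r hr hrn).trans (ENNReal.ofReal_le_ofReal ?_)
  calc _ ≤ 4 * K ^ 2 * (K ^ 4) ^ n * r ^ (1 + t) :=
        square_count_mul_mass_le_of_width h.one_le (h.scale_pos (hn.trans n.le_succ) hz)
          (h.mass_pos n hn z hz) hr (h.width_pos n hn z hz) hrn' (h.one_div_le n hn z hz)
          (h.width_mul_mass n hn z hz) ht₀ ht₁ (hwM n hjn)
    _ ≤ 4 * K ^ 2 * (c * r ^ (-(t - t'))) * r ^ (1 + t) := by
        gcongr
        exact hc n r hr hrG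
    _ = 4 * K ^ 2 * c * r ^ (1 + t') := by
        rw [show 1 + t' = -(t - t') + (1 + t) by ring, Real.rpow_add hr _ (1 + t)]
        ring

end PseudoMetric

variable {Z : Type*} [MetricSpace Z] [MeasurableSpace Z] {μ : Measure Z} {E A : Set Z}
  {P M w : ℕ → Z → ℝ} {G : ℕ → ℝ} {K t t' : ℝ} {n₀ : ℕ}
  (h : IsMassDistribution μ E P M w G K n₀)
include h

theorem le_dimH [BorelSpace Z] (ht₀ : 0 ≤ t) (ht₁ : t ≤ 1) (htt : t' < t) (ht' : 0 < 1 + t')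
    (hE : ∀ z ∈ E, ∀ᶠ n in atTop, w n z ^ (-t) ≤ K ^ n * M n z) :
    ENNReal.ofReal (1 + t') ≤ dimH E := by
  have hK : 0 < K := one_pos.trans_le h.one_le
  let S : ℕ × ℕ → Set Z := fun p =>
    {z ∈ E | n₀ ≤ p.1 ∧ (∀ n, p.1 ≤ n → w n z ^ (-t) ≤ K ^ n * M n z) ∧ P p.1 z ≤ p.2}
  have hES : E ⊆ ⋃ p, S p := fun z hz => by
    obtain ⟨j, hj⟩ := eventually_atTop.1 (hE z hz)
    obtain ⟨L, hL⟩ := exists_nat_ge (P (max j n₀) z)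
    exact mem_iUnion.2 ⟨(max j n₀, L), hz, le_max_right _ _,
      fun n hn => hj n ((le_max_left _ _).trans hn), hL⟩
  obtain ⟨⟨j, L⟩, hjL⟩ : ∃ p, μ (S p) ≠ 0 := by
    by_contra! hnull
    exact h.measure_ne_zero (measure_mono_null hES (measure_iUnion_null hnull))
  obtain ⟨C, hC₀, hC⟩ := h.exists_measure_closedBall_le ht₀ ht₁ htt
  have hmass := measure_le_mul_hausdorffMeasure (μ := μ) (E := S (j, L)) hC₀ ht'
    (r₀ := 1 / (K ^ j * (L + 1))) (by positivity) fun z ⟨hz, hj, hwM, hPL⟩ r hr hrr => by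
      refine hC z hz j hj hwM r hr ?_
      rw [le_div_iff₀ (by positivity)] at hrr
      rw [le_div_iff₀ (h.scale_pos hj hz)]
      calc K ^ j * r * P j z ≤ K ^ j * r * (L + 1) := by
            gcongr
            exact hPL.trans (lt_add_one _).le
        _ = r * (K ^ j * (L + 1)) := by ring
        _ ≤ 1 := hrr
  have hpos : μH[((⟨1 + t', ht'.le⟩ : ℝ≥0) : ℝ)] E ≠ 0 := fun hzero => by
    have hnull : μH[1 + t'] (S (j, L)) = 0 := measure_mono_null (sep_subset _ _) hzero
    rw [hnull, mul_zero] at hmass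
    exact hjL (le_antisymm hmass zero_le)
  refine le_trans (le_of_eq ?_) (le_dimH_of_hausdorffMeasure_ne_zero hpos)
  rw [ENNReal.ofReal, Real.toNNReal_of_nonneg ht'.le]
  rfl

theorem le_packingDim (hEA : E ⊆ A) (ht₁ : t ≤ 1) (htt : t' < t)
    (hE : ∀ z ∈ E, ∃ᶠ n in atTop, P n z ^ t ≤ K ^ n * M n z) :
    ENNReal.ofReal (1 + t') ≤ packingDim A := by
  have hK : 0 < K := one_pos.trans_le h.one_le
  obtain ⟨ε, hε, htε⟩ : ∃ ε, 0 < ε ∧ t' < t - ε := ⟨(t - t') / 2, by linarith, by linarith⟩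
  rcases lt_or_ge (1 + (t - ε)) 0 with hneg | hnonneg
  · rw [ENNReal.ofReal_of_nonpos (by linarith)]
    exact zero_le
  obtain ⟨c, hc₀, hc⟩ := h.growth.exists_pow_le_mul_rpow_neg (B := K ^ 4) (by positivity) hε
  refine le_packingDim_of_measure (C := 4 * c) (d := 1 + (t - ε)) (by positivity) hnonneg
    (by linarith) hEA h.measure_ne_zero fun z hz ρ hρ => ?_
  obtain ⟨m, hPM, hm, hGρ⟩ := ((hE z hz).and_eventually ((eventually_ge_atTop (n₀ + 1)).and
    (h.growth.tendsto_one_div.eventually (gt_mem_nhds hρ)))).exists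
  obtain ⟨n, rfl⟩ := Nat.exists_eq_succ_of_ne_zero (n := m) (by omega)
  have hn : n₀ ≤ n := by omega
  have hP := h.scale_pos (hn.trans n.le_succ) hz
  have hrG : 1 / (K ^ (n + 1) * P (n + 1) z) ≤ 1 / G (n + 1) :=
    one_div_le_one_div_of_le (h.growth.pos _) ((h.le_scale _ (hn.trans n.le_succ) z hz).trans
      (le_mul_of_one_le_left hP.le (one_le_pow₀ h.one_le)))
  have hr : 0 < 1 / (K ^ (n + 1) * P (n + 1) z) := by positivity
  have hrn : K ^ n * (1 / (K ^ (n + 1) * P (n + 1) z)) ≤ 1 / P n z := by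
    rw [pow_succ, mul_assoc, mul_one_div, div_mul_cancel_left₀ (by positivity), ← one_div]
    exact one_div_le_one_div_of_le (h.scale_pos hn hz) (h.scale_le_mul_succ n hn z hz)
  refine ⟨_, hr, hrG.trans_lt hGρ,
    (h.measure_closedBall_le n hn z hz _ hr hrn).trans (ENNReal.ofReal_le_ofReal ?_)⟩
  have hwP := mul_pos (h.width_pos n hn z hz) hP
  refine (square_count_mul_mass_le_of_scale h.one_le hP (h.mass_pos _ (hn.trans n.le_succ) z hz)
    hwP.le rfl ht₁ hPM).trans ?_
  set r := 1 / (K ^ (n + 1) * P (n + 1) z)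
  calc 4 * (K ^ 4) ^ (n + 1) * r ^ (1 + t) ≤ 4 * (c * r ^ (-ε)) * r ^ (1 + t) := by
        gcongr
        exact hc (n + 1) r hr hrG
    _ = 4 * c * r ^ (1 + (t - ε)) := by
        rw [show 1 + (t - ε) = -ε + (1 + t) by ring, Real.rpow_add hr _ (1 + t)]
        ring

end IsMassDistribution

end BallMass

/-! ### Sequences in `seqBox` -/

section AnnulusData

/-- The product `x 1 * ⋯ * x n` of the moduli along an orbit, which is the size of the derivative
of the `n`-th iterate. -/
noncomputable def modProd (x : ℕ → ℝ) (n : ℕ) : ℝ := ∏ k ∈ Finset.Icc 1 n, x k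

/-- The product `min(Δ_2, x_1) ⋯ min(Δ_{n+1}, x_n)`. Up to a factor `K ^ n`, an orbit with moduli
`x` passes through a box of a given generation with `min(Δ_{n+1}, x_n)` boxes of the next one. -/
noncomputable def minProd (a b x : ℕ → ℝ) (n : ℕ) : ℝ :=
  ∏ k ∈ Finset.Icc 1 n, min (annulusModulus a b (k + 1)) (x k)

/-- The quotient `min(Δ_{n+2}, x_{n+1}) / (x_1 ⋯ x_{n+1})`, which is the width of the pull-back
under the `n + 1`-st iterate of the part near a given point of the preimage under `exp` of
the next annulus. -/
noncomputable def stripWidth (a b x : ℕ → ℝ) (n : ℕ) : ℝ :=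
  min (annulusModulus a b (n + 2)) (x (n + 1)) / modProd x (n + 1)

/-- The assumptions on `lam`, `a`, `b` that do not involve admissibility: the annuli have moduli
bounded below by `D`, and their inner radii are eventually at least `1` and have products growing
faster than every geometric sequence. -/
structure AnnulusData (lam : ℕ → ℂ) (a b : ℕ → ℝ) (D : ℝ) : Prop where
  D_pos : 0 < D
  lam_ne : ∀ n, 1 ≤ n → lam n ≠ 0
  a_pos : ∀ n, 1 ≤ n → 0 < a n
  a_lt : ∀ n, 1 ≤ n → a n < b n
  growth : ∀ B : ℝ, ∀ᶠ n in atTop, B ^ n ≤ modProd a n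
  modulus : ∀ n, 1 ≤ n → D < annulusModulus a b n
  one_le_a : ∀ᶠ n in atTop, 1 ≤ a n

variable {lam : ℕ → ℂ} {a b x : ℕ → ℝ} {D : ℝ}

lemma modProd_succ (x : ℕ → ℝ) (n : ℕ) : modProd x (n + 1) = modProd x n * x (n + 1) :=
  Finset.prod_Icc_succ_top (by omega) _

lemma minProd_succ (a b x : ℕ → ℝ) (n : ℕ) :
    minProd a b x (n + 1) = minProd a b x n * min (annulusModulus a b (n + 2)) (x (n + 1)) :=
  Finset.prod_Icc_succ_top (by omega) _

lemma modProd_pos (hx : ∀ k, 1 ≤ k → 0 < x k) (n : ℕ) : 0 < modProd x n :=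
  Finset.prod_pos fun k hk => hx k (Finset.mem_Icc.1 hk).1

lemma one_le_pow_mul_minProd {K : ℝ} (hK : 0 < K)
    (hKx : ∀ k, 1 ≤ k → 1 / K ≤ min (annulusModulus a b (k + 1)) (x k)) (n : ℕ) :
    1 ≤ K ^ n * minProd a b x n := by
  induction n with
  | zero => simp [minProd]
  | succ n ih =>
    rw [minProd_succ, pow_succ, mul_mul_mul_comm]
    exact one_le_mul_of_one_le_of_one_le ih ((div_le_iff₀' hK).1 (hKx (n + 1) (by omega)))

lemma stripWidth_mul_minProd (a b x : ℕ → ℝ) (n : ℕ) :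
    stripWidth a b x n * minProd a b x n = minProd a b x (n + 1) / modProd x (n + 1) := by
  rw [minProd_succ, stripWidth]
  ring

namespace AnnulusData

variable (h : AnnulusData lam a b D)
include h

lemma isSuperexponential : IsSuperexponential (modProd a) :=
  ⟨modProd_pos h.a_pos, h.growth⟩

lemma exists_one_div_le_min : ∃ K : ℝ, 1 ≤ K ∧ ∀ x ∈ seqBox a b, ∀ k, 1 ≤ k →
    1 / K ≤ min (annulusModulus a b (k + 1)) (x k) := by
  obtain ⟨N, hN⟩ := eventually_atTop.1 h.one_le_a
  have hinv : ∀ k ∈ Finset.Icc 1 N, 0 ≤ 1 / a k := fun k hk =>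
    (one_div_pos.2 (h.a_pos k (Finset.mem_Icc.1 hk).1)).le
  have hsum := Finset.sum_nonneg hinv
  have hD := h.D_pos
  have hD' : 0 < 1 / D := by positivity
  refine ⟨1 + 1 / D + ∑ k ∈ Finset.Icc 1 N, 1 / a k, by linarith, fun x hx k hk => le_min ?_ ?_⟩
  · refine le_trans ?_ (h.modulus (k + 1) (by omega)).le
    rw [one_div_le (by positivity) hD]
    linarith
  · refine le_trans ?_ (hx k hk).1
    rw [one_div_le (by positivity) (h.a_pos k hk)]
    rcases le_total k N with hkN | hNk
    · linarith [Finset.single_le_sum hinv (Finset.mem_Icc.2 ⟨hk, hkN⟩)]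
    · linarith [(div_le_one (h.a_pos k hk)).2 (hN k hNk)]

variable (hx : x ∈ seqBox a b)
include hx

lemma x_pos (k : ℕ) (hk : 1 ≤ k) : 0 < x k := (h.a_pos k hk).trans_le (hx k hk).1

lemma min_pos (k : ℕ) (hk : 1 ≤ k) : 0 < min (annulusModulus a b (k + 1)) (x k) :=
  lt_min (h.D_pos.trans (h.modulus _ (by omega))) (h.x_pos hx k hk)

lemma modProd_le (n : ℕ) : modProd a n ≤ modProd x n :=
  Finset.prod_le_prod (fun k hk => (h.a_pos k (Finset.mem_Icc.1 hk).1).le)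
    fun k hk => (hx k (Finset.mem_Icc.1 hk).1).1

omit hx in
lemma eventually_one_lt_modProd : ∀ᶠ n in atTop, ∀ x ∈ seqBox a b, 1 < modProd x n := by
  filter_upwards [h.growth 2, eventually_ge_atTop 1] with n hn hn₁ x hx
  calc (1 : ℝ) < 2 ^ n := one_lt_pow₀ one_lt_two (by omega)
    _ ≤ modProd x n := hn.trans (h.modProd_le hx n)

lemma minProd_pos (n : ℕ) : 0 < minProd a b x n :=
  Finset.prod_pos fun k hk => h.min_pos hx k (Finset.mem_Icc.1 hk).1

lemma minProd_le_modProd (n : ℕ) : minProd a b x n ≤ modProd x n :=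
  Finset.prod_le_prod (fun k hk => (h.min_pos hx k (Finset.mem_Icc.1 hk).1).le)
    fun _ _ => min_le_right _ _

lemma stripWidth_pos (n : ℕ) : 0 < stripWidth a b x n :=
  div_pos (h.min_pos hx (n + 1) (by omega)) (modProd_pos (h.x_pos hx) _)

lemma stripWidth_le (n : ℕ) : stripWidth a b x n ≤ 1 / modProd x n := by
  have hx₀ := h.x_pos hx (n + 1) (by omega)
  have hP := modProd_pos (h.x_pos hx) n
  rw [stripWidth, modProd_succ, div_le_div_iff₀ (by positivity) hP, one_mul, mul_comm]
  exact mul_le_mul_of_nonneg_left (min_le_right _ _) hP.le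

lemma stripWidth_lt_one {n : ℕ} (hn : 1 < modProd x n) : stripWidth a b x n < 1 :=
  (h.stripWidth_le hx n).trans_lt ((div_lt_one (one_pos.trans hn)).2 hn)

lemma stripWidth_mul_modProd (n : ℕ) :
    stripWidth a b x n * modProd x (n + 1) = min (annulusModulus a b (n + 2)) (x (n + 1)) :=
  div_mul_cancel₀ _ (modProd_pos (h.x_pos hx) _).ne'

lemma phiRatio_succ (n : ℕ) :
    phiRatio a b (n + 1) x = Real.log (minProd a b x n) / -Real.log (stripWidth a b x n) := by
  rw [phiRatio, stripWidth, Real.log_div (h.min_pos hx (n + 1) (by omega)).ne'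
    (modProd_pos (h.x_pos hx) _).ne', neg_sub]
  rfl

lemma phiRatio_succ_le_iff {n : ℕ} (hn : 1 < modProd x n) {t : ℝ} :
    phiRatio a b (n + 1) x ≤ t ↔ minProd a b x n ≤ stripWidth a b x n ^ (-t) := by
  have hw := h.stripWidth_pos hx n
  have hlog := Real.log_neg hw (h.stripWidth_lt_one hx hn)
  rw [h.phiRatio_succ hx, div_le_iff₀ (neg_pos.2 hlog), mul_neg, ← neg_mul, ← Real.log_rpow hw,
    Real.log_le_log_iff (h.minProd_pos hx n) (by positivity)]

lemma le_phiRatio_succ_iff {n : ℕ} (hn : 1 < modProd x n) {t : ℝ} :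
    t ≤ phiRatio a b (n + 1) x ↔ stripWidth a b x n ^ (-t) ≤ minProd a b x n := by
  have hw := h.stripWidth_pos hx n
  have hlog := Real.log_neg hw (h.stripWidth_lt_one hx hn)
  rw [h.phiRatio_succ hx, le_div_iff₀ (neg_pos.2 hlog), mul_neg, ← neg_mul, ← Real.log_rpow hw,
    Real.log_le_log_iff (by positivity) (h.minProd_pos hx n)]

lemma psiRatio_le_iff {n : ℕ} (hn : 1 < modProd x n) {t : ℝ} :
    psiRatio a b n x ≤ t ↔ minProd a b x n ≤ modProd x n ^ t := by
  have hP : 0 < modProd x n := one_pos.trans hn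
  rw [← Real.log_le_log_iff (h.minProd_pos hx n) (by positivity), Real.log_rpow hP,
    ← div_le_iff₀ (Real.log_pos hn)]
  rfl

lemma le_psiRatio_iff {n : ℕ} (hn : 1 < modProd x n) {t : ℝ} :
    t ≤ psiRatio a b n x ↔ modProd x n ^ t ≤ minProd a b x n := by
  have hP : 0 < modProd x n := one_pos.trans hn
  rw [← Real.log_le_log_iff (by positivity) (h.minProd_pos hx n), Real.log_rpow hP,
    ← le_div_iff₀ (Real.log_pos hn)]
  rfl

lemma psiRatio_le_one {n : ℕ} (hn : 1 < modProd x n) : psiRatio a b n x ≤ 1 := by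
  rw [h.psiRatio_le_iff hx hn, Real.rpow_one]
  exact h.minProd_le_modProd hx n

lemma modProd_le_inv_stripWidth (n : ℕ) : modProd x n ≤ (stripWidth a b x n)⁻¹ := by
  rw [le_inv_comm₀ (modProd_pos (h.x_pos hx) n) (h.stripWidth_pos hx n), ← one_div]
  exact h.stripWidth_le hx n

lemma phiRatio_succ_le_one {n : ℕ} (hn : 1 < modProd x n) : phiRatio a b (n + 1) x ≤ 1 := by
  rw [h.phiRatio_succ_le_iff hx hn, Real.rpow_neg_one]
  exact (h.minProd_le_modProd hx n).trans (h.modProd_le_inv_stripWidth hx n)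

omit hx in
lemma eventually_rpow_neg_le_minProd {ε : ℝ} (hε : 0 < ε) :
    ∀ᶠ n in atTop, ∀ x ∈ seqBox a b, ∀ y, modProd x n ≤ y → y ^ (-ε) ≤ minProd a b x n := by
  obtain ⟨K, hK₁, hK⟩ := h.exists_one_div_le_min
  have hK₀ : 0 < K := one_pos.trans_le hK₁
  filter_upwards [h.isSuperexponential.eventually_pow_le_rpow hK₀ hε] with n hn x hx y hy
  have hy₀ : 0 < y := (modProd_pos (h.x_pos hx) n).trans_le hy
  rw [Real.rpow_neg hy₀.le, inv_le_iff_one_le_mul₀ (by positivity)]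
  calc 1 ≤ K ^ n * minProd a b x n := one_le_pow_mul_minProd hK₀ (hK x hx) n
    _ ≤ modProd a n ^ ε * minProd a b x n :=
        mul_le_mul_of_nonneg_right hn (h.minProd_pos hx n).le
    _ ≤ y ^ ε * minProd a b x n :=
        mul_le_mul_of_nonneg_right (Real.rpow_le_rpow (h.isSuperexponential.pos n).le
          ((h.modProd_le hx n).trans hy) hε.le) (h.minProd_pos hx n).le
    _ = minProd a b x n * y ^ ε := mul_comm _ _

lemma liminf_phiRatio_nonneg :
    (0 : EReal) ≤ liminf (fun n : ℕ => (phiRatio a b n x : EReal)) atTop := by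
  refine le_of_forall_lt fun c hc => ?_
  obtain ⟨s, hcs, hs⟩ := EReal.lt_iff_exists_real_btwn.1 hc
  have hs₀ : 0 < -s := neg_pos.2 (by exact_mod_cast hs)
  refine hcs.trans_le ?_
  rw [← liminf_nat_add _ 1]
  refine le_liminf_of_le (by isBoundedDefault) ?_
  filter_upwards [h.eventually_rpow_neg_le_minProd hs₀, h.eventually_one_lt_modProd]
    with n hmin hP
  have hw := h.stripWidth_pos hx n
  have hle := hmin x hx _ (h.modProd_le_inv_stripWidth hx n)
  rw [Real.inv_rpow hw.le, ← Real.rpow_neg hw.le, neg_neg] at hle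
  exact_mod_cast (h.le_phiRatio_succ_iff hx (hP x hx)).2 hle

lemma limsup_psiRatio_nonneg :
    (0 : EReal) ≤ limsup (fun n : ℕ => (psiRatio a b n x : EReal)) atTop := by
  refine le_of_forall_lt fun c hc => ?_
  obtain ⟨s, hcs, hs⟩ := EReal.lt_iff_exists_real_btwn.1 hc
  have hs₀ : 0 < -s := neg_pos.2 (by exact_mod_cast hs)
  have hev : ∀ᶠ n in atTop, ((s : ℝ) : EReal) ≤ psiRatio a b n x := by
    filter_upwards [h.eventually_rpow_neg_le_minProd hs₀, h.eventually_one_lt_modProd]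
      with n hmin hP
    have hle := hmin x hx _ le_rfl
    rw [neg_neg, ← h.le_psiRatio_iff hx (hP x hx)] at hle
    exact_mod_cast hle
  exact hcs.trans_le (le_limsup_of_frequently_le hev.frequently (by isBoundedDefault))

end AnnulusData

end AnnulusData

/-! ### Itineraries -/

section Itinerary

variable {lam : ℕ → ℂ} {a b : ℕ → ℝ}

lemma nonautExp_succ (lam : ℕ → ℂ) (k : ℕ) (z : ℂ) :
    nonautExp lam (k + 1) z = lam (k + 1) * Complex.exp (nonautExp lam k z) := rfl

lemma norm_nonautExp_succ (lam : ℕ → ℂ) (k : ℕ) (z : ℂ) :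
    ‖nonautExp lam (k + 1) z‖ = ‖lam (k + 1)‖ * Real.exp (nonautExp lam k z).re := by
  rw [nonautExp_succ, norm_mul, Complex.norm_exp]

lemma norm_nonautExp_pos (hlam : ∀ n, 1 ≤ n → lam n ≠ 0) (k : ℕ) (hk : 1 ≤ k) (z : ℂ) :
    0 < ‖nonautExp lam k z‖ := by
  obtain ⟨k, rfl⟩ : ∃ m, k = m + 1 := Nat.exists_eq_succ_of_ne_zero (by omega)
  rw [norm_nonautExp_succ]
  exact mul_pos (norm_pos_iff.2 (hlam _ hk)) (Real.exp_pos _)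

/-- The index of the cell of the square grid of mesh `1 / h` which contains `w`. -/
noncomputable def gridCell (h : ℝ) (w : ℂ) : ℤ × ℤ := (⌊h * w.re⌋, ⌊h * w.im⌋)

/-- The grid cell containing the `k`-th point of the orbit of `z`. The mesh `1 / 4` is small enough
for `exp` to have small distortion on a cell. -/
noncomputable def orbitCell (lam : ℕ → ℂ) (k : ℕ) (z : ℂ) : ℤ × ℤ :=
  gridCell 4 (nonautExp lam k z)

/-- The itinerary of `z` up to time `n`: the list of grid cells visited by its orbit. -/
noncomputable def itinerary (lam : ℕ → ℂ) (n : ℕ) (z : ℂ) : List (ℤ × ℤ) :=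
  (List.range (n + 1)).map fun k => orbitCell lam k z

/-- The sequence of moduli of the orbit of `z` after time `N`. The terms up to time `N`, when the
orbit need not be in the annuli, are replaced by those of `a`, so that the sequence lies
in `seqBox a b`. -/
noncomputable def orbitSeq (lam : ℕ → ℂ) (a : ℕ → ℝ) (N : ℕ) (z : ℂ) (k : ℕ) : ℝ :=
  if k ≤ N then a k else ‖nonautExp lam k z‖

lemma itinerary_eq_iff {n : ℕ} {z z' : ℂ} :
    itinerary lam n z = itinerary lam n z' ↔ ∀ k ≤ n, orbitCell lam k z = orbitCell lam k z' := by
  simp only [itinerary, List.map_inj_left, List.mem_range, Nat.lt_succ_iff]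

lemma orbitSeq_of_le {N k : ℕ} {z : ℂ} (hk : k ≤ N) : orbitSeq lam a N z k = a k := if_pos hk

lemma orbitSeq_of_lt {N k : ℕ} {z : ℂ} (hk : N < k) :
    orbitSeq lam a N z k = ‖nonautExp lam k z‖ := if_neg (not_le.2 hk)

lemma modProd_orbitSeq_self {N : ℕ} {z : ℂ} : modProd (orbitSeq lam a N z) N = modProd a N :=
  Finset.prod_congr rfl fun _ hk => orbitSeq_of_le (Finset.mem_Icc.1 hk).2

lemma minProd_orbitSeq_self {N : ℕ} {z : ℂ} :
    minProd a b (orbitSeq lam a N z) N = minProd a b a N :=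
  Finset.prod_congr rfl fun _ hk => by rw [orbitSeq_of_le (Finset.mem_Icc.1 hk).2]

lemma norm_sub_le_of_gridCell_eq {h : ℝ} (hh : 0 < h) {w w' : ℂ}
    (hc : gridCell h w = gridCell h w') : ‖w - w'‖ ≤ 2 / h := by
  simp only [gridCell, Prod.mk.injEq] at hc
  have hre := Int.abs_sub_lt_one_of_floor_eq_floor hc.1
  have him := Int.abs_sub_lt_one_of_floor_eq_floor hc.2
  rw [← mul_sub, abs_mul, abs_of_pos hh] at hre him
  rw [le_div_iff₀ hh, mul_comm]
  calc h * ‖w - w'‖ ≤ h * (|w.re - w'.re| + |w.im - w'.im|) := by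
        gcongr
        exact Complex.norm_le_abs_re_add_abs_im (w - w')
    _ ≤ 2 := by linarith

lemma card_Icc_floor_le {u v : ℝ} (huv : 0 ≤ v - u + 2) :
    ((Finset.Icc ⌊u⌋ ⌊v⌋).card : ℝ) ≤ v - u + 2 := by
  rw [Int.card_Icc, ← Int.cast_natCast (R := ℝ), Int.toNat_eq_max]
  push_cast
  exact max_le (by linarith [Int.floor_le v, Int.lt_floor_add_one u]) huv

lemma exists_finset_gridCell {h α β Y : ℝ} (hh : 0 < h) (hαβ : α ≤ β) (hY : 0 ≤ Y) :
    ∃ T : Finset (ℤ × ℤ), (∀ w : ℂ, α ≤ w.re → w.re ≤ β → ‖w‖ ≤ Y → gridCell h w ∈ T) ∧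
      (T.card : ℝ) ≤ (h * min (β - α) (2 * Y) + 2) * (2 * h * Y + 2) := by
  refine ⟨Finset.Icc ⌊h * max α (-Y)⌋ ⌊h * min β Y⌋ ×ˢ Finset.Icc ⌊h * (-Y)⌋ ⌊h * Y⌋,
    fun w hα hβ hw => ?_, ?_⟩
  · have hre := abs_le.1 ((Complex.abs_re_le_norm w).trans hw)
    have him := abs_le.1 ((Complex.abs_im_le_norm w).trans hw)
    simp only [gridCell, Finset.mem_product, Finset.mem_Icc]
    exact ⟨⟨Int.floor_le_floor (mul_le_mul_of_nonneg_left (max_le hα hre.1) hh.le),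
      Int.floor_le_floor (mul_le_mul_of_nonneg_left (le_min hβ hre.2) hh.le)⟩,
      Int.floor_le_floor (mul_le_mul_of_nonneg_left him.1 hh.le),
      Int.floor_le_floor (mul_le_mul_of_nonneg_left him.2 hh.le)⟩
  · have : 0 ≤ min (β - α) (2 * Y) := le_min (by linarith) (by linarith)
    have hwidth : h * min β Y - h * max α (-Y) ≤ h * min (β - α) (2 * Y) := by
      rw [← mul_sub]
      refine mul_le_mul_of_nonneg_left (le_min ?_ ?_) hh.le
      · linarith [min_le_left β Y, le_max_left α (-Y)]
      · linarith [min_le_right β Y, le_max_right α (-Y)]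
    have hre : ((Finset.Icc ⌊h * max α (-Y)⌋ ⌊h * min β Y⌋).card : ℝ) ≤
        h * min (β - α) (2 * Y) + 2 := by
      by_cases hle : ⌊h * max α (-Y)⌋ ≤ ⌊h * min β Y⌋
      · refine (card_Icc_floor_le ?_).trans (by linarith)
        have : (⌊h * max α (-Y)⌋ : ℝ) ≤ ⌊h * min β Y⌋ := by exact_mod_cast hle
        linarith [Int.floor_le (h * min β Y), Int.lt_floor_add_one (h * max α (-Y))]
      · rw [Finset.Icc_eq_empty hle, Finset.card_empty, Nat.cast_zero]
        positivity
    have him : ((Finset.Icc ⌊h * (-Y)⌋ ⌊h * Y⌋).card : ℝ) ≤ 2 * h * Y + 2 :=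
      (card_Icc_floor_le (by nlinarith)).trans (by linarith)
    rw [Finset.card_product, Nat.cast_mul]
    exact mul_le_mul hre him (Nat.cast_nonneg _) (by positivity)

lemma norm_nonautExp_succ_le_two_mul {k : ℕ} {z z' : ℂ}
    (hc : orbitCell lam k z = orbitCell lam k z') :
    ‖nonautExp lam (k + 1) z‖ ≤ 2 * ‖nonautExp lam (k + 1) z'‖ := by
  have hre : (nonautExp lam k z).re - (nonautExp lam k z').re ≤ 2 / 4 :=
    (Complex.re_le_norm _).trans (norm_sub_le_of_gridCell_eq (by norm_num) hc)
  have hexp : Real.exp (nonautExp lam k z).re ≤ 2 * Real.exp (nonautExp lam k z').re := by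
    rw [← Real.exp_log (show (0 : ℝ) < 2 by norm_num), ← Real.exp_add]
    exact Real.exp_le_exp.2 (by linarith [Real.log_two_gt_d9])
  rw [norm_nonautExp_succ, norm_nonautExp_succ, mul_left_comm]
  gcongr

lemma norm_le_two_mul_norm_exp_sub_one {w : ℂ} (hw : ‖w‖ ≤ 1 / 2) :
    ‖w‖ ≤ 2 * ‖Complex.exp w - 1‖ := by
  have hquad := Complex.norm_exp_sub_one_sub_id_le (x := w) (by linarith)
  have htri : ‖w‖ ≤ ‖Complex.exp w - 1‖ + ‖Complex.exp w - 1 - w‖ := by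
    simpa only [sub_sub_cancel] using norm_sub_le (Complex.exp w - 1) (Complex.exp w - 1 - w)
  nlinarith [norm_nonneg w]

lemma norm_sub_le_of_orbitCell_eq (hlam : ∀ n, 1 ≤ n → lam n ≠ 0) {k : ℕ} {z z' : ℂ}
    (hc : orbitCell lam k z = orbitCell lam k z') :
    ‖nonautExp lam k z - nonautExp lam k z'‖ ≤ 2 / ‖nonautExp lam (k + 1) z'‖ *
      ‖nonautExp lam (k + 1) z - nonautExp lam (k + 1) z'‖ := by
  have hpos := norm_nonautExp_pos hlam (k + 1) (by omega) z'
  have hdist : ‖nonautExp lam k z - nonautExp lam k z'‖ ≤ 1 / 2 :=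
    (norm_sub_le_of_gridCell_eq (by norm_num) hc).trans (by norm_num)
  have hfactor : nonautExp lam (k + 1) z - nonautExp lam (k + 1) z' =
      nonautExp lam (k + 1) z' * (Complex.exp (nonautExp lam k z - nonautExp lam k z') - 1) := by
    rw [nonautExp_succ, nonautExp_succ, Complex.exp_sub]
    field_simp [Complex.exp_ne_zero]
  rw [hfactor, norm_mul, ← mul_assoc, div_mul_cancel₀ _ hpos.ne']
  exact norm_le_two_mul_norm_exp_sub_one hdist

lemma norm_sub_le_prod (hlam : ∀ n, 1 ≤ n → lam n ≠ 0) {y z z' : ℂ} (n : ℕ)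
    (hc : ∀ k < n, orbitCell lam k z = orbitCell lam k y)
    (hc' : ∀ k < n, orbitCell lam k z' = orbitCell lam k y) :
    ‖z - z'‖ ≤ (∏ k ∈ Finset.Icc 1 n, 4 / ‖nonautExp lam k y‖) *
      ‖nonautExp lam n z - nonautExp lam n z'‖ := by
  induction n with
  | zero => simp [nonautExp]
  | succ n ih =>
    have hratio : 2 / ‖nonautExp lam (n + 1) z'‖ ≤ 4 / ‖nonautExp lam (n + 1) y‖ := by
      rw [div_le_div_iff₀ (norm_nonautExp_pos hlam (n + 1) (by omega) z')
        (norm_nonautExp_pos hlam (n + 1) (by omega) y)]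
      linarith [norm_nonautExp_succ_le_two_mul (hc' n (by omega)).symm]
    have hcell : orbitCell lam n z = orbitCell lam n z' :=
      (hc n (by omega)).trans (hc' n (by omega)).symm
    refine (ih (fun k hk => hc k (by omega)) fun k hk => hc' k (by omega)).trans ?_
    rw [Finset.prod_Icc_succ_top (by omega), mul_assoc]
    refine mul_le_mul_of_nonneg_left ?_ (Finset.prod_nonneg fun k _ => by positivity)
    exact (norm_sub_le_of_orbitCell_eq hlam hcell).trans (by gcongr)

-- Each level of the tree of itineraries contributes a factor `κ⁻¹` with at most `κ` branches.
lemma sum_prod_inv_le_one {Z α : Type*} [DecidableEq α] {c : ℕ → Z → α} {κ : ℕ → α → ℝ}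
    {F : Set Z} {N : ℕ} (hκ₀ : ∀ k q, 0 ≤ κ k q)
    (hκ : ∀ k, N ≤ k → ∀ q, ∀ S : Finset Z, (S : Set Z) ⊆ F → (∀ z ∈ S, c k z = q) →
      ((S.image (c (k + 1))).card : ℝ) ≤ κ k q) (j : ℕ) :
    ∀ k, N ≤ k → ∀ q, ∀ S : Finset Z, (S : Set Z) ⊆ F → (∀ z ∈ S, c k z = q) →
      (∀ z ∈ S, ∀ z' ∈ S, (∀ i, k < i → i ≤ k + j → c i z = c i z') → z = z') →
      ∑ z ∈ S, ∏ i ∈ Finset.range j, (κ (k + i) (c (k + i) z))⁻¹ ≤ 1 := by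
  induction j with
  | zero =>
    intro k _ q S _ _ hinj
    have hcard : S.card ≤ 1 := Finset.card_le_one.2 fun z hz z' hz' =>
      hinj z hz z' hz' fun i hi hi' => by omega
    simpa only [Finset.range_zero, Finset.prod_empty, Finset.sum_const, nsmul_eq_mul, mul_one,
      Nat.cast_le_one] using hcard
  | succ j ih =>
    intro k hk q S hSF hSq hinj
    have hbranch : ∀ q' ∈ S.image (c (k + 1)), ∑ z ∈ S with c (k + 1) z = q',
        ∏ i ∈ Finset.range j, (κ (k + 1 + i) (c (k + 1 + i) z))⁻¹ ≤ 1 := by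
      refine fun q' _ => ih (k + 1) (by omega) q' _
        (fun z hz => hSF (Finset.mem_filter.1 hz).1) (fun z hz => (Finset.mem_filter.1 hz).2) ?_
      intro z hz z' hz' heq
      rw [Finset.mem_filter] at hz hz'
      refine hinj z hz.1 z' hz'.1 fun i hi hi' => ?_
      rcases eq_or_ne i (k + 1) with rfl | hne
      · rw [hz.2, hz'.2]
      · exact heq i (by omega) (by omega)
    calc ∑ z ∈ S, ∏ i ∈ Finset.range (j + 1), (κ (k + i) (c (k + i) z))⁻¹
        = (κ k q)⁻¹ * ∑ z ∈ S, ∏ i ∈ Finset.range j, (κ (k + 1 + i) (c (k + 1 + i) z))⁻¹ := by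
          rw [Finset.mul_sum]
          refine Finset.sum_congr rfl fun z hz => ?_
          simp only [Finset.prod_range_succ', add_zero, hSq z hz, mul_comm, add_assoc,
            add_comm 1]
      _ = (κ k q)⁻¹ * ∑ q' ∈ S.image (c (k + 1)), ∑ z ∈ S with c (k + 1) z = q',
            ∏ i ∈ Finset.range j, (κ (k + 1 + i) (c (k + 1 + i) z))⁻¹ := by
          rw [Finset.sum_fiberwise_of_maps_to fun z hz => Finset.mem_image_of_mem _ hz]
      _ ≤ 1 := inv_mul_le_one_of_le₀ ((Finset.sum_le_card_nsmul _ _ 1 hbranch).trans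
          (by simpa only [nsmul_eq_mul, mul_one] using hκ k hk q S hSF hSq)) (hκ₀ k q)

end Itinerary

section ItineraryCover

open Set Metric

/-- The points whose orbit stays in the annuli from time `N` on and whose itinerary up to time `N`
is `σ`. These countably many sets, for varying `N` and `σ`, cover `escapeRateSet lam a b`. -/
def itineraryPiece (lam : ℕ → ℂ) (a b : ℕ → ℝ) (N : ℕ) (σ : List (ℤ × ℤ)) : Set ℂ :=
  {z | (∀ n, N ≤ n → a n ≤ ‖nonautExp lam n z‖ ∧ ‖nonautExp lam n z‖ ≤ b n) ∧
    itinerary lam N z = σ}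

/-- The modulus of the image under `E_{lam (k + 1)}` of the left edge of the cell `q` of the grid
of mesh `1 / 4`. It agrees up to a factor `2` with the modulus of the image of any point
of the cell. -/
noncomputable def cellModulus (lam : ℕ → ℂ) (k : ℕ) (q : ℤ × ℤ) : ℝ :=
  ‖lam (k + 1)‖ * Real.exp ((q.1 : ℝ) / 4)

/-- Up to a constant, the number of cells that can be visited at time `k + 1` by orbits in the
annuli which visit the cell `q` at time `k`: these cells meet the intersection of a vertical strip
of width `Δ_{k+2}` with a disc of radius `2 * cellModulus lam k q`. -/
noncomputable def cellBranching (lam : ℕ → ℂ) (a b : ℕ → ℝ) (k : ℕ) (q : ℤ × ℤ) : ℝ :=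
  cellModulus lam k q * min (annulusModulus a b (k + 2)) (cellModulus lam k q)

lemma cellModulus_nonneg (lam : ℕ → ℂ) (k : ℕ) (q : ℤ × ℤ) : 0 ≤ cellModulus lam k q := by
  unfold cellModulus
  positivity

lemma cellModulus_le (lam : ℕ → ℂ) (k : ℕ) (z : ℂ) :
    cellModulus lam k (orbitCell lam k z) ≤ ‖nonautExp lam (k + 1) z‖ := by
  simp only [norm_nonautExp_succ, cellModulus, orbitCell, gridCell]
  gcongr
  linarith [Int.floor_le (4 * (nonautExp lam k z).re)]

lemma norm_nonautExp_le_two_mul_cellModulus (lam : ℕ → ℂ) (k : ℕ) (z : ℂ) :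
    ‖nonautExp lam (k + 1) z‖ ≤ 2 * cellModulus lam k (orbitCell lam k z) := by
  have hexp : Real.exp (nonautExp lam k z).re ≤
      2 * Real.exp ((⌊4 * (nonautExp lam k z).re⌋ : ℝ) / 4) := by
    rw [← Real.exp_log (show (0 : ℝ) < 2 by norm_num), ← Real.exp_add]
    exact Real.exp_le_exp.2
      (by linarith [Int.lt_floor_add_one (4 * (nonautExp lam k z).re), Real.log_two_gt_d9])
  simp only [norm_nonautExp_succ, cellModulus, orbitCell, gridCell]
  rw [mul_left_comm]
  gcongr

lemma min_mul_le_mul_min {x y c : ℝ} (hc : 1 ≤ c) (hx : 0 ≤ x) : min x (c * y) ≤ c * min x y := by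
  rw [mul_min_of_nonneg _ _ (by linarith)]
  exact min_le_min (le_mul_of_one_le_left hx hc) le_rfl

lemma strip_cell_count_le {Δ X δ : ℝ} (hδ : 0 < δ) (hδm : δ ≤ min Δ X) (hX : 1 / 2 ≤ X) :
    (4 * min Δ (2 * (2 * X)) + 2) * (2 * 4 * (2 * X) + 2) ≤
      20 * (16 + 2 / δ) * (X * min Δ X) := by
  have hm : 0 < min Δ X := hδ.trans_le hδm
  have hmin : min Δ (2 * (2 * X)) ≤ 4 * min Δ X := by
    rw [show 2 * (2 * X) = 4 * X by ring]
    exact min_mul_le_mul_min (by norm_num) (hm.le.trans (min_le_left _ _))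
  have htwo : 2 ≤ 2 / δ * min Δ X := by
    rw [div_mul_eq_mul_div, le_div_iff₀ hδ]
    linarith
  calc (4 * min Δ (2 * (2 * X)) + 2) * (2 * 4 * (2 * X) + 2)
      ≤ (4 * (4 * min Δ X) + 2 / δ * min Δ X) * (20 * X) := by
        gcongr
        linarith
    _ = 20 * (16 + 2 / δ) * (X * min Δ X) := by ring

lemma strip_ball_count_le {n : ℕ} {c P y m μ r η : ℝ} (hn : 1 ≤ n) (hc : 0 ≤ c) (hP : 0 < P)
    (hy : 0 < y) (hm : 0 < m) (hμ₀ : 0 ≤ μ) (hμ : μ ≤ 4 * m) (hr : 0 < r)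
    (hη₀ : 0 < η) (hη : η ≤ 8 * 4 ^ n * c / (P * y * r)) :
    (η * μ + 2) * (2 * η * (2 * y) + 2) ≤
      (((32 * c + 2) * 4) ^ 2) ^ n * (1 / (P * r) + 1) * (m / (P * y) / r + 1) := by
  have hpow : (32 * c + 2) * 4 ^ n ≤ ((32 * c + 2) * 4) ^ n := by
    rw [mul_pow]
    gcongr
    exact le_self_pow₀ (by linarith) (by omega)
  have hone : (1 : ℝ) ≤ 4 ^ n := one_le_pow₀ (by norm_num)
  have hlin : ∀ s : ℝ, 0 ≤ s → 32 * c * 4 ^ n * s + 2 ≤ ((32 * c + 2) * 4) ^ n * (s + 1) :=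
    fun s hs => calc
      32 * c * 4 ^ n * s + 2 ≤ (32 * c + 2) * 4 ^ n * (s + 1) := by
        nlinarith [mul_nonneg hc (zero_le_one.trans hone),
          mul_nonneg hs (zero_le_one.trans hone)]
      _ ≤ ((32 * c + 2) * 4) ^ n * (s + 1) := by gcongr
  have hwidth : η * μ + 2 ≤ ((32 * c + 2) * 4) ^ n * (m / (P * y) / r + 1) := by
    refine le_trans ?_ (hlin _ (by positivity))
    calc η * μ + 2 ≤ 8 * 4 ^ n * c / (P * y * r) * (4 * m) + 2 := by gcongr
      _ = 32 * c * 4 ^ n * (m / (P * y) / r) + 2 := by field_simp; ring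
  have hheight : 2 * η * (2 * y) + 2 ≤ ((32 * c + 2) * 4) ^ n * (1 / (P * r) + 1) := by
    refine le_trans ?_ (hlin _ (by positivity))
    calc 2 * η * (2 * y) + 2 ≤ 2 * (8 * 4 ^ n * c / (P * y * r)) * (2 * y) + 2 := by gcongr
      _ = 32 * c * 4 ^ n * (1 / (P * r)) + 2 := by field_simp; ring
  calc (η * μ + 2) * (2 * η * (2 * y) + 2)
      ≤ ((32 * c + 2) * 4) ^ n * (m / (P * y) / r + 1) *
          (((32 * c + 2) * 4) ^ n * (1 / (P * r) + 1)) :=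
        mul_le_mul hwidth hheight (by positivity) (by positivity)
    _ = (((32 * c + 2) * 4) ^ 2) ^ n * (1 / (P * r) + 1) * (m / (P * y) / r + 1) := by
        rw [← pow_mul, mul_comm 2 n, pow_mul]
        ring

lemma exists_finset_closedBall_cover {Z α : Type*} [PseudoMetricSpace Z] {A : Set Z} {g : Z → α}
    {T : Finset α} {r : ℝ} (hT : MapsTo g A T)
    (hr : ∀ z ∈ A, ∀ z' ∈ A, g z = g z' → dist z z' ≤ r) :
    ∃ C : Finset Z, A ⊆ ⋃ c ∈ C, closedBall c r ∧ C.card ≤ T.card := by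
  obtain ⟨C, hCA, hC⟩ := exists_subset_bijOn A g
  have hfin : C.Finite := hC.finite_iff_finite.2 (T.finite_toSet.subset hT.image_subset)
  refine ⟨hfin.toFinset, fun z hz => ?_, Finset.card_le_card_of_injOn g ?_ ?_⟩
  · obtain ⟨c, hc, hcz⟩ := hC.surjOn (mem_image_of_mem g hz)
    exact mem_iUnion₂.2 ⟨c, hfin.mem_toFinset.2 hc, hr z hz c (hCA hc) hcz.symm⟩
  · exact fun c hc => hT (hCA (hfin.mem_toFinset.1 hc))
  · simpa only [Finite.coe_toFinset] using hC.injOn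

namespace AnnulusData

variable {lam : ℕ → ℂ} {a b : ℕ → ℝ} {D : ℝ} (h : AnnulusData lam a b D)
include h

lemma mem_seqBox_left : a ∈ seqBox a b := fun k hk => ⟨le_rfl, (h.a_lt k hk).le⟩

lemma orbitSeq_mem {N : ℕ} {z : ℂ}
    (hz : ∀ n, N < n → a n ≤ ‖nonautExp lam n z‖ ∧ ‖nonautExp lam n z‖ ≤ b n) :
    orbitSeq lam a N z ∈ seqBox a b := fun k hk => by
  rcases le_or_gt k N with hkN | hNk
  · rw [orbitSeq_of_le hkN]
    exact h.mem_seqBox_left k hk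
  · rw [orbitSeq_of_lt hNk]
    exact hz k hNk

lemma orbitSeq_mem_of_mem_itineraryPiece {N : ℕ} {σ : List (ℤ × ℤ)} {z : ℂ}
    (hz : z ∈ itineraryPiece lam a b N σ) : orbitSeq lam a N z ∈ seqBox a b :=
  h.orbitSeq_mem fun n hn => hz.1 n hn.le

lemma log_div_sub {k : ℕ} (hk : 1 ≤ k) :
    Real.log (b k / ‖lam k‖) - Real.log (a k / ‖lam k‖) = annulusModulus a b k := by
  have hlam := (norm_pos_iff.2 (h.lam_ne k hk)).ne'
  have ha := h.a_pos k hk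
  have hb := ha.trans (h.a_lt k hk)
  rw [annulusModulus, Real.log_div hb.ne' hlam, Real.log_div ha.ne' hlam,
    Real.log_div hb.ne' ha.ne', sub_sub_sub_cancel_right]

lemma re_mem_strip {k : ℕ} {z : ℂ}
    (hz : a (k + 1) ≤ ‖nonautExp lam (k + 1) z‖ ∧ ‖nonautExp lam (k + 1) z‖ ≤ b (k + 1)) :
    Real.log (a (k + 1) / ‖lam (k + 1)‖) ≤ (nonautExp lam k z).re ∧
      (nonautExp lam k z).re ≤ Real.log (b (k + 1) / ‖lam (k + 1)‖) := by
  have hlam := norm_pos_iff.2 (h.lam_ne (k + 1) (by omega))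
  have ha := h.a_pos (k + 1) (by omega)
  have hb := ha.trans (h.a_lt (k + 1) (by omega))
  rw [Real.log_le_iff_le_exp (by positivity), Real.le_log_iff_exp_le (by positivity),
    div_le_iff₀' hlam, le_div_iff₀' hlam, ← norm_nonautExp_succ]
  exact hz

lemma exists_finset_gridCell_orbit {η Y : ℝ} (hη : 0 < η) (hY : 0 ≤ Y) (k : ℕ) :
    ∃ T : Finset (ℤ × ℤ), (∀ z : ℂ, a (k + 2) ≤ ‖nonautExp lam (k + 2) z‖ ∧
        ‖nonautExp lam (k + 2) z‖ ≤ b (k + 2) → ‖nonautExp lam (k + 1) z‖ ≤ Y →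
        gridCell η (nonautExp lam (k + 1) z) ∈ T) ∧
      (T.card : ℝ) ≤ (η * min (annulusModulus a b (k + 2)) (2 * Y) + 2) * (2 * η * Y + 2) := by
  have hstrip := h.log_div_sub (k := k + 2) (by omega)
  obtain ⟨T, hT, hcard⟩ := exists_finset_gridCell (h := η)
    (α := Real.log (a (k + 2) / ‖lam (k + 2)‖)) (β := Real.log (b (k + 2) / ‖lam (k + 2)‖))
    hη (by linarith [h.modulus (k + 2) (by omega), h.D_pos]) hY
  rw [hstrip] at hcard
  exact ⟨T, fun z hz hzY => hT _ (h.re_mem_strip hz).1 (h.re_mem_strip hz).2 hzY, hcard⟩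

lemma cellBranching_nonneg (k : ℕ) (q : ℤ × ℤ) : 0 ≤ cellBranching lam a b k q :=
  mul_nonneg (cellModulus_nonneg lam k q)
    (le_min (h.D_pos.trans (h.modulus _ (by omega))).le (cellModulus_nonneg lam k q))

lemma card_image_orbitCell_le {N : ℕ} (hN : ∀ n, N ≤ n → 1 ≤ a n) {F : Set ℂ}
    (hF : ∀ z ∈ F, ∀ n, N ≤ n → a n ≤ ‖nonautExp lam n z‖ ∧ ‖nonautExp lam n z‖ ≤ b n)
    {k : ℕ} (hk : N ≤ k) (q : ℤ × ℤ) (S : Finset ℂ) (hS : (S : Set ℂ) ⊆ F)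
    (hq : ∀ z ∈ S, orbitCell lam k z = q) :
    ((S.image (orbitCell lam (k + 1))).card : ℝ) ≤
      20 * (16 + 2 / min D (1 / 2)) * cellBranching lam a b k q := by
  have hD := h.D_pos
  have hδ : 0 < min D (1 / 2) := lt_min hD one_half_pos
  rcases S.eq_empty_or_nonempty with rfl | ⟨z₀, hz₀⟩
  · rw [Finset.image_empty, Finset.card_empty, Nat.cast_zero]
    have := h.cellBranching_nonneg k q
    positivity
  have hmod : ∀ z ∈ S, ‖nonautExp lam (k + 1) z‖ ≤ 2 * cellModulus lam k q := fun z hz =>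
    hq z hz ▸ norm_nonautExp_le_two_mul_cellModulus lam k z
  have hX : 1 / 2 ≤ cellModulus lam k q := by
    linarith [hmod z₀ hz₀, (hF z₀ (hS hz₀) (k + 1) (by omega)).1, hN (k + 1) (by omega)]
  obtain ⟨T, hT, hcard⟩ := h.exists_finset_gridCell_orbit (η := 4)
    (Y := 2 * cellModulus lam k q) (by norm_num) (by linarith) k
  have hsub : S.image (orbitCell lam (k + 1)) ⊆ T := Finset.image_subset_iff.2 fun z hz =>
    hT z (hF z (hS hz) (k + 2) (by omega)) (hmod z hz)
  calc ((S.image (orbitCell lam (k + 1))).card : ℝ) ≤ T.card := by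
        exact_mod_cast Finset.card_le_card hsub
    _ ≤ _ := hcard
    _ ≤ _ := strip_cell_count_le hδ (min_le_min (h.modulus (k + 2) (by omega)).le hX) hX

lemma one_div_mul_min_norm_le (k : ℕ) (z : ℂ) :
    1 / (‖nonautExp lam (k + 1) z‖ *
        min (annulusModulus a b (k + 2)) ‖nonautExp lam (k + 1) z‖) ≤
      (cellBranching lam a b k (orbitCell lam k z))⁻¹ := by
  have hΔ := h.D_pos.trans (h.modulus (k + 2) (by omega))
  have hle := cellModulus_le lam k z
  have hX : 0 < cellModulus lam k (orbitCell lam k z) := by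
    linarith [norm_nonautExp_le_two_mul_cellModulus lam k z,
      norm_nonautExp_pos h.lam_ne (k + 1) (by omega) z]
  have hmin := lt_min hΔ hX
  rw [cellBranching, ← one_div]
  exact one_div_le_one_div_of_le (by positivity)
    (mul_le_mul hle (min_le_min le_rfl hle) hmin.le (norm_nonneg _))

lemma one_div_modProd_mul_minProd_orbitSeq_le (N j : ℕ) (z : ℂ) :
    1 / (modProd (orbitSeq lam a N z) (N + j) * minProd a b (orbitSeq lam a N z) (N + j)) ≤
      1 / (modProd a N * minProd a b a N) *
        ∏ i ∈ Finset.range j, (cellBranching lam a b (N + i) (orbitCell lam (N + i) z))⁻¹ := by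
  induction j with
  | zero => simp only [add_zero, modProd_orbitSeq_self, minProd_orbitSeq_self, Finset.range_zero,
      Finset.prod_empty, mul_one, le_refl]
  | succ j ih =>
    have hΔ := h.D_pos.trans (h.modulus (N + j + 2) (by omega))
    have hy := norm_nonautExp_pos h.lam_ne (N + j + 1) (by omega) z
    have := lt_min hΔ hy
    rw [← add_assoc, modProd_succ, minProd_succ, Finset.prod_range_succ,
      orbitSeq_of_lt (show N < N + j + 1 by omega), mul_mul_mul_comm, ← one_div_mul_one_div,
      ← mul_assoc]
    refine mul_le_mul ih (h.one_div_mul_min_norm_le (N + j) z) (by positivity) ?_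
    have hP := modProd_pos h.a_pos N
    have hM := h.minProd_pos h.mem_seqBox_left N
    exact mul_nonneg (by positivity) (Finset.prod_nonneg fun i _ =>
      inv_nonneg.2 (h.cellBranching_nonneg _ _))

lemma sum_prod_inv_cellBranching_le {N : ℕ} (hN : ∀ n, N ≤ n → 1 ≤ a n) {σ : List (ℤ × ℤ)}
    {S : Finset ℂ} (hS : (S : Set ℂ) ⊆ itineraryPiece lam a b N σ) {j : ℕ}
    (hinj : InjOn (itinerary lam (N + j)) S) :
    ∑ z ∈ S, ∏ i ∈ Finset.range j, (cellBranching lam a b (N + i) (orbitCell lam (N + i) z))⁻¹ ≤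
      (20 * (16 + 2 / min D (1 / 2))) ^ j := by
  have hδ : 0 < min D (1 / 2) := lt_min h.D_pos one_half_pos
  set C : ℝ := 20 * (16 + 2 / min D (1 / 2))
  have hC₀ : 0 < C := by positivity
  rcases S.eq_empty_or_nonempty with rfl | ⟨z₀, hz₀⟩
  · rw [Finset.sum_empty]
    positivity
  have hsame : ∀ z ∈ S, ∀ i ≤ N, orbitCell lam i z = orbitCell lam i z₀ := fun z hz =>
    itinerary_eq_iff.1 ((hS hz).2.trans (hS hz₀).2.symm)
  have hsum : ∑ z ∈ S, ∏ i ∈ Finset.range j,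
      (C * cellBranching lam a b (N + i) (orbitCell lam (N + i) z))⁻¹ ≤ 1 := by
    refine sum_prod_inv_le_one (c := orbitCell lam) (κ := fun k q => C * cellBranching lam a b k q)
      (fun k q => mul_nonneg hC₀.le (h.cellBranching_nonneg k q))
      (fun k hk q S hS hq => h.card_image_orbitCell_le hN (fun z hz => hz.1) hk q S hS hq)
      j N le_rfl (orbitCell lam N z₀) S hS (fun z hz => hsame z hz N le_rfl) ?_
    refine fun z hz z' hz' heq => hinj hz hz' (itinerary_eq_iff.2 fun i hi => ?_)
    rcases le_or_gt i N with hiN | hNi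
    · rw [hsame z hz i hiN, hsame z' hz' i hiN]
    · exact heq i hNi hi
  simp only [mul_inv, Finset.prod_mul_distrib, Finset.prod_const, Finset.card_range,
    ← Finset.mul_sum, inv_pow] at hsum
  rwa [inv_mul_le_iff₀ (by positivity), mul_one] at hsum

lemma exists_sum_weight_le {N : ℕ} (hN : ∀ n, N ≤ n → 1 ≤ a n) (σ : List (ℤ × ℤ)) :
    ∃ K : ℝ, 1 ≤ K ∧ ∀ n, max N 1 ≤ n → ∀ S : Finset ℂ,
      (S : Set ℂ) ⊆ itineraryPiece lam a b N σ → InjOn (itinerary lam n) S →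
      ∑ z ∈ S, 1 / (modProd (orbitSeq lam a N z) n * minProd a b (orbitSeq lam a N z) n) ≤
        K ^ n := by
  have hδ : 0 < min D (1 / 2) := lt_min h.D_pos one_half_pos
  have hP := modProd_pos h.a_pos N
  have hM := h.minProd_pos h.mem_seqBox_left N
  set c : ℝ := 1 / (modProd a N * minProd a b a N)
  set C : ℝ := 20 * (16 + 2 / min D (1 / 2))
  have hC₁ : 1 ≤ C := by
    have : 0 < 2 / min D (1 / 2) := by positivity
    linarith
  refine ⟨max c 1 * C, one_le_mul_of_one_le_of_one_le (le_max_right _ _) hC₁,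
    fun n hn S hS hinj => ?_⟩
  obtain ⟨j, rfl⟩ : ∃ j, n = N + j := Nat.exists_eq_add_of_le ((le_max_left _ _).trans hn)
  calc ∑ z ∈ S, 1 / (modProd (orbitSeq lam a N z) (N + j) *
          minProd a b (orbitSeq lam a N z) (N + j))
      ≤ ∑ z ∈ S, c * ∏ i ∈ Finset.range j,
          (cellBranching lam a b (N + i) (orbitCell lam (N + i) z))⁻¹ :=
        Finset.sum_le_sum fun z _ => h.one_div_modProd_mul_minProd_orbitSeq_le N j z
    _ = c * ∑ z ∈ S, ∏ i ∈ Finset.range j,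
          (cellBranching lam a b (N + i) (orbitCell lam (N + i) z))⁻¹ := (Finset.mul_sum ..).symm
    _ ≤ c * C ^ j := by
        gcongr
        exact h.sum_prod_inv_cellBranching_le hN hS hinj
    _ ≤ max c 1 ^ (N + j) * C ^ (N + j) := by
        gcongr
        · exact (le_max_left _ _).trans (le_self_pow₀ (le_max_right _ _) (by omega))
        · omega
    _ = (max c 1 * C) ^ (N + j) := (mul_pow _ _ _).symm

lemma exists_prod_div_norm_le (N : ℕ) (σ : List (ℤ × ℤ)) :
    ∃ c : ℝ, 0 ≤ c ∧ ∀ z ∈ itineraryPiece lam a b N σ,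
      ∏ k ∈ Finset.Icc 1 N, (a k / ‖nonautExp lam k z‖) ≤ c := by
  rcases (itineraryPiece lam a b N σ).eq_empty_or_nonempty with hemp | ⟨z₀, hz₀⟩
  · exact ⟨0, le_rfl, fun z hz => absurd hz (hemp ▸ notMem_empty z)⟩
  have ha : ∀ k ∈ Finset.Icc 1 N, 0 ≤ a k := fun k hk => (h.a_pos k (Finset.mem_Icc.1 hk).1).le
  refine ⟨∏ k ∈ Finset.Icc 1 N, (2 * a k / ‖nonautExp lam k z₀‖),
    Finset.prod_nonneg fun k hk => div_nonneg (mul_nonneg zero_le_two (ha k hk)) (norm_nonneg _),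
    fun z hz => Finset.prod_le_prod (fun k hk => div_nonneg (ha k hk) (norm_nonneg _))
      fun k hk => ?_⟩
  obtain ⟨hk₁, hkN⟩ := Finset.mem_Icc.1 hk
  obtain ⟨i, rfl⟩ : ∃ i, k = i + 1 := Nat.exists_eq_succ_of_ne_zero (by omega)
  have hle := norm_nonautExp_succ_le_two_mul
    (itinerary_eq_iff.1 (hz₀.2.trans hz.2.symm) i (by omega))
  rw [div_le_div_iff₀ (norm_nonautExp_pos h.lam_ne (i + 1) hk₁ z)
    (norm_nonautExp_pos h.lam_ne (i + 1) hk₁ z₀), mul_comm 2, mul_assoc]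
  exact mul_le_mul_of_nonneg_left hle (ha _ hk)

lemma prod_four_div_mul_modProd {N n : ℕ} (hn : N ≤ n) (z : ℂ) :
    (∏ k ∈ Finset.Icc 1 n, 4 / ‖nonautExp lam k z‖) * modProd (orbitSeq lam a N z) n =
      4 ^ n * ∏ k ∈ Finset.Icc 1 N, (a k / ‖nonautExp lam k z‖) := by
  have htail : ∏ k ∈ Finset.Icc 1 n, (orbitSeq lam a N z k / ‖nonautExp lam k z‖) =
      ∏ k ∈ Finset.Icc 1 N, (a k / ‖nonautExp lam k z‖) := by
    rw [← Finset.prod_subset (Finset.Icc_subset_Icc_right hn)]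
    · exact Finset.prod_congr rfl fun k hk => by rw [orbitSeq_of_le (Finset.mem_Icc.1 hk).2]
    · intro k hk hkN
      rw [Finset.mem_Icc] at hk hkN
      rw [orbitSeq_of_lt (by omega), div_self (norm_nonautExp_pos h.lam_ne k hk.1 z).ne']
  rw [← htail, modProd]
  simp only [Finset.prod_div_distrib, Finset.prod_const, Nat.card_Icc, Nat.add_sub_cancel]
  rw [div_mul_eq_mul_div, mul_div_assoc]

lemma exists_class_cover_card_le {N n : ℕ} {σ : List (ℤ × ℤ)} (hn : N ≤ n) {z : ℂ}
    {r η : ℝ} (hr : 0 < r)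
    (hη : η = 2 * (∏ k ∈ Finset.Icc 1 (n + 1), 4 / ‖nonautExp lam k z‖) / r) :
    ∃ C : Finset ℂ, {z' ∈ itineraryPiece lam a b N σ | itinerary lam n z' = itinerary lam n z} ⊆
        ⋃ c ∈ C, closedBall c r ∧
      (C.card : ℝ) ≤ (η * min (annulusModulus a b (n + 2))
        (2 * (2 * ‖nonautExp lam (n + 1) z‖)) + 2) *
        (2 * η * (2 * ‖nonautExp lam (n + 1) z‖) + 2) := by
  have hΛ : 0 < ∏ k ∈ Finset.Icc 1 (n + 1), 4 / ‖nonautExp lam k z‖ :=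
    Finset.prod_pos fun k hk => by
      have := norm_nonautExp_pos h.lam_ne k (Finset.mem_Icc.1 hk).1 z
      positivity
  have hη₀ : 0 < η := by
    rw [hη]
    positivity
  have hdist : ∀ z₁, itinerary lam n z₁ = itinerary lam n z → ∀ z₂,
      itinerary lam n z₂ = itinerary lam n z →
      gridCell η (nonautExp lam (n + 1) z₁) = gridCell η (nonautExp lam (n + 1) z₂) →
      dist z₁ z₂ ≤ r := fun z₁ hz₁ z₂ hz₂ hcell => calc
    dist z₁ z₂ = ‖z₁ - z₂‖ := dist_eq_norm _ _
    _ ≤ (∏ k ∈ Finset.Icc 1 (n + 1), 4 / ‖nonautExp lam k z‖) *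
          ‖nonautExp lam (n + 1) z₁ - nonautExp lam (n + 1) z₂‖ :=
        norm_sub_le_prod h.lam_ne (n + 1)
          (fun k hk => itinerary_eq_iff.1 hz₁ k (by omega))
          (fun k hk => itinerary_eq_iff.1 hz₂ k (by omega))
    _ ≤ (∏ k ∈ Finset.Icc 1 (n + 1), 4 / ‖nonautExp lam k z‖) * (2 / η) := by
        gcongr
        exact norm_sub_le_of_gridCell_eq hη₀ hcell
    _ = r := by
        rw [hη]
        field_simp
  obtain ⟨T, hT, hTcard⟩ := h.exists_finset_gridCell_orbit hη₀
    (Y := 2 * ‖nonautExp lam (n + 1) z‖) (by positivity) n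
  obtain ⟨C, hcov, hC⟩ := exists_finset_closedBall_cover (r := r)
    (A := {z' ∈ itineraryPiece lam a b N σ | itinerary lam n z' = itinerary lam n z})
    (g := fun z' => gridCell η (nonautExp lam (n + 1) z')) (T := T)
    (fun z' hz' => hT z' (hz'.1.1 (n + 2) (by omega))
      (norm_nonautExp_succ_le_two_mul (itinerary_eq_iff.1 hz'.2 n le_rfl)))
    (fun z₁ hz₁ z₂ hz₂ => hdist z₁ hz₁.2 z₂ hz₂.2)
  exact ⟨C, hcov, hTcard.trans' (by exact_mod_cast hC)⟩

lemma exists_class_cover (N : ℕ) (σ : List (ℤ × ℤ)) :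
    ∃ K : ℝ, 1 ≤ K ∧ ∀ n, max N 1 ≤ n → ∀ z ∈ itineraryPiece lam a b N σ, ∀ r : ℝ, 0 < r →
      ∃ C : Finset ℂ, {z' ∈ itineraryPiece lam a b N σ | itinerary lam n z' = itinerary lam n z} ⊆
        ⋃ c ∈ C, closedBall c r ∧
      (C.card : ℝ) ≤ K ^ n * (1 / (modProd (orbitSeq lam a N z) n * r) + 1) *
        (stripWidth a b (orbitSeq lam a N z) n / r + 1) := by
  obtain ⟨c, hc₀, hc⟩ := h.exists_prod_div_norm_le N σ
  refine ⟨((32 * c + 2) * 4) ^ 2, one_le_pow₀ (by linarith), fun n hn z hz r hr => ?_⟩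
  obtain ⟨hNn, hn₁⟩ := max_le_iff.1 hn
  obtain ⟨C, hcov, hC⟩ := h.exists_class_cover_card_le (σ := σ) hNn (z := z) hr rfl
  refine ⟨C, hcov, hC.trans ?_⟩
  have hx := h.orbitSeq_mem_of_mem_itineraryPiece hz
  have hxn : orbitSeq lam a N z (n + 1) = ‖nonautExp lam (n + 1) z‖ := orbitSeq_of_lt (by omega)
  have hP := modProd_pos (h.x_pos hx) n
  have hy := norm_nonautExp_pos h.lam_ne (n + 1) (by omega) z
  have hΔ := h.D_pos.trans (h.modulus (n + 2) (by omega))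
  have hΛ : 0 < ∏ k ∈ Finset.Icc 1 (n + 1), 4 / ‖nonautExp lam k z‖ :=
    Finset.prod_pos fun k hk => by
      have := norm_nonautExp_pos h.lam_ne k (Finset.mem_Icc.1 hk).1 z
      positivity
  have hprod := h.prod_four_div_mul_modProd (show N ≤ n + 1 by omega) z
  rw [modProd_succ, hxn] at hprod
  rw [stripWidth, modProd_succ, hxn]
  refine strip_ball_count_le hn₁ hc₀ hP hy (lt_min hΔ hy) (by positivity) ?_ hr
    (by positivity) ?_
  · rw [show 2 * (2 * ‖nonautExp lam (n + 1) z‖) = 4 * ‖nonautExp lam (n + 1) z‖ by ring]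
    exact min_mul_le_mul_min (by norm_num) hΔ.le
  · rw [div_le_div_iff₀ hr (by positivity)]
    calc 2 * (∏ k ∈ Finset.Icc 1 (n + 1), 4 / ‖nonautExp lam k z‖) *
          (modProd (orbitSeq lam a N z) n * ‖nonautExp lam (n + 1) z‖ * r)
        = 2 * (4 ^ (n + 1) * ∏ k ∈ Finset.Icc 1 N, (a k / ‖nonautExp lam k z‖)) * r := by
          rw [← hprod]
          ring
      _ ≤ 2 * (4 ^ (n + 1) * c) * r := by
          gcongr
          exact hc z hz
      _ = 8 * 4 ^ n * c * r := by ring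

end AnnulusData

end ItineraryCover

/-! ### Upper bounds -/

section UpperBounds

open Set Metric

lemma packingDim_le_of_countable_cover {X ι : Type*} [MetricSpace X] [Countable ι] [Nonempty ι]
    {A : Set X} {d : ℝ≥0∞} (F : ι → Set X) (hA : A ⊆ ⋃ i, F i) (hF : ∀ i, upperBoxDim (F i) ≤ d) :
    packingDim A ≤ d := by
  obtain ⟨f, hf⟩ := exists_surjective_nat ι
  exact iInf₂_le_of_le (fun n => F (f n)) (hA.trans (hf.iUnion_comp F).superset)
    (iSup_le fun n => hF _)

lemma escapeRateSet_subset_iUnion_itineraryPiece (lam : ℕ → ℂ) (a b : ℕ → ℝ) (N₀ : ℕ) :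
    escapeRateSet lam a b ⊆ ⋃ p : {N // N₀ ≤ N} × List (ℤ × ℤ),
      itineraryPiece lam a b p.1 p.2 := fun z hz => by
  obtain ⟨N, hN⟩ := eventually_atTop.1 hz
  exact mem_iUnion.2 ⟨⟨⟨max N N₀, le_max_right _ _⟩, itinerary lam (max N N₀) z⟩,
    fun n hn => hN n ((le_max_left _ _).trans hn), rfl⟩

/-- The points of `itineraryPiece lam a b N σ` for which the bound `psiRatio ≤ t` holds from time
`M` on, and whose scale at time `M` is at most `L`. -/
def uniformPiece (lam : ℕ → ℂ) (a b : ℕ → ℝ) (t : ℝ) (N : ℕ) (σ : List (ℤ × ℤ)) (M L : ℕ) :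
    Set ℂ :=
  {z ∈ itineraryPiece lam a b N σ |
    (∀ n, M ≤ n → psiRatio a b n (orbitSeq lam a N z) ≤ t) ∧ modProd (orbitSeq lam a N z) M ≤ L}

namespace AnnulusData

variable {lam : ℕ → ℂ} {a b : ℕ → ℝ} {D : ℝ} (h : AnnulusData lam a b D)
include h

lemma exists_one_le_and_one_lt_modProd :
    ∃ N, ∀ n, N ≤ n → 1 ≤ a n ∧ ∀ x ∈ seqBox a b, 1 < modProd x n :=
  eventually_atTop.1 (h.one_le_a.and h.eventually_one_lt_modProd)

lemma exists_isClassCover {N : ℕ} (hN : ∀ n, N ≤ n → 1 ≤ a n) (σ : List (ℤ × ℤ)) :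
    ∃ K, IsClassCover (itineraryPiece lam a b N σ) (itinerary lam)
      (fun n z => modProd (orbitSeq lam a N z) n) (fun n z => minProd a b (orbitSeq lam a N z) n)
      (fun n z => stripWidth a b (orbitSeq lam a N z) n) (modProd a) K (max N 1) := by
  obtain ⟨K₁, hK₁, hsum⟩ := h.exists_sum_weight_le hN σ
  obtain ⟨K₂, hK₂, hcover⟩ := h.exists_class_cover N σ
  have hx : ∀ z ∈ itineraryPiece lam a b N σ, orbitSeq lam a N z ∈ seqBox a b :=
    fun z hz => h.orbitSeq_mem_of_mem_itineraryPiece hz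
  refine ⟨max K₁ K₂, {
    one_le := hK₁.trans (le_max_left _ _)
    growth := h.isSuperexponential
    le_scale := fun n _ z hz => h.modProd_le (hx z hz) n
    width_pos := fun n _ z hz => h.stripWidth_pos (hx z hz) n
    width_le := fun n _ z hz => h.stripWidth_le (hx z hz) n
    mass_pos := fun n _ z hz => h.minProd_pos (hx z hz) n
    sum_weight_le := fun n hn S hS hinj => (hsum n hn S hS hinj).trans
      (pow_le_pow_left₀ (by linarith) (le_max_left _ _) n)
    exists_cover := fun n hn z hz r hr => ?_ }⟩
  obtain ⟨C, hcov, hcard⟩ := hcover n hn z hz r hr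
  refine ⟨C, hcov, hcard.trans ?_⟩
  have := modProd_pos (h.x_pos (hx z hz)) n
  have := h.stripWidth_pos (hx z hz) n
  gcongr
  exact le_max_right _ _

theorem dimH_escapeRateSet_le {t t' : ℝ} (htt : t < t') (ht' : 0 < t')
    (hφ : ∀ x ∈ seqBox a b, liminf (fun n : ℕ => (phiRatio a b n x : EReal)) atTop < t) :
    dimH (escapeRateSet lam a b) ≤ ENNReal.ofReal (1 + t') := by
  obtain ⟨N₀, hN₀⟩ := h.exists_one_le_and_one_lt_modProd
  refine (dimH_mono (escapeRateSet_subset_iUnion_itineraryPiece lam a b N₀)).trans ?_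
  rw [dimH_iUnion]
  refine iSup_le fun ⟨⟨N, hN⟩, σ⟩ => ?_
  obtain ⟨K, hcover⟩ := h.exists_isClassCover (fun n hn => (hN₀ n (hN.trans hn)).1) σ
  refine hcover.dimH_le htt ht' fun z hz => ?_
  have hx := h.orbitSeq_mem_of_mem_itineraryPiece hz
  have hfreq : ∃ᶠ n in atTop, phiRatio a b (n + 1) (orbitSeq lam a N z) < t := by
    refine (frequently_lt_of_liminf_lt (by isBoundedDefault)
      ((liminf_nat_add _ 1).trans_lt (hφ _ hx))).mono fun n hn => ?_
    exact_mod_cast hn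
  exact (hfreq.and_eventually (eventually_ge_atTop N₀)).mono fun n ⟨hlt, hn⟩ =>
    (h.phiRatio_succ_le_iff hx ((hN₀ n hn).2 _ hx)).1 hlt.le

lemma upperBoxDim_uniformPiece_le {N₀ N M : ℕ}
    (hN₀ : ∀ n, N₀ ≤ n → 1 ≤ a n ∧ ∀ x ∈ seqBox a b, 1 < modProd x n) (hN : N₀ ≤ N)
    (hM : max N 1 ≤ M) (σ : List (ℤ × ℤ)) (L : ℕ) {t t' : ℝ} (ht₀ : 0 < t) (htt : t < t') :
    upperBoxDim (uniformPiece lam a b t N σ M L) ≤ ENNReal.ofReal (1 + t') := by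
  obtain ⟨K, hcover⟩ := h.exists_isClassCover (fun n hn => (hN₀ n (hN.trans hn)).1) σ
  refine (hcover.mono (F' := uniformPiece lam a b t N σ M L) (fun z hz => hz.1) hM).upperBoxDim_le
    (fun n _ z _ => stripWidth_mul_minProd a b _ n) (le_min ht₀.le zero_le_one)
    (min_le_right t 1) ((min_le_left t 1).trans_lt htt) (fun n hn z hz => ?_) fun z hz => hz.2.2
  have hx := h.orbitSeq_mem_of_mem_itineraryPiece hz.1
  have hone := (hN₀ n (hN.trans ((le_max_left _ _).trans (hM.trans hn)))).2 _ hx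
  exact (h.psiRatio_le_iff hx hone).1 (le_min (hz.2.1 n hn) (h.psiRatio_le_one hx hone))

theorem packingDim_escapeRateSet_le {t t' : ℝ} (ht₀ : 0 < t) (htt : t < t')
    (hψ : ∀ x ∈ seqBox a b, limsup (fun n : ℕ => (psiRatio a b n x : EReal)) atTop < t) :
    packingDim (escapeRateSet lam a b) ≤ ENNReal.ofReal (1 + t') := by
  obtain ⟨N₀, hN₀⟩ := h.exists_one_le_and_one_lt_modProd
  have : Nonempty (({N // N₀ ≤ N} × List (ℤ × ℤ)) × ℕ × ℕ) := ⟨⟨⟨⟨N₀, le_rfl⟩, []⟩, 0, 0⟩⟩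
  refine packingDim_le_of_countable_cover
    (fun p : ({N // N₀ ≤ N} × List (ℤ × ℤ)) × ℕ × ℕ =>
      uniformPiece lam a b t p.1.1 p.1.2 (max (max p.1.1 1) p.2.1) p.2.2) (fun z hz => ?_)
    fun ⟨⟨⟨N, hN⟩, σ⟩, M, L⟩ =>
      h.upperBoxDim_uniformPiece_le hN₀ hN (le_max_left _ _) σ L ht₀ htt
  obtain ⟨p, hp⟩ := mem_iUnion.1 (escapeRateSet_subset_iUnion_itineraryPiece lam a b N₀ hz)
  obtain ⟨M, hM⟩ := eventually_atTop.1
    (eventually_lt_of_limsup_lt (hψ _ (h.orbitSeq_mem_of_mem_itineraryPiece hp)))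
  obtain ⟨L, hL⟩ := exists_nat_ge (modProd (orbitSeq lam a p.1 z) (max (max p.1 1) M))
  refine mem_iUnion.2 ⟨⟨p, M, L⟩, hp, fun n hn => ?_, hL⟩
  exact_mod_cast (hM n ((le_max_right _ _).trans hn)).le

end AnnulusData

end UpperBounds

/-! ### Families of boxes -/

section BoxFamilies

open Set Metric

/-- The closed box of width `s` and height `2π` whose left edge has midpoint `ζ`. It is a
fundamental domain of `exp` inside a vertical strip of width `s`. -/
def expBox (s : ℝ) (ζ : ℂ) : Set ℂ :=
  {w | ζ.re ≤ w.re ∧ w.re ≤ ζ.re + s ∧ |w.im - ζ.im| ≤ Real.pi}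

/-- The boxes `expBox s ζ`, `ζ ∈ T`, form a separated family in the annulus `X ≤ |w| ≤ X e^s`
which is as large and as evenly spread, up to the constants `c` and `C`, as one could hope for in
the intersection of this annulus with a vertical strip of width `δ`. -/
structure IsBoxFamily (T : Finset ℂ) (s c C δ X : ℝ) : Prop where
  annulus : ∀ ζ ∈ T, ∀ w ∈ expBox s ζ, X ≤ ‖w‖ ∧ ‖w‖ ≤ X * Real.exp s
  separated : ∀ ζ ∈ T, ∀ ζ' ∈ T, ζ ≠ ζ' → ∀ w ∈ expBox s ζ, ∀ w' ∈ expBox s ζ', s ≤ ‖w - w'‖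
  le_card : c * (X * min δ X) ≤ T.card
  card_meeting_le : ∀ (w : ℂ) (R : ℝ), 0 ≤ R → ∀ T' ⊆ T,
    (∀ ζ ∈ T', (expBox s ζ ∩ closedBall w R).Nonempty) →
      (T'.card : ℝ) ≤ C * ((1 + R) * (1 + min R (min δ X)))

/-- Every vertical strip `α ≤ re w ≤ β` of width more than `D` that comes within `q X` of the
imaginary axis contains a family of boxes in the annulus `X ≤ |w| ≤ X e^s`, uniformly
in `X ≥ A`. -/
structure HasBoxes (q D s c C A : ℝ) : Prop where
  s_pos : 0 < s
  s_le_one : s ≤ 1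
  s_le : s ≤ D
  c_pos : 0 < c
  C_pos : 0 < C
  one_le : 1 ≤ A
  exists_isBoxFamily : ∀ X α β : ℝ, A ≤ X → D < β - α → α ≤ q * X → -(q * X) ≤ β →
    ∃ T : Finset ℂ, IsBoxFamily T s c C (β - α) X ∧ ∀ ζ ∈ T, α ≤ ζ.re ∧ ζ.re + s ≤ β

lemma sqrt_le_of_add_two_mul_sq {X c u₀ : ℝ} (hX : 0 ≤ X) (hc : c ≤ 1 / 8) :
    √(X ^ 2 - u₀ ^ 2 + 2 * c * X ^ 2) ≤ 5 / 4 * X :=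
  Real.sqrt_le_left (by positivity) |>.2 <| by nlinarith [sq_nonneg u₀, sq_nonneg X]

/-- The corner `(u₀, v₀)` is put slightly outside the circle `|w| = X`, so that the rectangle does
not enter the disc even where the circle is steep. -/
lemma sq_bounds_of_mem_rectangle {X s c u₀ ℓ u v : ℝ} (hX : 0 < X) (hs₀ : 0 < s) (hs₁ : s ≤ 1)
    (hc₀ : 0 < c) (hc : c ≤ s / 8) (hu₀ : -X ≤ u₀) (hu₁ : u₀ + ℓ ≤ X) (hℓ₀ : 0 ≤ ℓ)
    (hℓ : ℓ ≤ c * X) (hu : u ∈ Icc u₀ (u₀ + ℓ))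
    (hv : v - √(X ^ 2 - u₀ ^ 2 + 2 * c * X ^ 2) ∈ Icc 0 (s / 4 * X)) :
    X ^ 2 ≤ u ^ 2 + v ^ 2 ∧ u ^ 2 + v ^ 2 ≤ (X * Real.exp s) ^ 2 := by
  set v₀ := √(X ^ 2 - u₀ ^ 2 + 2 * c * X ^ 2)
  obtain ⟨hu, hu'⟩ := hu
  obtain ⟨hv, hv'⟩ := hv
  have hv₀ : 0 ≤ v₀ := Real.sqrt_nonneg _
  have hv₀X : v₀ ≤ 5 / 4 * X := sqrt_le_of_add_two_mul_sq hX.le (by linarith)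
  have hv₀_sq : v₀ ^ 2 = X ^ 2 - u₀ ^ 2 + 2 * c * X ^ 2 := Real.sq_sqrt <| by
    have : u₀ ^ 2 ≤ X ^ 2 := sq_le_sq' hu₀ (by linarith)
    have : 0 ≤ 2 * c * X ^ 2 := by positivity
    linarith
  have hu_sq : |u ^ 2 - u₀ ^ 2| ≤ 2 * c * X ^ 2 := by
    have hdiff : |u - u₀| ≤ c * X := abs_le.2 ⟨by nlinarith, by linarith⟩
    have hsum : |u + u₀| ≤ 2 * X := abs_le.2 ⟨by linarith, by linarith⟩
    calc |u ^ 2 - u₀ ^ 2| = |u - u₀| * |u + u₀| := by rw [← abs_mul]; ring_nf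
      _ ≤ c * X * (2 * X) := by gcongr
      _ = 2 * c * X ^ 2 := by ring
  obtain ⟨hu_sq₁, hu_sq₂⟩ := abs_le.1 hu_sq
  constructor
  · have : v₀ ^ 2 ≤ v ^ 2 := by gcongr; linarith
    linarith
  · have hv_sq : v ^ 2 ≤ v₀ ^ 2 + s * X ^ 2 := calc
      v ^ 2 ≤ (v₀ + s / 4 * X) ^ 2 := by gcongr <;> linarith
      _ = v₀ ^ 2 + v₀ * (s / 2 * X) + s ^ 2 * X ^ 2 / 16 := by ring
      _ ≤ v₀ ^ 2 + 5 / 4 * X * (s / 2 * X) + s * X ^ 2 / 16 := by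
        have : s ^ 2 ≤ s := by nlinarith
        gcongr
      _ ≤ v₀ ^ 2 + s * X ^ 2 := by nlinarith [mul_pos hs₀ (pow_pos hX 2)]
    have hexp : 1 + 2 * s ≤ Real.exp s ^ 2 := by
      rw [← Real.exp_nat_mul, add_comm]
      exact_mod_cast Real.add_one_le_exp (2 * s)
    calc u ^ 2 + v ^ 2 ≤ X ^ 2 + 4 * (c * X ^ 2) + s * X ^ 2 := by linarith
      _ ≤ X ^ 2 + 4 * (s / 8 * X ^ 2) + s * X ^ 2 := by gcongr
      _ ≤ (1 + 2 * s) * X ^ 2 := by nlinarith [mul_pos hs₀ (pow_pos hX 2)]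
      _ ≤ Real.exp s ^ 2 * X ^ 2 := by gcongr
      _ = (X * Real.exp s) ^ 2 := by ring

/-- The points of the lattice with periods `2s` and `4π` based at `(u₀, y₀)`, which is chosen so
coarse that the boxes at its points are separated. -/
noncomputable def gridPoint (s u₀ y₀ : ℝ) (p : ℕ × ℕ) : ℂ :=
  ⟨u₀ + 2 * s * p.1, y₀ + 4 * Real.pi * p.2⟩

/-- An `I` by `J` array of points of the lattice with periods `2s` and `4π`. -/
noncomputable def gridPoints (s u₀ y₀ : ℝ) (I J : ℕ) : Finset ℂ :=
  (Finset.range I ×ˢ Finset.range J).image (gridPoint s u₀ y₀)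

section Grid

variable {s u₀ y₀ : ℝ} {I J : ℕ}

lemma gridPoint_injective (hs₀ : 0 < s) : Function.Injective (gridPoint s u₀ y₀) := by
  intro p p' hpp
  have hre := congrArg Complex.re hpp
  have him := congrArg Complex.im hpp
  simp only [gridPoint, add_right_inj, mul_eq_mul_left_iff, Nat.cast_inj] at hre him
  exact Prod.ext (hre.resolve_right (by positivity)) (him.resolve_right (by positivity))

lemma card_gridPoints (hs₀ : 0 < s) : (gridPoints s u₀ y₀ I J).card = I * J := by
  rw [gridPoints, Finset.card_image_of_injective _ (gridPoint_injective hs₀), Finset.card_product,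
    Finset.card_range, Finset.card_range]

lemma re_mem_of_mem_gridPoints (hs₀ : 0 < s) {ζ : ℂ} (hζ : ζ ∈ gridPoints s u₀ y₀ I J) :
    u₀ ≤ ζ.re ∧ ζ.re + s ≤ u₀ + 2 * s * I := by
  obtain ⟨p, hp, rfl⟩ := Finset.mem_image.1 hζ
  have hp₁ : (p.1 : ℝ) + 1 ≤ I := by
    exact_mod_cast Finset.mem_range.1 (Finset.mem_product.1 hp).1
  have : 2 * s * (p.1 + 1) ≤ 2 * s * I := by gcongr
  have : 0 ≤ 2 * s * p.1 := by positivity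
  constructor <;> simp only [gridPoint] <;> linarith

lemma im_mem_of_mem_gridPoints {ζ : ℂ} (hζ : ζ ∈ gridPoints s u₀ y₀ I J) :
    y₀ ≤ ζ.im ∧ ζ.im + 2 * Real.pi ≤ y₀ + 4 * Real.pi * J := by
  obtain ⟨p, hp, rfl⟩ := Finset.mem_image.1 hζ
  have hp₂ : (p.2 : ℝ) + 1 ≤ J := by
    exact_mod_cast Finset.mem_range.1 (Finset.mem_product.1 hp).2
  have : 4 * Real.pi * (p.2 + 1) ≤ 4 * Real.pi * J := by gcongr
  have : 0 ≤ 4 * Real.pi * p.2 := by positivity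
  constructor <;> simp only [gridPoint] <;> linarith [Real.pi_pos]

lemma le_abs_sub_of_natCast_ne {x y P Q : ℝ} {i j : ℕ} (hij : i ≠ j) (hP : 0 < P)
    (hx : x - P * i ∈ Icc 0 Q) (hy : y - P * j ∈ Icc 0 Q) : P - Q ≤ |x - y| := by
  obtain ⟨hx, hx'⟩ := hx
  obtain ⟨hy, hy'⟩ := hy
  rcases hij.lt_or_gt with hlt | hlt
  · have : P * (i + 1) ≤ P * j := by gcongr; exact_mod_cast hlt
    exact le_abs.2 (.inr (by linarith))
  · have : P * (j + 1) ≤ P * i := by gcongr; exact_mod_cast hlt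
    exact le_abs.2 (.inl (by linarith))

lemma le_norm_sub_of_gridPoint_ne (hs₀ : 0 < s) (hs₁ : s ≤ 1) {p p' : ℕ × ℕ} (hne : p ≠ p')
    {w w' : ℂ} (hw : w ∈ expBox s (gridPoint s u₀ y₀ p))
    (hw' : w' ∈ expBox s (gridPoint s u₀ y₀ p')) : s ≤ ‖w - w'‖ := by
  obtain ⟨hre₁, hre₂, him⟩ := hw
  obtain ⟨hre₁', hre₂', him'⟩ := hw'
  simp only [gridPoint, abs_le] at hre₁ hre₂ him hre₁' hre₂' him'
  have hπ := Real.pi_gt_three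
  by_cases h₁ : p.1 = p'.1
  · have h₂ : p.2 ≠ p'.2 := fun h₂ => hne (Prod.ext h₁ h₂)
    have hle := le_abs_sub_of_natCast_ne (x := w.im - y₀ + Real.pi) (y := w'.im - y₀ + Real.pi)
      (Q := 2 * Real.pi) h₂ (show 0 < 4 * Real.pi by positivity)
      ⟨by linarith, by linarith⟩ ⟨by linarith, by linarith⟩
    rw [add_sub_add_right_eq_sub, sub_sub_sub_cancel_right, ← Complex.sub_im] at hle
    linarith [Complex.abs_im_le_norm (w - w')]
  · have hle := le_abs_sub_of_natCast_ne (x := w.re - u₀) (y := w'.re - u₀) (Q := s) h₁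
      (show 0 < 2 * s by positivity) ⟨by linarith, by linarith⟩ ⟨by linarith, by linarith⟩
    rw [sub_sub_sub_cancel_right, ← Complex.sub_re] at hle
    linarith [Complex.abs_re_le_norm (w - w')]

lemma card_le_of_forall_natCast_mem_Icc {S : Finset ℕ} {u v : ℝ} (huv : 0 ≤ v - u + 2)
    (hS : ∀ i ∈ S, (i : ℝ) ∈ Icc u v) : (S.card : ℝ) ≤ v - u + 2 := by
  refine le_trans ?_ (card_Icc_floor_le huv)
  have hcard : S.card ≤ (Finset.Icc ⌊u⌋ ⌊v⌋).card :=
    Finset.card_le_card_of_injOn (fun i => (i : ℤ))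
      (fun i hi => Finset.mem_Icc.2
        ⟨by exact_mod_cast (Int.floor_le u).trans (hS i hi).1,
          Int.le_floor.2 (by exact_mod_cast (hS i hi).2)⟩)
      Nat.cast_injective.injOn
  exact_mod_cast hcard

lemma index_mem_of_meeting (hs₀ : 0 < s) {w : ℂ} {R : ℝ} {p : ℕ × ℕ}
    (hmeet : (expBox s (gridPoint s u₀ y₀ p) ∩ closedBall w R).Nonempty) :
    (p.1 : ℝ) ∈ Icc ((w.re - R - s - u₀) / (2 * s)) ((w.re + R - u₀) / (2 * s)) ∧
    (p.2 : ℝ) ∈ Icc ((w.im - R - Real.pi - y₀) / (4 * Real.pi))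
      ((w.im + R + Real.pi - y₀) / (4 * Real.pi)) := by
  obtain ⟨y, ⟨hre₁, hre₂, him⟩, hy⟩ := hmeet
  simp only [gridPoint, abs_le] at hre₁ hre₂ him
  rw [mem_closedBall, dist_eq_norm] at hy
  have hre' := abs_le.1 ((Complex.abs_re_le_norm (y - w)).trans hy)
  have him' := abs_le.1 ((Complex.abs_im_le_norm (y - w)).trans hy)
  rw [Complex.sub_re] at hre'
  rw [Complex.sub_im] at him'
  have := Real.pi_pos
  refine ⟨⟨?_, ?_⟩, ?_, ?_⟩
  · rw [div_le_iff₀ (by positivity)]; linarith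
  · rw [le_div_iff₀ (by positivity)]; linarith
  · rw [div_le_iff₀ (by positivity)]; linarith
  · rw [le_div_iff₀ (by positivity)]; linarith

lemma card_rows_le {m R u : ℝ} {S : Finset ℕ} (hs₀ : 0 < s) (hm : 0 < m) (hR : 0 ≤ R)
    (hI : 2 * s * I ≤ m) (hSI : S ⊆ Finset.range I)
    (hS : ∀ i ∈ S, (i : ℝ) ∈ Icc ((u - R - s - u₀) / (2 * s)) ((u + R - u₀) / (2 * s))) :
    (S.card : ℝ) ≤ (3 + 1 / s) * (1 + min R m) := by
  have hs' : 0 < 1 / s := by positivity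
  rcases le_total R m with hRm | hRm
  · rw [min_eq_left hRm]
    have hwidth : (u + R - u₀) / (2 * s) - (u - R - s - u₀) / (2 * s) = 1 / s * R + 1 / 2 := by
      field_simp; ring
    have hsR : 0 ≤ 1 / s * R := by positivity
    calc (S.card : ℝ) ≤ _ := card_le_of_forall_natCast_mem_Icc (by linarith) hS
      _ ≤ (3 + 1 / s) * (1 + R) := by rw [hwidth]; nlinarith
  · rw [min_eq_right hRm]
    have hsm : 0 < 1 / s * m := by positivity
    calc (S.card : ℝ) ≤ I := by
          exact_mod_cast (Finset.card_le_card hSI).trans_eq (Finset.card_range I)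
      _ ≤ m / (2 * s) := by rw [le_div_iff₀ (by positivity)]; linarith
      _ = 1 / s * m / 2 := by field_simp
      _ ≤ (3 + 1 / s) * (1 + m) := by nlinarith

lemma card_columns_le {R v : ℝ} {S : Finset ℕ} (hR : 0 ≤ R)
    (hS : ∀ j ∈ S, (j : ℝ) ∈ Icc ((v - R - Real.pi - y₀) / (4 * Real.pi))
      ((v + R + Real.pi - y₀) / (4 * Real.pi))) :
    (S.card : ℝ) ≤ 3 * (1 + R) := by
  have hwidth : (v + R + Real.pi - y₀) / (4 * Real.pi) - (v - R - Real.pi - y₀) / (4 * Real.pi) =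
      R / (2 * Real.pi) + 1 / 2 := by
    field_simp; ring
  have hRπ : 0 ≤ R / (2 * Real.pi) := by positivity
  have hRR : R / (2 * Real.pi) ≤ R := div_le_self hR (by linarith [Real.pi_gt_three])
  exact (card_le_of_forall_natCast_mem_Icc (by linarith) hS).trans (by linarith)

lemma card_meeting_gridPoints_le (hs₀ : 0 < s) {m R : ℝ} {w : ℂ} {T' : Finset ℂ} (hm : 0 < m)
    (hI : 2 * s * I ≤ m) (hR : 0 ≤ R) (hT' : T' ⊆ gridPoints s u₀ y₀ I J)
    (hmeet : ∀ ζ ∈ T', (expBox s ζ ∩ closedBall w R).Nonempty) :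
    (T'.card : ℝ) ≤ 3 * (3 + 1 / s) * ((1 + R) * (1 + min R m)) := by
  obtain ⟨P, hP, rfl⟩ := Finset.subset_image_iff.1 hT'
  have hindex : ∀ p ∈ P, _ := fun p hp =>
    index_mem_of_meeting hs₀ (hmeet _ (Finset.mem_image_of_mem _ hp))
  have hrows : ((P.image Prod.fst).card : ℝ) ≤ (3 + 1 / s) * (1 + min R m) := by
    refine card_rows_le (I := I) (u := w.re) hs₀ hm hR hI ?_
      (Finset.forall_mem_image.2 fun p hp => (hindex p hp).1)
    exact Finset.image_subset_iff.2 fun p hp => (Finset.mem_product.1 (hP hp)).1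
  have hcolumns : ((P.image Prod.snd).card : ℝ) ≤ 3 * (1 + R) :=
    card_columns_le (v := w.im) hR (Finset.forall_mem_image.2 fun p hp => (hindex p hp).2)
  have hcard : (P.image (gridPoint s u₀ y₀)).card ≤
      (P.image Prod.fst).card * (P.image Prod.snd).card := by
    rw [← Finset.card_product]
    exact Finset.card_image_le.trans (Finset.card_le_card Finset.subset_product)
  calc ((P.image (gridPoint s u₀ y₀)).card : ℝ)
      ≤ (P.image Prod.fst).card * (P.image Prod.snd).card := by exact_mod_cast hcard
    _ ≤ (3 + 1 / s) * (1 + min R m) * (3 * (1 + R)) :=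
        mul_le_mul hrows hcolumns (Nat.cast_nonneg _) ((Nat.cast_nonneg _).trans hrows)
    _ = 3 * (3 + 1 / s) * ((1 + R) * (1 + min R m)) := by ring

end Grid

lemma half_le_natFloor {y : ℝ} (hy : 1 ≤ y) : y / 2 ≤ ⌊y⌋₊ := by
  have hlt := Nat.lt_floor_add_one y
  have hle : (1 : ℝ) ≤ ⌊y⌋₊ := by exact_mod_cast Nat.one_le_floor_iff y |>.2 hy
  linarith

lemma mul_natFloor_div_le {x y : ℝ} (hx : 0 < x) (hy : 0 ≤ y) : x * ⌊y / x⌋₊ ≤ y := by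
  have := Nat.floor_le (show 0 ≤ y / x by positivity)
  rwa [le_div_iff₀ hx, mul_comm] at this

lemma exists_subinterval {q X c α β : ℝ} (hq : 0 ≤ q) (hX : 0 < X) (hc : c ≤ 1 - q)
    (hα : α ≤ q * X) (hβ : -(q * X) ≤ β) :
    ∃ u₀, α ≤ u₀ ∧ u₀ + min (β - α) (c * X) ≤ β ∧ -X ≤ u₀ ∧ u₀ + min (β - α) (c * X) ≤ X := by
  have hcX : c * X ≤ (1 - q) * X := by gcongr
  have hqX : 0 ≤ q * X := by positivity
  have hℓ₁ := min_le_left (β - α) (c * X)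
  have hℓ₂ := min_le_right (β - α) (c * X)
  refine ⟨max α (-X), le_max_left _ _, ?_, le_max_right _ _, ?_⟩ <;>
    rcases max_cases α (-X) with h | h <;> rw [h.1] <;> linarith

lemma isBoxFamily_gridPoints {X s c δ u₀ : ℝ} (hs₀ : 0 < s) (hs₁ : s ≤ 1) (hc₀ : 0 < c)
    (hc : c ≤ s / 8) (hX : 64 ≤ s * X) (hcX : 4 * s ≤ c * X) (hδ : 4 * s ≤ δ) (hu₀ : -X ≤ u₀)
    (hu₁ : u₀ + min δ (c * X) ≤ X) :
    IsBoxFamily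
      (gridPoints s u₀ (√(X ^ 2 - u₀ ^ 2 + 2 * c * X ^ 2) + Real.pi)
        ⌊min δ (c * X) / (2 * s)⌋₊ ⌊s / 4 * X / (4 * Real.pi)⌋₊)
      s (c / (4 * s) * (s / 4 / (8 * Real.pi))) (3 * (3 + 1 / s)) δ X := by
  have hX₀ : 0 < X := by nlinarith
  set ℓ := min δ (c * X)
  have hℓ : 4 * s ≤ ℓ := le_min hδ hcX
  have hI : 2 * s * ⌊ℓ / (2 * s)⌋₊ ≤ ℓ := mul_natFloor_div_le (by positivity) (by linarith)
  have hJ : 4 * Real.pi * ⌊s / 4 * X / (4 * Real.pi)⌋₊ ≤ s / 4 * X :=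
    mul_natFloor_div_le (by positivity) (by positivity)
  refine ⟨fun ζ hζ w hw => ?_, fun ζ hζ ζ' hζ' hne w hw w' hw' => ?_, ?_,
    fun w R hR T' hT' hmeet => ?_⟩
  · obtain ⟨hre₁, hre₂, him⟩ := hw
    obtain ⟨him₁, him₂⟩ := abs_le.1 him
    obtain ⟨hζ₁, hζ₂⟩ := re_mem_of_mem_gridPoints hs₀ hζ
    obtain ⟨hζ₃, hζ₄⟩ := im_mem_of_mem_gridPoints hζ
    have hsq := sq_bounds_of_mem_rectangle (u := w.re) (v := w.im) hX₀ hs₀ hs₁ hc₀ hc hu₀ hu₁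
      (by linarith) (min_le_right _ _) ⟨by linarith, by linarith⟩ ⟨by linarith, by linarith⟩
    rw [sq w.re, sq w.im, ← Complex.normSq_apply, ← Complex.sq_norm] at hsq
    exact ⟨abs_le_of_sq_le_sq' hsq.1 (norm_nonneg _) |>.2,
      abs_le_of_sq_le_sq' hsq.2 (by positivity) |>.2⟩
  · obtain ⟨p, -, rfl⟩ := Finset.mem_image.1 hζ
    obtain ⟨p', -, rfl⟩ := Finset.mem_image.1 hζ'
    exact le_norm_sub_of_gridPoint_ne hs₀ hs₁ (fun hpp => hne (congrArg _ hpp)) hw hw'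
  · have hI' : ℓ / (2 * s) / 2 ≤ ⌊ℓ / (2 * s)⌋₊ :=
      half_le_natFloor ((le_div_iff₀ (by positivity)).2 (by linarith))
    have hJ' : s / 4 * X / (4 * Real.pi) / 2 ≤ ⌊s / 4 * X / (4 * Real.pi)⌋₊ :=
      half_le_natFloor ((le_div_iff₀ (by positivity)).2 (by linarith [Real.pi_le_four]))
    have hcℓ : c * min δ X ≤ ℓ := by
      rw [mul_min_of_nonneg _ _ hc₀.le]
      exact min_le_min_right _ (mul_le_of_le_one_left (by linarith) (by linarith))
    rw [card_gridPoints hs₀, Nat.cast_mul]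
    calc c / (4 * s) * (s / 4 / (8 * Real.pi)) * (X * min δ X)
        = c * min δ X / (2 * s) / 2 * (s / 4 * X / (4 * Real.pi) / 2) := by ring
      _ ≤ ℓ / (2 * s) / 2 * (s / 4 * X / (4 * Real.pi) / 2) := by gcongr
      _ ≤ _ := by gcongr
  · refine card_meeting_gridPoints_le hs₀ (lt_min (by linarith) hX₀) (hI.trans ?_) hR hT' hmeet
    exact min_le_min_left _ (mul_le_of_le_one_left hX₀.le (by linarith))

lemma exists_hasBoxes {q D : ℝ} (hq₀ : 0 < q) (hq₁ : q < 1) (hD : 0 < D) :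
    ∃ s c C A : ℝ, HasBoxes q D s c C A := by
  obtain ⟨s, hs₀, hs₁, hsD⟩ : ∃ s : ℝ, 0 < s ∧ s ≤ 1 ∧ 4 * s ≤ D :=
    ⟨min D 1 / 4, by positivity, by linarith [min_le_right D 1], by linarith [min_le_left D 1]⟩
  obtain ⟨c, hc₀, hcs, hcq⟩ : ∃ c : ℝ, 0 < c ∧ c ≤ s / 8 ∧ c ≤ 1 - q :=
    ⟨min (s / 8) (1 - q), lt_min (by positivity) (by linarith), min_le_left _ _, min_le_right _ _⟩
  have hsc : 0 < 4 * s / c := by positivity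
  have hs64 : 0 < 64 / s := by positivity
  refine ⟨s, c / (4 * s) * (s / 4 / (8 * Real.pi)), 3 * (3 + 1 / s), 1 + 4 * s / c + 64 / s, hs₀,
    hs₁, by linarith, by positivity, by positivity, by linarith, fun X α β hX hδ hα hβ => ?_⟩
  have hX₀ : 0 < X := by linarith
  have hcX : 4 * s ≤ c * X := (div_le_iff₀' hc₀).1 (by linarith)
  have hsX : 64 ≤ s * X := (div_le_iff₀' hs₀).1 (by linarith)
  obtain ⟨u₀, hu₀α, hu₁β, hu₀X, hu₁X⟩ := exists_subinterval hq₀.le hX₀ hcq hα hβ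
  refine ⟨_, isBoxFamily_gridPoints hs₀ hs₁ hc₀ hcs hsX hcX (by linarith) hu₀X hu₁X,
    fun ζ hζ => ?_⟩
  obtain ⟨hζ₁, hζ₂⟩ := re_mem_of_mem_gridPoints hs₀ hζ
  have hI := mul_natFloor_div_le (show 0 < 2 * s by positivity)
    (show 0 ≤ min (β - α) (c * X) from le_min (by linarith) (by positivity))
  exact ⟨hu₀α.trans hζ₁, by linarith⟩

end BoxFamilies

/-! ### Trees of boxes -/

section BoxTrees

open Set Metric MeasureTheory

/-- A tree of boxes: every box of level `k ≥ N` with base point `ζ` in `V k` has the finite family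
`T k ζ` of boxes of the next level as its children. The point `ζ` is sent to the circle of radius
`‖lam (k + 1)‖ * exp ζ.re`, and the image of its box covers its children. -/
structure IsBoxTree (lam : ℕ → ℂ) (Δ : ℕ → ℝ) (s c C : ℝ) (N : ℕ) (V : ℕ → ℂ → Prop)
    (T : ℕ → ℂ → Finset ℂ) : Prop where
  lam_ne : ∀ n, 1 ≤ n → lam n ≠ 0
  s_pos : 0 < s
  s_le_one : s ≤ 1
  c_pos : 0 < c
  C_pos : 0 < C
  modulus_pos : ∀ n, 1 ≤ n → 0 < Δ n
  child_mem : ∀ k, N ≤ k → ∀ ζ, V k ζ → ∀ ζ' ∈ T k ζ, V (k + 1) ζ'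
  isBoxFamily : ∀ k, N ≤ k → ∀ ζ, V k ζ →
    IsBoxFamily (T k ζ) s c C (Δ (k + 2)) (‖lam (k + 1)‖ * Real.exp ζ.re)

/-- The inverse branch of `z ↦ lam (k + 1) * exp z` with values near `ζ`. -/
noncomputable def invBranch (lam : ℕ → ℂ) (k : ℕ) (ζ w : ℂ) : ℂ :=
  ζ + Complex.log (w / (lam (k + 1) * Complex.exp ζ))

/-- The measure distributing unit mass uniformly over `j` generations of boxes. -/
noncomputable def treeMeasure (lam : ℕ → ℂ) (T : ℕ → ℂ → Finset ℂ) : ℕ → ℕ → ℂ → Measure ℂ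
  | 0, _, ζ => Measure.dirac ζ
  | j + 1, k, ζ => ((T k ζ).card : ℝ≥0∞)⁻¹ •
      ∑ ζ' ∈ T k ζ, (treeMeasure lam T j (k + 1) ζ').map (invBranch lam k ζ)

/-- The points whose orbit follows `j` generations of boxes. -/
def treeSet (lam : ℕ → ℂ) (s : ℝ) (T : ℕ → ℂ → Finset ℂ) : ℕ → ℕ → ℂ → Set ℂ
  | 0, _, ζ => expBox s ζ
  | j + 1, k, ζ => {z | z ∈ expBox s ζ ∧
      ∃ ζ' ∈ T k ζ, lam (k + 1) * Complex.exp z ∈ treeSet lam s T j (k + 1) ζ'}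

/-- The points whose orbit follows all generations of boxes. -/
def treeLimit (lam : ℕ → ℂ) (s : ℝ) (T : ℕ → ℂ → Finset ℂ) (k : ℕ) (ζ : ℂ) : Set ℂ :=
  ⋂ j, treeSet lam s T j k ζ

/-- The bound for the mass of a ball of radius `r` around a point of level `k` of a tree of boxes
whose orbit has absolute values `x l`, obtained by following the ball up to level `n`, where its
radius is at most `r * ∏ 3 x l`. -/
noncomputable def ballMassBound (B : ℝ) (Δ x : ℕ → ℝ) (k n : ℕ) (r : ℝ) : ℝ :=
  (∏ l ∈ Finset.Ico (k + 1) (n + 1), B / (x l * min (Δ (l + 1)) (x l))) *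
    ((1 + r * ∏ l ∈ Finset.Ico (k + 1) (n + 1), 3 * x l) *
      (1 + min (r * ∏ l ∈ Finset.Ico (k + 1) (n + 1), 3 * x l) (min (Δ (n + 1)) (x n))))

section BallMassBound

variable {B r : ℝ} {Δ x : ℕ → ℝ} {k n : ℕ}

lemma ballMassBound_congr {x' : ℕ → ℝ} (hkn : k < n) (hx : ∀ l, k < l → x l = x' l) :
    ballMassBound B Δ x k n r = ballMassBound B Δ x' k n r := by
  have hprod (f : ℕ → ℝ → ℝ) : ∏ l ∈ Finset.Ico (k + 1) (n + 1), f l (x l) =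
      ∏ l ∈ Finset.Ico (k + 1) (n + 1), f l (x' l) :=
    Finset.prod_congr rfl fun l hl => by rw [hx l (Finset.mem_Ico.1 hl).1]
  simp only [ballMassBound, hx n hkn, hprod fun _ t => 3 * t,
    hprod fun l t => B / (t * min (Δ (l + 1)) t)]

lemma ballMassBound_self : ballMassBound B Δ x n n r =
    (1 + r) * (1 + min r (min (Δ (n + 1)) (x n))) := by
  simp [ballMassBound]

lemma ballMassBound_eq_mul (hkn : k < n) : ballMassBound B Δ x k n r =
    B / (x (k + 1) * min (Δ (k + 2)) (x (k + 1))) *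
      ballMassBound B Δ x (k + 1) n (r * (3 * x (k + 1))) := by
  have hbot (f : ℕ → ℝ) : ∏ l ∈ Finset.Ico (k + 1) (n + 1), f l =
      f (k + 1) * ∏ l ∈ Finset.Ico (k + 1 + 1) (n + 1), f l :=
    Finset.prod_eq_prod_Ico_succ_bot (by lia) f
  simp only [ballMassBound, hbot, mul_assoc]

lemma ballMassBound_nonneg (hB : 0 ≤ B) (hr : 0 ≤ r) (hΔ : ∀ l, 1 ≤ l → 0 ≤ Δ l)
    (hx : ∀ l, 0 ≤ x l) : 0 ≤ ballMassBound B Δ x k n r := by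
  have hmin (l : ℕ) : 0 ≤ min (Δ (l + 1)) (x l) := le_min (hΔ _ (by lia)) (hx l)
  have hR : 0 ≤ r * ∏ l ∈ Finset.Ico (k + 1) (n + 1), 3 * x l :=
    mul_nonneg hr <| Finset.prod_nonneg fun l _ => mul_nonneg (by norm_num) (hx l)
  have : 0 ≤ min (r * ∏ l ∈ Finset.Ico (k + 1) (n + 1), 3 * x l) (min (Δ (n + 1)) (x n)) :=
    le_min hR (hmin n)
  exact mul_nonneg (Finset.prod_nonneg fun l _ => div_nonneg hB (mul_nonneg (hx l) (hmin l)))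
    (by positivity)

end BallMassBound

lemma measurable_invBranch (lam : ℕ → ℂ) (k : ℕ) (ζ : ℂ) : Measurable (invBranch lam k ζ) := by
  unfold invBranch
  fun_prop

lemma isClosed_expBox (s : ℝ) (ζ : ℂ) : IsClosed (expBox s ζ) :=
  (isClosed_le continuous_const Complex.continuous_re).inter <|
    (isClosed_le Complex.continuous_re continuous_const).inter <|
      isClosed_le (Complex.continuous_im.sub continuous_const).abs continuous_const

lemma self_mem_expBox {s : ℝ} (hs : 0 ≤ s) (ζ : ℂ) : ζ ∈ expBox s ζ :=
  ⟨le_rfl, le_add_of_nonneg_right hs, by simpa using Real.pi_pos.le⟩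

lemma norm_sub_le_of_mem_expBox {s : ℝ} {ζ w : ℂ} (hs : s ≤ 1) (hw : w ∈ expBox s ζ) :
    ‖w - ζ‖ ≤ 1 + Real.pi := by
  refine (Complex.norm_le_abs_re_add_abs_im _).trans ?_
  rw [Complex.sub_re, Complex.sub_im]
  exact add_le_add (abs_le.2 ⟨by linarith [hw.1], by linarith [hw.2.1]⟩) hw.2.2

lemma norm_mul_exp_mem_of_mem_expBox {s : ℝ} {c ζ z : ℂ} (hz : z ∈ expBox s ζ) :
    ‖c‖ * Real.exp ζ.re ≤ ‖c * Complex.exp z‖ ∧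
      ‖c * Complex.exp z‖ ≤ ‖c‖ * Real.exp ζ.re * Real.exp s := by
  rw [norm_mul, Complex.norm_exp, mul_assoc, ← Real.exp_add]
  exact ⟨mul_le_mul_of_nonneg_left (Real.exp_le_exp.2 hz.1) (norm_nonneg c),
    mul_le_mul_of_nonneg_left (Real.exp_le_exp.2 hz.2.1) (norm_nonneg c)⟩

lemma norm_exp_sub_le {s : ℝ} (hs : s ≤ 1) {c ζ z w : ℂ} (hz : z ∈ expBox s ζ)
    (hw : w ∈ expBox s ζ) :
    ‖c * Complex.exp w - c * Complex.exp z‖ ≤ 3 * ‖c * Complex.exp z‖ * ‖w - z‖ := by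
  refine (convex_halfSpace_re_le (z.re + 1)).norm_image_sub_le_of_norm_hasDerivWithin_le
    (f' := fun y => c * Complex.exp y)
    (fun y _ => ((Complex.hasDerivAt_exp y).const_mul c).hasDerivWithinAt) (fun y hy => ?_)
    (show z.re ≤ z.re + 1 by linarith) (show w.re ≤ z.re + 1 by linarith [hz.1, hw.2.1])
  have hexp : Real.exp y.re ≤ 3 * Real.exp z.re := calc
    Real.exp y.re ≤ Real.exp (1 + z.re) := Real.exp_le_exp.2 (by rw [add_comm]; exact hy)
    _ = Real.exp 1 * Real.exp z.re := Real.exp_add _ _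
    _ ≤ 3 * Real.exp z.re := by gcongr; exact Real.exp_one_lt_three.le
  rw [norm_mul, norm_mul, Complex.norm_exp, Complex.norm_exp]
  calc ‖c‖ * Real.exp y.re ≤ ‖c‖ * (3 * Real.exp z.re) := by gcongr
    _ = 3 * (‖c‖ * Real.exp z.re) := by ring

section TreeSet

variable (lam : ℕ → ℂ) (s : ℝ) (T : ℕ → ℂ → Finset ℂ)

lemma treeSet_subset_expBox (j k : ℕ) (ζ : ℂ) : treeSet lam s T j k ζ ⊆ expBox s ζ := by
  cases j with
  | zero => exact subset_rfl
  | succ j => exact fun z hz => hz.1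

lemma treeLimit_subset_expBox (k : ℕ) (ζ : ℂ) : treeLimit lam s T k ζ ⊆ expBox s ζ :=
  iInter_subset _ 0

lemma isClosed_treeSet (j : ℕ) : ∀ k ζ, IsClosed (treeSet lam s T j k ζ) := by
  induction j with
  | zero => exact fun _ ζ => isClosed_expBox s ζ
  | succ j ih =>
    intro k ζ
    have hsucc : treeSet lam s T (j + 1) k ζ = expBox s ζ ∩
        (fun z => lam (k + 1) * Complex.exp z) ⁻¹' ⋃ ζ' ∈ T k ζ, treeSet lam s T j (k + 1) ζ' := by
      ext z; simp [treeSet]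
    rw [hsucc]
    refine (isClosed_expBox s ζ).inter (IsClosed.preimage (by fun_prop) ?_)
    exact (T k ζ).finite_toSet.isClosed_biUnion fun ζ' _ => ih (k + 1) ζ'

lemma isClosed_treeLimit (k : ℕ) (ζ : ℂ) : IsClosed (treeLimit lam s T k ζ) :=
  isClosed_iInter fun j => isClosed_treeSet lam s T j k ζ

lemma treeSet_succ_subset (j : ℕ) : ∀ k ζ, treeSet lam s T (j + 1) k ζ ⊆ treeSet lam s T j k ζ := by
  induction j with
  | zero => exact fun k ζ z hz => hz.1
  | succ j ih =>
    rintro k ζ z ⟨hz, ζ', hζ', hmem⟩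
    exact ⟨hz, ζ', hζ', ih _ _ hmem⟩

lemma treeSet_antitone (k : ℕ) (ζ : ℂ) : Antitone fun j => treeSet lam s T j k ζ :=
  antitone_nat_of_succ_le fun j => treeSet_succ_subset lam s T j k ζ

variable {lam s T}

lemma exists_child_mem_treeLimit {k : ℕ} {ζ z : ℂ} (hz : z ∈ treeLimit lam s T k ζ) :
    ∃ ζ' ∈ T k ζ, lam (k + 1) * Complex.exp z ∈ treeLimit lam s T (k + 1) ζ' := by
  classical
  by_contra! hcon
  have hexit : ∀ ζ' ∈ T k ζ, ∃ j, lam (k + 1) * Complex.exp z ∉ treeSet lam s T j (k + 1) ζ' :=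
    fun ζ' hζ' => by simpa [treeLimit] using hcon ζ' hζ'
  choose! j hj using hexit
  obtain ⟨-, ζ', hζ', hmem⟩ := mem_iInter.1 hz ((T k ζ).sup j + 1)
  exact hj ζ' hζ' (treeSet_antitone lam s T (k + 1) ζ' (Finset.le_sup hζ') hmem)

end TreeSet

lemma treeMeasure_succ_apply {lam : ℕ → ℂ} {T : ℕ → ℂ → Finset ℂ} {j k : ℕ} {ζ : ℂ} {B : Set ℂ}
    (hB : MeasurableSet B) :
    treeMeasure lam T (j + 1) k ζ B = ((T k ζ).card : ℝ≥0∞)⁻¹ *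
      ∑ ζ' ∈ T k ζ, treeMeasure lam T j (k + 1) ζ' (invBranch lam k ζ ⁻¹' B) := by
  rw [treeMeasure]
  simp only [Measure.smul_apply, Measure.coe_finsetSum, Finset.sum_apply, smul_eq_mul,
    Measure.map_apply (measurable_invBranch _ _ _) hB]

namespace IsBoxTree

variable {lam : ℕ → ℂ} {Δ : ℕ → ℝ} {s c C : ℝ} {N : ℕ} {V : ℕ → ℂ → Prop}
  {T : ℕ → ℂ → Finset ℂ} (h : IsBoxTree lam Δ s c C N V T)
include h

lemma norm_mul_exp_pos (k : ℕ) (z : ℂ) : 0 < ‖lam (k + 1) * Complex.exp z‖ :=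
  norm_pos_iff.2 (mul_ne_zero (h.lam_ne _ (by lia)) (Complex.exp_ne_zero _))

lemma min_norm_mul_exp_pos (k : ℕ) (z : ℂ) :
    0 < min (Δ (k + 2)) ‖lam (k + 1) * Complex.exp z‖ :=
  lt_min (h.modulus_pos _ (by lia)) (h.norm_mul_exp_pos k z)

lemma invBranch_mem {k : ℕ} (hk : N ≤ k) {ζ ζ' w : ℂ} (hζ : V k ζ) (hζ' : ζ' ∈ T k ζ)
    (hw : w ∈ expBox s ζ') :
    invBranch lam k ζ w ∈ expBox s ζ ∧ lam (k + 1) * Complex.exp (invBranch lam k ζ w) = w := by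
  have hζ_norm := h.norm_mul_exp_pos k ζ
  obtain ⟨hle, hge⟩ := (h.isBoxFamily k hk ζ hζ).annulus ζ' hζ' w hw
  rw [← Complex.norm_exp, ← norm_mul] at hle hge
  have hne : lam (k + 1) * Complex.exp ζ ≠ 0 := norm_pos_iff.1 hζ_norm
  have hw_pos : 0 < ‖w‖ := hζ_norm.trans_le hle
  have hlog₀ : 0 ≤ Real.log (‖w‖ / ‖lam (k + 1) * Complex.exp ζ‖) :=
    Real.log_nonneg ((one_le_div hζ_norm).2 hle)
  have hlog₁ : Real.log (‖w‖ / ‖lam (k + 1) * Complex.exp ζ‖) ≤ s := by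
    rwa [Real.log_le_iff_le_exp (div_pos hw_pos hζ_norm), div_le_iff₀' hζ_norm]
  refine ⟨⟨?_, ?_, ?_⟩, ?_⟩
  · simpa only [invBranch, Complex.add_re, Complex.log_re, norm_div, le_add_iff_nonneg_right]
  · simpa only [invBranch, Complex.add_re, Complex.log_re, norm_div, add_le_add_iff_left]
  · simpa only [invBranch, Complex.add_im, Complex.log_im, add_sub_cancel_left] using
      Complex.abs_arg_le_pi _
  · rw [invBranch, Complex.exp_add, Complex.exp_log (div_ne_zero (norm_pos_iff.1 hw_pos) hne),
      ← mul_assoc, mul_div_cancel₀ _ hne]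

lemma card_pos {k : ℕ} (hk : N ≤ k) {ζ : ℂ} (hζ : V k ζ) : 0 < (T k ζ).card := by
  have hX := h.norm_mul_exp_pos k ζ
  have hmin := h.min_norm_mul_exp_pos k ζ
  rw [norm_mul, Complex.norm_exp] at hX hmin
  have hcard := (h.isBoxFamily k hk ζ hζ).le_card
  exact_mod_cast (mul_pos h.c_pos (mul_pos hX hmin)).trans_le hcard

lemma isProbabilityMeasure_treeMeasure (j : ℕ) : ∀ k, N ≤ k → ∀ ζ, V k ζ →
    IsProbabilityMeasure (treeMeasure lam T j k ζ) := by
  induction j with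
  | zero => intro k _ ζ _; rw [treeMeasure]; infer_instance
  | succ j ih =>
    refine fun k hk ζ hζ => ⟨?_⟩
    have hchild : ∀ ζ' ∈ T k ζ,
        treeMeasure lam T j (k + 1) ζ' (invBranch lam k ζ ⁻¹' univ) = 1 := fun ζ' hζ' => by
      have := ih (k + 1) (by lia) ζ' (h.child_mem k hk ζ hζ ζ' hζ')
      rw [preimage_univ, measure_univ]
    rw [treeMeasure_succ_apply MeasurableSet.univ, Finset.sum_congr rfl hchild, Finset.sum_const,
      nsmul_eq_mul, mul_one]
    exact ENNReal.inv_mul_cancel (by exact_mod_cast (h.card_pos hk hζ).ne')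
      (ENNReal.natCast_ne_top _)

lemma treeMeasure_compl_treeSet (j : ℕ) : ∀ i ≤ j, ∀ k, N ≤ k → ∀ ζ, V k ζ →
    treeMeasure lam T j k ζ (treeSet lam s T i k ζ)ᶜ = 0 := by
  induction j with
  | zero =>
    intro i hi k _ ζ _
    obtain rfl : i = 0 := by lia
    rw [treeMeasure, Measure.dirac_apply' _ (isClosed_treeSet _ _ _ _ _ _).measurableSet.compl]
    simp [treeSet, self_mem_expBox h.s_pos.le ζ]
  | succ j ih =>
    intro i hi k hk ζ hζ
    rw [treeMeasure_succ_apply (isClosed_treeSet _ _ _ _ _ _).measurableSet.compl,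
      Finset.sum_eq_zero, mul_zero]
    intro ζ' hζ'
    refine measure_mono_null ?_ (ih (i - 1) (by lia) (k + 1) (by lia) ζ'
      (h.child_mem k hk ζ hζ ζ' hζ'))
    refine fun w hw hwS => hw ?_
    obtain ⟨hmem, heq⟩ := h.invBranch_mem hk hζ hζ' (treeSet_subset_expBox _ _ _ _ _ _ hwS)
    cases i with
    | zero => exact hmem
    | succ i => exact ⟨hmem, ζ', hζ', heq.symm ▸ hwS⟩

lemma treeMeasure_preimage_le {j k : ℕ} (hk : N ≤ k) {ζ ζ' z : ℂ} (hζ : V k ζ)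
    (hζ' : ζ' ∈ T k ζ) (hz : z ∈ expBox s ζ) (r : ℝ) :
    treeMeasure lam T j (k + 1) ζ' (invBranch lam k ζ ⁻¹' closedBall z r) ≤
      treeMeasure lam T j (k + 1) ζ' (expBox s ζ' ∩ closedBall (lam (k + 1) * Complex.exp z)
        (r * (3 * ‖lam (k + 1) * Complex.exp z‖))) := by
  have hnull : treeMeasure lam T j (k + 1) ζ' (expBox s ζ')ᶜ = 0 :=
    h.treeMeasure_compl_treeSet j 0 (Nat.zero_le _) (k + 1) (by lia) ζ'
      (h.child_mem k hk ζ hζ ζ' hζ')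
  rw [← measure_inter_conull (t := expBox s ζ') hnull]
  refine measure_mono fun w ⟨hwball, hwbox⟩ => ⟨hwbox, ?_⟩
  obtain ⟨hmem, heq⟩ := h.invBranch_mem hk hζ hζ' hwbox
  rw [mem_preimage, mem_closedBall, dist_eq_norm] at hwball
  rw [mem_closedBall, dist_eq_norm, mul_comm r]
  calc ‖w - lam (k + 1) * Complex.exp z‖
      ≤ 3 * ‖lam (k + 1) * Complex.exp z‖ * ‖invBranch lam k ζ w - z‖ := by
        simpa only [heq] using norm_exp_sub_le h.s_le_one (c := lam (k + 1)) hz hmem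
    _ ≤ 3 * ‖lam (k + 1) * Complex.exp z‖ * r := by gcongr

lemma treeMeasure_succ_closedBall_le {j k : ℕ} (hk : N ≤ k) {ζ z : ℂ} (hζ : V k ζ)
    (hz : z ∈ expBox s ζ) (r : ℝ) :
    treeMeasure lam T (j + 1) k ζ (closedBall z r) ≤ ((T k ζ).card : ℝ≥0∞)⁻¹ *
      ∑ ζ' ∈ T k ζ, treeMeasure lam T j (k + 1) ζ' (expBox s ζ' ∩
        closedBall (lam (k + 1) * Complex.exp z) (r * (3 * ‖lam (k + 1) * Complex.exp z‖))) := by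
  rw [treeMeasure_succ_apply isClosed_closedBall.measurableSet]
  refine mul_le_mul_right (Finset.sum_le_sum fun ζ' hζ' => ?_) _
  exact h.treeMeasure_preimage_le hk hζ hζ' hz r

lemma sum_treeMeasure_le_card_meeting {j k : ℕ} (hk : N ≤ k) {ζ z : ℂ} (hζ : V k ζ)
    (hz : z ∈ expBox s ζ) {R : ℝ} (hR : 0 ≤ R) :
    ∑ ζ' ∈ T k ζ, treeMeasure lam T j (k + 1) ζ'
        (expBox s ζ' ∩ closedBall (lam (k + 1) * Complex.exp z) R) ≤
      ENNReal.ofReal (C * ((1 + R) *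
        (1 + min R (min (Δ (k + 2)) ‖lam (k + 1) * Complex.exp z‖)))) := by
  classical
  set T' := (T k ζ).filter fun ζ' =>
    (expBox s ζ' ∩ closedBall (lam (k + 1) * Complex.exp z) R).Nonempty
  have hcount : (T'.card : ℝ) ≤ C * ((1 + R) *
      (1 + min R (min (Δ (k + 2)) ‖lam (k + 1) * Complex.exp z‖))) := by
    refine ((h.isBoxFamily k hk ζ hζ).card_meeting_le _ R hR T' (Finset.filter_subset _ _)
      fun ζ' hζ' => (Finset.mem_filter.1 hζ').2).trans ?_
    have := h.C_pos
    gcongr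
    exact (norm_mul_exp_mem_of_mem_expBox hz).1
  calc _ ≤ (T'.card : ℝ≥0∞) := by
        rw [Finset.card_filter, Nat.cast_sum]
        refine Finset.sum_le_sum fun ζ' hζ' => ?_
        split_ifs with hne
        · have := h.isProbabilityMeasure_treeMeasure j (k + 1) (by lia) ζ'
            (h.child_mem k hk ζ hζ ζ' hζ')
          simpa using prob_le_one
        · rw [not_nonempty_iff_eq_empty.1 hne, measure_empty]
          exact zero_le
    _ ≤ _ := by
        rw [← ENNReal.ofReal_natCast]
        exact ENNReal.ofReal_le_ofReal hcount

lemma sum_treeMeasure_eq_single {j k : ℕ} (hk : N ≤ k) {ζ ζ₀ z : ℂ} (hζ : V k ζ)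
    (hζ₀ : ζ₀ ∈ T k ζ) (hz : z ∈ expBox s ζ₀) {R : ℝ} (hR : R < s) :
    ∑ ζ' ∈ T k ζ, treeMeasure lam T j (k + 1) ζ' (expBox s ζ' ∩ closedBall z R) =
      treeMeasure lam T j (k + 1) ζ₀ (expBox s ζ₀ ∩ closedBall z R) := by
  refine Finset.sum_eq_single_of_mem ζ₀ hζ₀ fun ζ' hζ' hne => ?_
  have hempty : expBox s ζ' ∩ closedBall z R = ∅ := by
    refine eq_empty_of_forall_notMem fun w ⟨hwbox, hwball⟩ => ?_
    have hsep := (h.isBoxFamily k hk ζ hζ).separated ζ' hζ' ζ₀ hζ₀ hne w hwbox z hz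
    rw [mem_closedBall, dist_eq_norm] at hwball
    linarith
  rw [hempty, measure_empty]

lemma norm_mul_min_le {k : ℕ} {ζ z : ℂ} (hz : z ∈ expBox s ζ) :
    ‖lam (k + 1) * Complex.exp z‖ * min (Δ (k + 2)) ‖lam (k + 1) * Complex.exp z‖ ≤
      9 * (‖lam (k + 1)‖ * Real.exp ζ.re *
        min (Δ (k + 2)) (‖lam (k + 1)‖ * Real.exp ζ.re)) := by
  obtain ⟨-, hle⟩ := norm_mul_exp_mem_of_mem_expBox (c := lam (k + 1)) hz
  set X := ‖lam (k + 1)‖ * Real.exp ζ.re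
  set x := ‖lam (k + 1) * Complex.exp z‖
  have hx : x ≤ 3 * X := calc
    x ≤ X * Real.exp s := hle
    _ ≤ X * 3 := by
      gcongr
      exact (Real.exp_le_exp.2 h.s_le_one).trans Real.exp_one_lt_three.le
    _ = 3 * X := mul_comm _ _
  have hmin : min (Δ (k + 2)) x ≤ 3 * min (Δ (k + 2)) X :=
    (min_le_min le_rfl hx).trans
      (min_mul_le_mul_min (by norm_num) (h.modulus_pos (k + 2) (by lia)).le)
  calc x * min (Δ (k + 2)) x ≤ 3 * X * (3 * min (Δ (k + 2)) X) :=
        mul_le_mul hx hmin (h.min_norm_mul_exp_pos k z).le (by positivity)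
    _ = _ := by ring

lemma inv_card_mul_le {k : ℕ} (hk : N ≤ k) {ζ z : ℂ} (hζ : V k ζ) (hz : z ∈ expBox s ζ)
    {t : ℝ} (ht : 0 ≤ t) :
    ((T k ζ).card : ℝ≥0∞)⁻¹ * ENNReal.ofReal t ≤
      ENNReal.ofReal (9 / c / (‖lam (k + 1) * Complex.exp z‖ *
        min (Δ (k + 2)) ‖lam (k + 1) * Complex.exp z‖) * t) := by
  have hcard : (0 : ℝ) < (T k ζ).card := by exact_mod_cast h.card_pos hk hζ
  have hc := h.c_pos
  have hpos := mul_pos (h.norm_mul_exp_pos k z) (h.min_norm_mul_exp_pos k z)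
  rw [← ENNReal.ofReal_natCast, ← ENNReal.ofReal_inv_of_pos hcard,
    ← ENNReal.ofReal_mul (by positivity)]
  refine ENNReal.ofReal_le_ofReal (mul_le_mul_of_nonneg_right ?_ ht)
  rw [inv_eq_one_div, div_le_div_iff₀ hcard hpos, one_mul, div_mul_eq_mul_div, le_div_iff₀' hc]
  calc _ ≤ c * (9 * (‖lam (k + 1)‖ * Real.exp ζ.re *
          min (Δ (k + 2)) (‖lam (k + 1)‖ * Real.exp ζ.re))) := by
        exact mul_le_mul_of_nonneg_left (h.norm_mul_min_le hz) hc.le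
    _ ≤ 9 * (T k ζ).card := by linarith [(h.isBoxFamily k hk ζ hζ).le_card]

/-- As long as the image of the ball has radius less than `s` it meets only one box of each
generation; in generation `n` the boxes it meets are counted. -/
lemma treeMeasure_closedBall_le {u : ℂ} {n : ℕ} (j : ℕ) : ∀ k, N ≤ k → k < n → n ≤ k + j →
    ∀ ζ, V k ζ → nonautExp lam k u ∈ treeLimit lam s T k ζ →
    (∀ l, k < l → 1 ≤ ‖nonautExp lam l u‖) → ∀ r : ℝ, 0 ≤ r →
    r * ∏ l ∈ Finset.Ico (k + 1) n, 3 * ‖nonautExp lam l u‖ < s →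
    treeMeasure lam T j k ζ (closedBall (nonautExp lam k u) r) ≤ ENNReal.ofReal
      (ballMassBound (9 * (C + 1) / c) Δ (fun l => ‖nonautExp lam l u‖) k n r) := by
  have hc := h.c_pos
  have hC := h.C_pos
  set x : ℕ → ℝ := fun l => ‖nonautExp lam l u‖
  induction j with
  | zero => intros; lia
  | succ j ih =>
    intro k hk hkn hnj ζ hζ hu hx r hr hgap
    have hz := treeLimit_subset_expBox _ _ _ _ _ hu
    set R := r * (3 * x (k + 1))
    have hR : 0 ≤ R := by positivity
    have hb : 0 ≤ ballMassBound (9 * (C + 1) / c) Δ x (k + 1) n R :=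
      ballMassBound_nonneg (by positivity) hR (fun l hl => (h.modulus_pos l hl).le)
        fun l => norm_nonneg _
    suffices hsum : ∑ ζ' ∈ T k ζ, treeMeasure lam T j (k + 1) ζ' (expBox s ζ' ∩
        closedBall (nonautExp lam (k + 1) u) R) ≤
          ENNReal.ofReal ((C + 1) * ballMassBound (9 * (C + 1) / c) Δ x (k + 1) n R) by
      refine (h.treeMeasure_succ_closedBall_le hk hζ hz r).trans <|
        (mul_le_mul_right hsum _).trans <|
        (h.inv_card_mul_le hk hζ hz (by positivity)).trans_eq ?_
      rw [ballMassBound_eq_mul hkn]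
      congr 1
      simp only [x, nonautExp_succ, R]
      ring
    rcases (Nat.succ_le_of_lt hkn).eq_or_lt with rfl | hkn
    · rw [ballMassBound_self]
      refine (h.sum_treeMeasure_le_card_meeting hk hζ hz hR).trans (ENNReal.ofReal_le_ofReal ?_)
      have : 0 ≤ min R (min (Δ (k + 2)) (x (k + 1))) :=
        le_min hR (h.min_norm_mul_exp_pos k _).le
      exact mul_le_mul_of_nonneg_right (by linarith) (by positivity)
    · obtain ⟨ζ₀, hζ₀, hlim⟩ := exists_child_mem_treeLimit hu
      rw [Finset.prod_eq_prod_Ico_succ_bot hkn, ← mul_assoc] at hgap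
      have hprod : 1 ≤ ∏ l ∈ Finset.Ico (k + 1 + 1) n, 3 * x l :=
        Finset.one_le_prod fun l hl => by
          linarith [hx l (by have := (Finset.mem_Ico.1 hl).1; lia)]
      rw [← nonautExp_succ] at hlim
      rw [h.sum_treeMeasure_eq_single hk hζ hζ₀ (treeLimit_subset_expBox _ _ _ _ _ hlim)
        ((le_mul_of_one_le_right hR hprod).trans_lt hgap)]
      refine (measure_mono inter_subset_right).trans <|
        (ih (k + 1) (by lia) hkn (by lia) ζ₀ (h.child_mem k hk ζ hζ ζ₀ hζ₀) hlim
          (fun l hl => hx l (by lia)) R hR hgap).trans (ENNReal.ofReal_le_ofReal ?_)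
      exact le_mul_of_one_le_left hb (by linarith)

end IsBoxTree

end BoxTrees

section LimitMeasure

open Set Metric MeasureTheory

lemma isCompact_expBox {s : ℝ} (hs : s ≤ 1) (ζ : ℂ) : IsCompact (expBox s ζ) :=
  (isCompact_closedBall ζ (1 + Real.pi)).of_isClosed_subset (isClosed_expBox s ζ) fun w hw => by
    rw [mem_closedBall, dist_eq_norm]
    exact norm_sub_le_of_mem_expBox hs hw

lemma exists_limit_measure {Z : Type*} [PseudoEMetricSpace Z] [T2Space Z] [MeasurableSpace Z]
    [BorelSpace Z] {K : Set Z} (hK : IsCompact K) (ν : ℕ → Measure Z)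
    (hν : ∀ j, IsProbabilityMeasure (ν j)) (hνK : ∀ j, ν j Kᶜ = 0) :
    ∃ ν' : Measure Z, IsProbabilityMeasure ν' ∧
      ∀ U, IsOpen U → ∀ m, (∀ᶠ j in atTop, ν j U ≤ m) → ν' U ≤ m := by
  let νs : ℕ → ProbabilityMeasure Z := fun j => ⟨ν j, hν j⟩
  have htight : IsTightMeasureSet {x | ∃ μ ∈ range νs, (μ : Measure Z) = x} := by
    rw [isTightMeasureSet_iff_exists_isCompact_measure_compl_le]
    refine fun ε _ => ⟨K, hK, ?_⟩
    rintro _ ⟨_, ⟨j, rfl⟩, rfl⟩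
    exact (hνK j).trans_le zero_le
  have hclosure : ↑((hyperfilter ℕ).map νs) ≤ 𝓟 (closure (range νs)) :=
    le_principal_iff.2 (Filter.mem_of_superset Filter.range_mem_map subset_closure)
  obtain ⟨ν', -, hν'⟩ :=
    (isCompact_closure_of_isTightMeasureSet htight).ultrafilter_le_nhds _ hclosure
  have hlim : Tendsto νs (hyperfilter ℕ) (𝓝 ν') := hν'
  refine ⟨ν', inferInstance, fun U hU m hm => ?_⟩
  refine (ProbabilityMeasure.le_liminf_measure_open_of_tendsto hlim hU).trans ?_
  exact liminf_le_of_frequently_le' (hm.filter_mono Nat.hyperfilter_le_atTop).frequently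

lemma IsBoxTree.exists_limit_treeMeasure {lam : ℕ → ℂ} {Δ : ℕ → ℝ} {s c C : ℝ} {N : ℕ}
    {V : ℕ → ℂ → Prop} {T : ℕ → ℂ → Finset ℂ} (h : IsBoxTree lam Δ s c C N V T) {ζ : ℂ}
    (hζ : V N ζ) :
    ∃ ν : Measure ℂ, IsProbabilityMeasure ν ∧ ν (treeLimit lam s T N ζ)ᶜ = 0 ∧
      ∀ U, IsOpen U → ∀ m, (∀ᶠ j in atTop, treeMeasure lam T j N ζ U ≤ m) → ν U ≤ m := by
  obtain ⟨ν, hν, hνU⟩ := exists_limit_measure (isCompact_expBox h.s_le_one ζ)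
    (fun j => treeMeasure lam T j N ζ)
    (fun j => h.isProbabilityMeasure_treeMeasure j N le_rfl ζ hζ)
    (fun j => h.treeMeasure_compl_treeSet j 0 (Nat.zero_le _) N le_rfl ζ hζ)
  refine ⟨ν, hν, ?_, hνU⟩
  rw [treeLimit, compl_iInter, measure_iUnion_null_iff]
  refine fun i => le_antisymm (hνU _ (isClosed_treeSet _ _ _ _ _ _).isOpen_compl 0 ?_) zero_le
  filter_upwards [eventually_ge_atTop i] with j hj
  exact (h.treeMeasure_compl_treeSet j i hj N le_rfl ζ hζ).le

lemma contDiff_nonautExp (lam : ℕ → ℂ) (N : ℕ) : ContDiff ℂ 1 (nonautExp lam N) := by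
  induction N with
  | zero => exact contDiff_id
  | succ N ih => exact contDiff_const.mul ih.cexp

lemma exists_lipschitz_nonautExp (lam : ℕ → ℂ) (N : ℕ) (R : ℝ) : ∃ L : ℝ, 0 ≤ L ∧
    ∀ u v, ‖u‖ ≤ R → ‖v‖ ≤ R → ‖nonautExp lam N u - nonautExp lam N v‖ ≤ L * ‖u - v‖ := by
  obtain ⟨K, hK⟩ := (contDiff_nonautExp lam N).locallyLipschitz.locallyLipschitzOn
    |>.exists_lipschitzOnWith_of_compact (isCompact_closedBall (0 : ℂ) R)
  refine ⟨K, K.2, fun u v hu hv => ?_⟩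
  simpa only [dist_eq_norm] using hK.dist_le_mul u (by simpa using hu) v (by simpa using hv)

lemma norm_log_add_mem {r R : ℝ} (hr : 0 < r) {w : ℂ} (hrw : r ≤ ‖w‖) (hwR : ‖w‖ ≤ R) :
    1 ≤ ‖Complex.log w + (4 * Real.pi : ℝ) * Complex.I‖ ∧
      ‖Complex.log w + (4 * Real.pi : ℝ) * Complex.I‖ ≤
        max |Real.log r| |Real.log R| + 5 * Real.pi := by
  have hre : (Complex.log w + (4 * Real.pi : ℝ) * Complex.I).re = Real.log ‖w‖ := by
    rw [Complex.add_re, Complex.re_ofReal_mul, Complex.I_re, Complex.log_re, mul_zero, add_zero]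
  have him : (Complex.log w + (4 * Real.pi : ℝ) * Complex.I).im = w.arg + 4 * Real.pi := by
    rw [Complex.add_im, Complex.im_ofReal_mul, Complex.I_im, Complex.log_im, mul_one]
  have harg := abs_le.1 (Complex.abs_arg_le_pi w)
  constructor
  · refine le_trans ?_ (Complex.abs_im_le_norm _)
    rw [him]
    exact le_trans (by linarith [Real.pi_gt_three]) (le_abs_self _)
  · refine (Complex.norm_le_abs_re_add_abs_im _).trans ?_
    rw [hre, him]
    refine add_le_add (abs_le_max_abs_abs (Real.log_le_log hr hrw) ?_) (abs_le.2 ?_)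
    · exact Real.log_le_log (hr.trans_le hrw) hwR
    · constructor <;> linarith [Real.pi_pos]

/-- Adding `4πi` to the logarithm keeps the values of the inverse branches away from the origin,
so that the construction can be iterated. -/
lemma exists_rightInverse_nonautExp {lam : ℕ → ℂ} (hlam : ∀ n, 1 ≤ n → lam n ≠ 0) (N : ℕ) :
    ∀ r R : ℝ, 0 < r → ∃ g : ℂ → ℂ, Measurable g ∧ ∃ R₀ : ℝ, ∀ w, r ≤ ‖w‖ → ‖w‖ ≤ R →
      nonautExp lam N (g w) = w ∧ ‖g w‖ ≤ R₀ := by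
  induction N with
  | zero => exact fun r R _ => ⟨id, measurable_id, R, fun w _ hw => ⟨rfl, hw⟩⟩
  | succ N ih =>
    intro r R hr
    have hl := hlam (N + 1) (by lia)
    have : 0 < ‖lam (N + 1)‖ := norm_pos_iff.2 hl
    obtain ⟨g, hg, R₀, hgR⟩ := ih 1 (max |Real.log (r / ‖lam (N + 1)‖)|
      |Real.log (R / ‖lam (N + 1)‖)| + 5 * Real.pi) one_pos
    refine ⟨fun w => g (Complex.log (w / lam (N + 1)) + (4 * Real.pi : ℝ) * Complex.I),
      hg.comp (by fun_prop), R₀, fun w hrw hwR => ?_⟩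
    have hbounds := norm_log_add_mem (r := r / ‖lam (N + 1)‖) (R := R / ‖lam (N + 1)‖)
      (w := w / lam (N + 1)) (by positivity) (by rw [norm_div]; gcongr) (by rw [norm_div]; gcongr)
    obtain ⟨hinv, hnorm⟩ := hgR _ hbounds.1 hbounds.2
    have hperiod : ((4 * Real.pi : ℝ) : ℂ) * Complex.I = (2 : ℕ) * (2 * Real.pi * Complex.I) := by
      push_cast
      ring
    refine ⟨?_, hnorm⟩
    rw [nonautExp_succ, hinv, Complex.exp_add, hperiod, Complex.exp_nat_mul_two_pi_mul_I, mul_one,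
      Complex.exp_log (div_ne_zero (norm_pos_iff.1 (hr.trans_le hrw)) hl), mul_div_cancel₀ _ hl]

lemma exists_pullback_measure {lam : ℕ → ℂ} (hlam : ∀ n, 1 ≤ n → lam n ≠ 0) (N : ℕ)
    (ν : Measure ℂ) [NeZero ν] {F : Set ℂ} (hF : IsClosed F) {r₀ R : ℝ} (hr₀ : 0 < r₀)
    (hFr : ∀ w ∈ F, r₀ ≤ ‖w‖ ∧ ‖w‖ ≤ R) (hνF : ν Fᶜ = 0) :
    ∃ (μ : Measure ℂ) (E : Set ℂ) (L : ℝ), 1 ≤ L ∧ μ E ≠ 0 ∧ (∀ u ∈ E, nonautExp lam N u ∈ F) ∧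
      ∀ u ∈ E, ∀ r, 0 < r → μ (closedBall u r) ≤ ν (ball (nonautExp lam N u) (L * r)) := by
  obtain ⟨g, hg, R₀, hgR⟩ := exists_rightInverse_nonautExp hlam N r₀ R hr₀
  obtain ⟨L, hL₀, hL⟩ := exists_lipschitz_nonautExp lam N R₀
  set E : Set ℂ := {u | ‖u‖ ≤ R₀} ∩ nonautExp lam N ⁻¹' F
  have hE : MeasurableSet E := ((isClosed_le continuous_norm continuous_const).inter
    (hF.preimage (contDiff_nonautExp lam N).continuous)).measurableSet
  refine ⟨ν.map g, E, L + 1, by linarith, ?_, fun u hu => hu.2, fun u hu r hr => ?_⟩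
  · rw [Measure.map_apply hg hE]
    have hFE : F ⊆ g ⁻¹' E := fun w hw => by
      obtain ⟨hinv, hnorm⟩ := hgR w (hFr w hw).1 (hFr w hw).2
      exact ⟨hnorm, by rwa [mem_preimage, hinv]⟩
    intro hnull
    refine NeZero.ne ν (Measure.measure_univ_eq_zero.1 ?_)
    rw [← union_compl_self F]
    exact measure_union_null (measure_mono_null hFE hnull) hνF
  · rw [Measure.map_apply hg isClosed_closedBall.measurableSet, ← measure_inter_conull hνF]
    refine measure_mono fun w ⟨hw, hwF⟩ => ?_
    obtain ⟨hinv, hnorm⟩ := hgR w (hFr w hwF).1 (hFr w hwF).2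
    rw [mem_preimage, mem_closedBall, dist_eq_norm] at hw
    rw [mem_ball, dist_eq_norm]
    calc ‖w - nonautExp lam N u‖ ≤ L * ‖g w - u‖ := by
          simpa only [hinv] using hL (g w) u hnorm hu.1
      _ ≤ L * r := by gcongr
      _ < (L + 1) * r := by linarith

theorem IsBoxTree.exists_measure {lam : ℕ → ℂ} {Δ : ℕ → ℝ} {s c C : ℝ} {N : ℕ} {V : ℕ → ℂ → Prop}
    {T : ℕ → ℂ → Finset ℂ} (h : IsBoxTree lam Δ s c C N V T) {ζ : ℂ} (hζ : V N ζ)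
    (hζ₁ : ∀ w ∈ expBox s ζ, 1 ≤ ‖w‖) :
    ∃ (μ : Measure ℂ) (E : Set ℂ) (L : ℝ), 1 ≤ L ∧ μ E ≠ 0 ∧
      (∀ u ∈ E, nonautExp lam N u ∈ treeLimit lam s T N ζ) ∧
      ∀ u ∈ E, ∀ r, 0 < r → ∀ m, (∀ᶠ j in atTop,
        treeMeasure lam T j N ζ (closedBall (nonautExp lam N u) (L * r)) ≤ m) →
        μ (closedBall u r) ≤ m := by
  obtain ⟨ν, _, hνlim, hνU⟩ := h.exists_limit_treeMeasure hζ
  have hlim : ∀ w ∈ treeLimit lam s T N ζ, 1 ≤ ‖w‖ ∧ ‖w‖ ≤ ‖ζ‖ + (1 + Real.pi) := fun w hw => by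
    have hbox := treeLimit_subset_expBox _ _ _ _ _ hw
    exact ⟨hζ₁ w hbox, (norm_le_norm_add_norm_sub' w ζ).trans <| by
      gcongr
      exact norm_sub_le_of_mem_expBox h.s_le_one hbox⟩
  obtain ⟨μ, E, L, hL, hμE, hE, hball⟩ := exists_pullback_measure h.lam_ne N ν
    (isClosed_treeLimit lam s T N ζ) one_pos hlim hνlim
  refine ⟨μ, E, L, hL, hμE, hE, fun u hu r hr m hm => (hball u hu r hr).trans ?_⟩
  refine hνU _ isOpen_ball m (hm.mono fun j hj => ?_)
  exact (measure_mono ball_subset_closedBall).trans hj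

end LimitMeasure

section StripBoxes

open Set MeasureTheory

/-- The box with base point `ζ` is mapped by `E_{lam (k + 1)}` into the annulus of index `k + 1`. -/
def IsStripBox (lam : ℕ → ℂ) (a b : ℕ → ℝ) (s : ℝ) (k : ℕ) (ζ : ℂ) : Prop :=
  Real.log (a (k + 1) / ‖lam (k + 1)‖) ≤ ζ.re ∧ ζ.re + s ≤ Real.log (b (k + 1) / ‖lam (k + 1)‖)

namespace AnnulusData

variable {lam : ℕ → ℂ} {a b : ℕ → ℝ} {D s : ℝ} {k : ℕ} {ζ : ℂ} (h : AnnulusData lam a b D)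
include h

lemma log_div_norm_le_iff {n : ℕ} (hn : 1 ≤ n) {t : ℝ} :
    Real.log (a n / ‖lam n‖) ≤ t ↔ a n ≤ ‖lam n‖ * Real.exp t := by
  have hlam := norm_pos_iff.2 (h.lam_ne n hn)
  rw [Real.log_le_iff_le_exp (div_pos (h.a_pos n hn) hlam), div_le_iff₀' hlam]

lemma le_log_div_norm_iff {n : ℕ} (hn : 1 ≤ n) {t : ℝ} :
    t ≤ Real.log (b n / ‖lam n‖) ↔ ‖lam n‖ * Real.exp t ≤ b n := by
  have hlam := norm_pos_iff.2 (h.lam_ne n hn)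
  rw [Real.le_log_iff_exp_le (div_pos ((h.a_pos n hn).trans (h.a_lt n hn)) hlam),
    le_div_iff₀' hlam]

lemma mem_annulus_of_isStripBox (hζ : IsStripBox lam a b s k ζ) {z : ℂ} (hz : z ∈ expBox s ζ) :
    a (k + 1) ≤ ‖lam (k + 1)‖ * Real.exp z.re ∧ ‖lam (k + 1)‖ * Real.exp z.re ≤ b (k + 1) :=
  ⟨(h.log_div_norm_le_iff (by omega)).1 (hζ.1.trans hz.1),
    (h.le_log_div_norm_iff (by omega)).1 (hz.2.1.trans hζ.2)⟩

lemma exists_isBoxFamily_isStripBox {q c C A : ℝ} (hq : 0 < q) (hB : HasBoxes q D s c C A)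
    (hadm : a (k + 2) ≤ ‖lam (k + 2)‖ * Real.exp (q * a (k + 1)) ∧
      ‖lam (k + 2)‖ * Real.exp (-(q * a (k + 1))) ≤ b (k + 2))
    (hA : A ≤ a (k + 1)) (hζ : IsStripBox lam a b s k ζ) :
    ∃ T, IsBoxFamily T s c C (annulusModulus a b (k + 2)) (‖lam (k + 1)‖ * Real.exp ζ.re) ∧
      ∀ ζ' ∈ T, IsStripBox lam a b s (k + 1) ζ' := by
  have hX : a (k + 1) ≤ ‖lam (k + 1)‖ * Real.exp ζ.re :=
    (h.mem_annulus_of_isStripBox hζ (self_mem_expBox hB.s_pos.le ζ)).1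
  have hqX : q * a (k + 1) ≤ q * (‖lam (k + 1)‖ * Real.exp ζ.re) :=
    mul_le_mul_of_nonneg_left hX hq.le
  rw [← h.log_div_sub (by omega)]
  exact hB.exists_isBoxFamily _ _ _ (hA.trans hX)
    (by rw [h.log_div_sub (by omega)]; exact h.modulus _ (by omega))
    (((h.log_div_norm_le_iff (by omega)).2 hadm.1).trans hqX)
    ((neg_le_neg hqX).trans ((h.le_log_div_norm_iff (by omega)).2 hadm.2))

lemma exists_isBoxTree {q c C A : ℝ} (hq : 0 < q) (hB : HasBoxes q D s c C A) {N : ℕ}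
    (hadm : ∀ n, N ≤ n → a (n + 1) ≤ ‖lam (n + 1)‖ * Real.exp (q * a n) ∧
      ‖lam (n + 1)‖ * Real.exp (-(q * a n)) ≤ b (n + 1))
    (hA : ∀ n, N ≤ n → A ≤ a n) :
    ∃ T, IsBoxTree lam (annulusModulus a b) s c C N (IsStripBox lam a b s) T := by
  have hchildren (k : ℕ) (ζ : ℂ) (hk : N ≤ k) (hζ : IsStripBox lam a b s k ζ) :=
    h.exists_isBoxFamily_isStripBox hq hB (hadm (k + 1) (by omega)) (hA (k + 1) (by omega)) hζ
  choose! T hT hT' using hchildren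
  exact ⟨T, {
    lam_ne := h.lam_ne
    s_pos := hB.s_pos
    s_le_one := hB.s_le_one
    c_pos := hB.c_pos
    C_pos := hB.C_pos
    modulus_pos := fun n hn => h.D_pos.trans (h.modulus n hn)
    child_mem := fun k hk ζ hζ => hT' k ζ hk hζ
    isBoxFamily := fun k hk ζ hζ => hT k ζ hk hζ }⟩

lemma exists_isStripBox (hs : s ≤ D) (k : ℕ) :
    ∃ ζ : ℂ, IsStripBox lam a b s k ζ ∧ ∀ w ∈ expBox s ζ, 1 ≤ ‖w‖ := by
  have hwidth := h.modulus (k + 1) (by omega)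
  rw [← h.log_div_sub (by omega)] at hwidth
  refine ⟨⟨Real.log (a (k + 1) / ‖lam (k + 1)‖), 1 + Real.pi⟩, ⟨le_rfl, ?_⟩, fun w hw => ?_⟩
  · change Real.log (a (k + 1) / ‖lam (k + 1)‖) + s ≤ _
    linarith
  · have him : |w.im - (1 + Real.pi)| ≤ Real.pi := hw.2.2
    exact le_trans (by linarith [(abs_le.1 him).1])
      ((le_abs_self _).trans (Complex.abs_im_le_norm w))

lemma mem_annulus_of_mem_treeLimit {c C : ℝ} {N : ℕ} {T : ℕ → ℂ → Finset ℂ}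
    (hT : IsBoxTree lam (annulusModulus a b) s c C N (IsStripBox lam a b s) T) {u : ℂ} (i : ℕ) :
    ∀ k, N ≤ k → ∀ ζ, IsStripBox lam a b s k ζ → nonautExp lam k u ∈ treeLimit lam s T k ζ →
      a (k + 1 + i) ≤ ‖nonautExp lam (k + 1 + i) u‖ ∧
        ‖nonautExp lam (k + 1 + i) u‖ ≤ b (k + 1 + i) := by
  induction i with
  | zero =>
    intro k _ ζ hζ hu
    rw [add_zero, norm_nonautExp_succ]
    exact h.mem_annulus_of_isStripBox hζ (treeLimit_subset_expBox lam s T k ζ hu)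
  | succ i ih =>
    intro k hk ζ hζ hu
    obtain ⟨ζ', hζ', hu'⟩ := exists_child_mem_treeLimit hu
    rw [show k + 1 + (i + 1) = k + 1 + 1 + i by ring]
    exact ih (k + 1) (by omega) ζ' (hT.child_mem k hk ζ hζ ζ' hζ') hu'

end AnnulusData

end StripBoxes

/-! ### Lower bounds -/

section LowerBounds

open Set MeasureTheory Metric

lemma prod_Icc_one_mul_prod_Ico {N n : ℕ} (hNn : N ≤ n) (f : ℕ → ℝ) :
    (∏ l ∈ Finset.Icc 1 N, f l) * ∏ l ∈ Finset.Ico (N + 1) (n + 1), f l =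
      ∏ l ∈ Finset.Icc 1 n, f l := by
  simp only [← Finset.Ico_add_one_right_eq_Icc]
  exact Finset.prod_Ico_consecutive f (by omega) (by omega)

lemma eventually_mul_pow_lt_pow {c d : ℝ} (hc : 0 ≤ c) (hd : 0 ≤ d) :
    ∀ᶠ K : ℝ in atTop, ∀ n : ℕ, 1 ≤ n → c * d ^ n < K ^ n := by
  filter_upwards [eventually_ge_atTop ((1 + c) * (1 + d))] with K hK n hn
  calc c * d ^ n ≤ c * (1 + d) ^ n := by
        gcongr
        linarith
    _ < (1 + c) * (1 + d) ^ n := by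
        gcongr
        linarith
    _ ≤ (1 + c) ^ n * (1 + d) ^ n := by
        gcongr
        exact le_self_pow₀ (by linarith) (by omega)
    _ = ((1 + c) * (1 + d)) ^ n := (mul_pow _ _ _).symm
    _ ≤ K ^ n := by gcongr

lemma one_add_mul_one_add_min_le {κ κ' y w : ℝ} (hκκ' : κ ≤ κ') (hκ : 0 ≤ κ) (hκ' : 1 ≤ κ')
    (hy : 0 ≤ y) (hw : 0 ≤ w) :
    (1 + κ * y) * (1 + min (κ * y) w) ≤ κ' ^ 2 * ((1 + y) * (1 + min y w)) := by
  have : 0 ≤ min (κ * y) w := le_min (by positivity) hw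
  have : 0 ≤ min y w := le_min hy hw
  have hmin : min (κ * y) w ≤ κ' * min y w := calc
    min (κ * y) w ≤ min w (κ' * y) := by
      rw [min_comm]
      exact min_le_min_left w (by gcongr)
    _ ≤ κ' * min y w := by
      rw [min_comm y]
      exact min_mul_le_mul_min hκ' hw
  calc (1 + κ * y) * (1 + min (κ * y) w) ≤ (κ' * (1 + y)) * (κ' * (1 + min y w)) := by
        gcongr
        · nlinarith
        · linarith
    _ = κ' ^ 2 * ((1 + y) * (1 + min y w)) := by ring

namespace AnnulusData

variable {lam : ℕ → ℂ} {a b : ℕ → ℝ} {D : ℝ} (h : AnnulusData lam a b D)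
include h

section

variable {x : ℕ → ℝ} (hx : x ∈ seqBox a b) {N n : ℕ} (hNn : N ≤ n)
include hx hNn

lemma prod_Ico_eq_modProd_div :
    ∏ l ∈ Finset.Ico (N + 1) (n + 1), x l = modProd x n / modProd x N :=
  eq_div_of_mul_eq (modProd_pos (h.x_pos hx) N).ne' <| by
    rw [mul_comm]
    exact prod_Icc_one_mul_prod_Ico hNn x

lemma prod_Ico_min_eq_minProd_div :
    ∏ l ∈ Finset.Ico (N + 1) (n + 1), min (annulusModulus a b (l + 1)) (x l) =
      minProd a b x n / minProd a b x N :=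
  eq_div_of_mul_eq (h.minProd_pos hx N).ne' <| by
    rw [mul_comm]
    exact prod_Icc_one_mul_prod_Ico hNn fun l => min (annulusModulus a b (l + 1)) (x l)

lemma prod_Ico_three_mul_eq : ∏ l ∈ Finset.Ico (N + 1) (n + 1), 3 * x l =
    3 ^ (n - N) * (modProd x n / modProd x N) := by
  rw [Finset.prod_mul_distrib, Finset.prod_const, Nat.card_Ico, Nat.add_sub_add_right,
    h.prod_Ico_eq_modProd_div hx hNn]

lemma ballMassBound_eq (B L r : ℝ) :
    ballMassBound B (annulusModulus a b) x N n (L * r) =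
      B ^ (n - N) * (modProd x N * minProd a b x N) / (modProd x n * minProd a b x n) *
        ((1 + 3 ^ (n - N) * (L / modProd x N) * (modProd x n * r)) *
          (1 + min (3 ^ (n - N) * (L / modProd x N) * (modProd x n * r))
            (min (annulusModulus a b (n + 1)) (x n)))) := by
  have hradius : L * r * (3 ^ (n - N) * (modProd x n / modProd x N)) =
      3 ^ (n - N) * (L / modProd x N) * (modProd x n * r) := by ring
  rw [ballMassBound, h.prod_Ico_three_mul_eq hx hNn, hradius, Finset.prod_div_distrib,
    Finset.prod_const, Nat.card_Ico, Nat.add_sub_add_right, Finset.prod_mul_distrib,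
    h.prod_Ico_eq_modProd_div hx hNn, h.prod_Ico_min_eq_minProd_div hx hNn, div_mul_div_comm,
    div_div_eq_mul_div]

end

variable {N : ℕ} (hN : 1 ≤ N)
include hN

lemma eventually_mul_prod_lt {L s : ℝ} (hL : 0 ≤ L) (hs : 0 < s) :
    ∀ᶠ K : ℝ in atTop, ∀ x ∈ seqBox a b, modProd x N = modProd a N → ∀ n, N ≤ n → ∀ r, 0 < r →
      K ^ n * r ≤ 1 / modProd x n → L * r * ∏ l ∈ Finset.Ico (N + 1) (n + 1), 3 * x l < s := by
  have hp := modProd_pos h.a_pos N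
  filter_upwards [eventually_mul_pow_lt_pow (c := L / (modProd a N * s)) (d := 3)
    (by positivity) (by norm_num)] with K hK x hx hxN n hNn r hr hKr
  have hP := modProd_pos (h.x_pos hx) n
  rw [le_div_iff₀ hP] at hKr
  rw [h.prod_Ico_three_mul_eq hx hNn, hxN]
  calc L * r * (3 ^ (n - N) * (modProd x n / modProd a N))
      ≤ L * r * (3 ^ n * (modProd x n / modProd a N)) := by
        gcongr
        · norm_num
        · omega
    _ = L / (modProd a N * s) * 3 ^ n * r * modProd x n * s := by field_simp
    _ < K ^ n * r * modProd x n * s := by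
        gcongr
        exact hK n (hN.trans hNn)
    _ ≤ s := mul_le_of_le_one_left hs.le hKr

lemma eventually_ballMassBound_le {B L : ℝ} (hB : 0 ≤ B) (hL : 0 ≤ L) :
    ∀ᶠ K : ℝ in atTop, ∀ x ∈ seqBox a b, modProd x N = modProd a N →
      minProd a b x N = minProd a b a N → ∀ n, N ≤ n → ∀ r, 0 < r →
      ballMassBound B (annulusModulus a b) x N (n + 1) (L * r) ≤ K ^ n *
        (1 + modProd x (n + 1) * r) * (1 + min (modProd x (n + 1) * r)
          (stripWidth a b x n * modProd x (n + 1))) /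
        (modProd x (n + 1) * minProd a b x (n + 1)) := by
  set p := modProd a N
  set m := minProd a b a N
  have hp : 0 < p := modProd_pos h.a_pos N
  have hm : 0 < m := h.minProd_pos h.mem_seqBox_left N
  filter_upwards [eventually_mul_pow_lt_pow (c := p * m * (1 + L / p) ^ 2) (d := 9 * (1 + B))
    (by positivity) (by positivity)] with K hK x hx hxp hxm n hNn r hr
  have hP := modProd_pos (h.x_pos hx) (n + 1)
  have hM := h.minProd_pos hx (n + 1)
  have hw := h.min_pos hx (n + 1) (by omega)
  rw [h.ballMassBound_eq hx (by omega), hxp, hxm, h.stripWidth_mul_modProd hx]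
  set j := n + 1 - N
  set y := modProd x (n + 1) * r
  set w := min (annulusModulus a b (n + 1 + 1)) (x (n + 1))
  have : 0 ≤ min y w := le_min (by positivity) hw.le
  have hκ : (1 : ℝ) ≤ 3 ^ j * (1 + L / p) := one_le_mul_of_one_le_of_one_le
    (one_le_pow₀ (by norm_num)) (le_add_of_nonneg_right (by positivity))
  have hcoeff : B ^ j * (p * m) * (3 ^ j * (1 + L / p)) ^ 2 ≤ K ^ n := calc
    _ = p * m * (1 + L / p) ^ 2 * (9 * B) ^ j := by
      rw [mul_pow, mul_pow, ← pow_mul, mul_comm j, pow_mul]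
      norm_num
      ring
    _ ≤ p * m * (1 + L / p) ^ 2 * (9 * (1 + B)) ^ n := by
      gcongr
      exact (pow_le_pow_left₀ (by positivity) (by linarith) j).trans
        (pow_le_pow_right₀ (by linarith) (by omega))
    _ ≤ K ^ n := (hK n (by omega)).le
  calc _ ≤ B ^ j * (p * m) / (modProd x (n + 1) * minProd a b x (n + 1)) *
        ((3 ^ j * (1 + L / p)) ^ 2 * ((1 + y) * (1 + min y w))) := by
        refine mul_le_mul_of_nonneg_left (one_add_mul_one_add_min_le ?_ ?_ hκ ?_ hw.le) ?_
        · gcongr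
          linarith
        all_goals positivity
    _ = B ^ j * (p * m) * (3 ^ j * (1 + L / p)) ^ 2 * ((1 + y) * (1 + min y w)) /
        (modProd x (n + 1) * minProd a b x (n + 1)) := by ring
    _ ≤ K ^ n * ((1 + y) * (1 + min y w)) / (modProd x (n + 1) * minProd a b x (n + 1)) := by
        gcongr
    _ = _ := by rw [mul_assoc]

end AnnulusData

end LowerBounds

section MassOfBalls

open MeasureTheory Metric

namespace AnnulusData

variable {lam : ℕ → ℂ} {a b : ℕ → ℝ} {D : ℝ} (h : AnnulusData lam a b D)
include h

lemma eventually_treeMeasure_closedBall_le {s c C : ℝ} {N : ℕ} (hN : 1 ≤ N)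
    {T : ℕ → ℂ → Finset ℂ}
    (hT : IsBoxTree lam (annulusModulus a b) s c C N (IsStripBox lam a b s) T) {ζ : ℂ}
    (hζ : IsStripBox lam a b s N ζ) (ha : ∀ n, N ≤ n → 1 ≤ a n) {L : ℝ} (hL : 0 ≤ L) :
    ∀ᶠ K : ℝ in atTop, ∀ u, nonautExp lam N u ∈ treeLimit lam s T N ζ →
      ∀ n, N ≤ n → ∀ r, 0 < r → K ^ n * r ≤ 1 / modProd (orbitSeq lam a N u) n → ∀ j, n < j →
      treeMeasure lam T j N ζ (closedBall (nonautExp lam N u) (L * r)) ≤ ENNReal.ofReal (K ^ n *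
        (1 + modProd (orbitSeq lam a N u) (n + 1) * r) *
        (1 + min (modProd (orbitSeq lam a N u) (n + 1) * r)
          (stripWidth a b (orbitSeq lam a N u) n * modProd (orbitSeq lam a N u) (n + 1))) /
        (modProd (orbitSeq lam a N u) (n + 1) * minProd a b (orbitSeq lam a N u) (n + 1))) := by
  have hc := hT.c_pos
  have hC := hT.C_pos
  filter_upwards [h.eventually_mul_prod_lt hN hL hT.s_pos,
    h.eventually_ballMassBound_le (B := 9 * (C + 1) / c) hN (by positivity) hL]
    with K hgap hmass u hu n hn r hr hKr j hj
  have hann : ∀ l, N < l → a l ≤ ‖nonautExp lam l u‖ ∧ ‖nonautExp lam l u‖ ≤ b l := fun l hl => by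
    obtain ⟨i, rfl⟩ := Nat.exists_eq_add_of_le (Nat.succ_le_of_lt hl)
    exact h.mem_annulus_of_mem_treeLimit hT i N le_rfl ζ hζ hu
  have hx := h.orbitSeq_mem hann
  have hxl : ∀ l, N < l → ‖nonautExp lam l u‖ = orbitSeq lam a N u l := fun l hl =>
    (orbitSeq_of_lt hl).symm
  have hprod : ∏ l ∈ Finset.Ico (N + 1) (n + 1), 3 * ‖nonautExp lam l u‖ =
      ∏ l ∈ Finset.Ico (N + 1) (n + 1), 3 * orbitSeq lam a N u l :=
    Finset.prod_congr rfl fun l hl => by rw [hxl l (Finset.mem_Ico.1 hl).1]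
  refine (hT.treeMeasure_closedBall_le (n := n + 1) j N le_rfl (by omega) (by omega) ζ hζ hu
    (fun l hl => (ha l hl.le).trans (hann l hl).1) (L * r) (by positivity) ?_).trans
    (ENNReal.ofReal_le_ofReal ?_)
  · rw [hprod]
    exact hgap _ hx modProd_orbitSeq_self n hn r hr hKr
  · rw [ballMassBound_congr (by omega) hxl]
    exact hmass _ hx modProd_orbitSeq_self minProd_orbitSeq_self n hn r hr

theorem exists_isMassDistribution {q s c C A : ℝ} (hq : 0 < q) (hB : HasBoxes q D s c C A)
    (hadm : IsAdmissible lam a b q) (hA : ∀ᶠ n in atTop, A ≤ a n) :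
    ∃ (N : ℕ) (μ : Measure ℂ) (E : Set ℂ) (K : ℝ),
      (∀ u ∈ E, ∀ n, N < n → a n ≤ ‖nonautExp lam n u‖ ∧ ‖nonautExp lam n u‖ ≤ b n) ∧
      (∀ x ∈ seqBox a b, ∀ k, 1 ≤ k → 1 / K ≤ min (annulusModulus a b (k + 1)) (x k)) ∧
      IsMassDistribution μ E (fun n u => modProd (orbitSeq lam a N u) n)
        (fun n u => minProd a b (orbitSeq lam a N u) n)
        (fun n u => stripWidth a b (orbitSeq lam a N u) n) (modProd a) K N := by
  obtain ⟨N, hN⟩ := eventually_atTop.1 ((hadm.and hA).and (eventually_ge_atTop 1))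
  obtain ⟨T, hT⟩ := h.exists_isBoxTree hq hB (fun n hn => (hN n hn).1.1) fun n hn => (hN n hn).1.2
  obtain ⟨ζ, hζ, hζ₁⟩ := h.exists_isStripBox hB.s_le N
  obtain ⟨μ, E, L, hL, hμE, hlim, hμ⟩ := hT.exists_measure hζ hζ₁
  obtain ⟨Km, hKm₁, hKm⟩ := h.exists_one_div_le_min
  obtain ⟨K, hball, hK⟩ := ((h.eventually_treeMeasure_closedBall_le (hN N le_rfl).2 hT hζ
    (fun n hn => hB.one_le.trans (hN n hn).1.2) (zero_le_one.trans hL)).and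
    (eventually_ge_atTop Km)).exists
  have hann : ∀ u ∈ E, ∀ n, N < n →
      a n ≤ ‖nonautExp lam n u‖ ∧ ‖nonautExp lam n u‖ ≤ b n := fun u hu n hn => by
    obtain ⟨i, rfl⟩ := Nat.exists_eq_add_of_le (Nat.succ_le_of_lt hn)
    exact h.mem_annulus_of_mem_treeLimit hT i N le_rfl ζ hζ (hlim u hu)
  have hbox : ∀ u ∈ E, orbitSeq lam a N u ∈ seqBox a b := fun u hu => h.orbitSeq_mem (hann u hu)
  have hmin : ∀ x ∈ seqBox a b, ∀ k, 1 ≤ k → 1 / K ≤ min (annulusModulus a b (k + 1)) (x k) :=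
    fun x hx k hk => (one_div_le_one_div_of_le (by linarith) hK).trans (hKm x hx k hk)
  refine ⟨N, μ, E, K, hann, hmin, {
    one_le := hKm₁.trans hK
    growth := h.isSuperexponential
    measure_ne_zero := hμE
    le_scale := fun n _ u hu => h.modProd_le (hbox u hu) n
    scale_le_mul_succ := fun n _ u hu => ?_
    width_pos := fun n _ u hu => h.stripWidth_pos (hbox u hu) n
    one_div_le := fun n _ u hu => ?_
    mass_pos := fun n _ u hu => h.minProd_pos (hbox u hu) n
    width_mul_mass := fun n _ u _ => stripWidth_mul_minProd a b _ n
    measure_closedBall_le := fun n hn u hu r hr hKr => hμ u hu r hr _ <|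
      (eventually_gt_atTop n).mono fun j hj => hball u (hlim u hu) n hn r hr hKr j hj }⟩
  · have hx := (hmin _ (hbox u hu) (n + 1) (by omega)).trans (min_le_right _ _)
    rw [div_le_iff₀' (by linarith)] at hx
    rw [modProd_succ, mul_left_comm]
    exact le_mul_of_one_le_right (modProd_pos (h.x_pos (hbox u hu)) n).le hx
  · rw [h.stripWidth_mul_modProd (hbox u hu)]
    exact hmin _ (hbox u hu) (n + 1) (by omega)

lemma eventually_le_phiRatio_succ {t : ℝ} {x : ℕ → ℝ} (hx : x ∈ seqBox a b)
    (hφ : (t : EReal) < liminf (fun n : ℕ => (phiRatio a b n x : EReal)) atTop) :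
    ∀ᶠ n in atTop, 1 < modProd x n ∧ t ≤ phiRatio a b (n + 1) x := by
  filter_upwards [(tendsto_add_atTop_nat 1).eventually (eventually_lt_of_lt_liminf hφ),
    h.eventually_one_lt_modProd] with n hlt hone
  exact ⟨hone x hx, by exact_mod_cast hlt.le⟩

lemma frequently_le_psiRatio {t : ℝ} {x : ℕ → ℝ} (hx : x ∈ seqBox a b)
    (hψ : (t : EReal) < limsup (fun n : ℕ => (psiRatio a b n x : EReal)) atTop) :
    ∃ᶠ n in atTop, 1 < modProd x n ∧ t ≤ psiRatio a b n x := by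
  refine ((frequently_lt_of_lt_limsup (by isBoundedDefault) hψ).and_eventually
    h.eventually_one_lt_modProd).mono fun n hn => ?_
  exact ⟨hn.2 x hx, by exact_mod_cast hn.1.le⟩

theorem le_dimH_escapeRateSet {q s c C A : ℝ} (hq : 0 < q) (hB : HasBoxes q D s c C A)
    (hadm : IsAdmissible lam a b q) (hA : ∀ᶠ n in atTop, A ≤ a n) {t t' : ℝ} (htt : t' < t)
    (ht' : 0 < 1 + t')
    (hφ : ∀ x ∈ seqBox a b, (t : EReal) < liminf (fun n : ℕ => (phiRatio a b n x : EReal)) atTop) :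
    ENNReal.ofReal (1 + t') ≤ dimH (escapeRateSet lam a b) := by
  obtain ⟨N, μ, E, K, hann, hmin, hμ⟩ := h.exists_isMassDistribution hq hB hadm hA
  have hbox : ∀ u ∈ E, orbitSeq lam a N u ∈ seqBox a b := fun u hu => h.orbitSeq_mem (hann u hu)
  have hev := fun x hx => h.eventually_le_phiRatio_succ (x := x) hx (hφ x hx)
  have ht₁ : t ≤ 1 := by
    obtain ⟨n, hone, hle⟩ := (hev a h.mem_seqBox_left).exists
    exact hle.trans (h.phiRatio_succ_le_one h.mem_seqBox_left hone)
  refine (hμ.le_dimH (t := max t 0) (le_max_right _ _) (max_le ht₁ zero_le_one)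
    (htt.trans_le (le_max_left _ _)) ht' fun u hu => ?_).trans
    (dimH_mono fun u hu => (eventually_gt_atTop N).mono (hann u hu))
  rcases le_total t 0 with ht | ht
  · rw [max_eq_right ht]
    refine Eventually.of_forall fun n => ?_
    simpa only [neg_zero, Real.rpow_zero] using
      one_le_pow_mul_minProd (one_pos.trans_le hμ.one_le) (hmin _ (hbox u hu)) n
  · rw [max_eq_left ht]
    filter_upwards [hev _ (hbox u hu)] with n hn
    exact ((h.le_phiRatio_succ_iff (hbox u hu) hn.1).1 hn.2).trans <|
      le_mul_of_one_le_left (h.minProd_pos (hbox u hu) n).le (one_le_pow₀ hμ.one_le)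

theorem le_packingDim_escapeRateSet {q s c C A : ℝ} (hq : 0 < q) (hB : HasBoxes q D s c C A)
    (hadm : IsAdmissible lam a b q) (hA : ∀ᶠ n in atTop, A ≤ a n) {t t' : ℝ} (htt : t' < t)
    (hψ : ∀ x ∈ seqBox a b, (t : EReal) < limsup (fun n : ℕ => (psiRatio a b n x : EReal)) atTop) :
    ENNReal.ofReal (1 + t') ≤ packingDim (escapeRateSet lam a b) := by
  obtain ⟨N, μ, E, K, hann, -, hμ⟩ := h.exists_isMassDistribution hq hB hadm hA
  have hbox : ∀ u ∈ E, orbitSeq lam a N u ∈ seqBox a b := fun u hu => h.orbitSeq_mem (hann u hu)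
  have hfr := fun x hx => h.frequently_le_psiRatio (x := x) hx (hψ x hx)
  have ht₁ : t ≤ 1 := by
    obtain ⟨n, hone, hle⟩ := (hfr a h.mem_seqBox_left).exists
    exact hle.trans (h.psiRatio_le_one h.mem_seqBox_left hone)
  refine hμ.le_packingDim (fun u hu => (eventually_gt_atTop N).mono (hann u hu)) ht₁ htt
    fun u hu => (hfr _ (hbox u hu)).mono fun n hn => ?_
  exact ((h.le_psiRatio_iff (hbox u hu) hn.1).1 hn.2).trans <|
    le_mul_of_one_le_left (h.minProd_pos (hbox u hu) n).le (one_le_pow₀ hμ.one_le)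

end AnnulusData

end MassOfBalls

lemma AnnulusData.of_tendsto {lam : ℕ → ℂ} {a b : ℕ → ℝ} {D : ℝ} (hD : 0 < D)
    (hlam : ∀ n, 1 ≤ n → lam n ≠ 0) (hab : ∀ n, 1 ≤ n → 0 < a n ∧ a n < b n)
    (hgrowth : Tendsto (fun n : ℕ => (∏ k ∈ Finset.Icc 1 n, a k) ^ ((1 : ℝ) / (n : ℝ))) atTop atTop)
    (hmod : ∀ n, 1 ≤ n → D < annulusModulus a b n) (ha : ∀ᶠ n in atTop, 1 ≤ a n) :
    AnnulusData lam a b D where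
  D_pos := hD
  lam_ne := hlam
  a_pos n hn := (hab n hn).1
  a_lt n hn := (hab n hn).2
  growth B := by
    filter_upwards [hgrowth.eventually_ge_atTop |B|, eventually_ne_atTop 0] with n hn hn₀
    have hprod : 0 ≤ modProd a n := (modProd_pos (fun k hk => (hab k hk).1) n).le
    calc B ^ n ≤ |B| ^ n := (le_abs_self _).trans_eq (abs_pow B n)
      _ ≤ (modProd a n ^ ((1 : ℝ) / n)) ^ n := pow_le_pow_left₀ (abs_nonneg B) hn n
      _ = modProd a n := by rw [one_div, Real.rpow_inv_natCast_pow hprod hn₀]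
  modulus := hmod
  one_le_a := ha

lemma coe_lt_one_add_iff {x : ℝ} {v : EReal} : (x : EReal) < 1 + v ↔ ((x - 1 : ℝ) : EReal) < v := by
  rw [EReal.coe_sub, EReal.coe_one, add_comm]
  exact (EReal.sub_lt_iff (.inl (by decide)) (.inl (by decide))).symm

lemma one_add_lt_coe_iff {x : ℝ} {v : EReal} : 1 + v < (x : EReal) ↔ v < ((x - 1 : ℝ) : EReal) := by
  rw [EReal.coe_sub, EReal.coe_one, add_comm]
  exact (EReal.lt_sub_iff_add_lt (.inl (by decide)) (.inl (by decide))).symm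

lemma one_add_le_of_forall_lt {v : EReal} {d : ℝ≥0∞}
    (hd : ∀ t t' : ℝ, t' < t → 0 < 1 + t' → (t : EReal) < v → ENNReal.ofReal (1 + t') ≤ d) :
    1 + v ≤ (d : EReal) := by
  by_contra! hlt
  obtain ⟨y, hdy, hyv⟩ := EReal.lt_iff_exists_real_btwn.1 hlt
  obtain ⟨z, hyz, hzv⟩ := EReal.lt_iff_exists_real_btwn.1 hyv
  have hy : 0 < y := by exact_mod_cast (EReal.coe_ennreal_nonneg d).trans_lt hdy
  have hyz : y < z := by exact_mod_cast hyz
  have hyd := hd (z - 1) (y - 1) (by linarith) (by linarith) (coe_lt_one_add_iff.1 hzv)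
  rw [add_sub_cancel, ← EReal.coe_ennreal_le_coe_ennreal_iff, EReal.coe_ennreal_ofReal,
    max_eq_left hy.le] at hyd
  exact hdy.not_ge hyd

lemma le_one_add_of_forall_lt {v : EReal} {d : ℝ≥0∞} (hv : 0 ≤ v)
    (hd : ∀ t t' : ℝ, 0 < t → t < t' → v < (t : EReal) → d ≤ ENNReal.ofReal (1 + t')) :
    (d : EReal) ≤ 1 + v := by
  by_contra! hlt
  obtain ⟨y, hvy, hyd⟩ := EReal.lt_iff_exists_real_btwn.1 hlt
  obtain ⟨z, hvz, hzy⟩ := EReal.lt_iff_exists_real_btwn.1 hvy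
  have hzy : z < y := by exact_mod_cast hzy
  rw [one_add_lt_coe_iff] at hvz
  have hz : 0 < z - 1 := by exact_mod_cast hv.trans_lt hvz
  have hdy := hd (z - 1) (y - 1) hz (by linarith) hvz
  rw [add_sub_cancel, ← EReal.coe_ennreal_le_coe_ennreal_iff, EReal.coe_ennreal_ofReal,
    max_eq_left (by linarith)] at hdy
  exact hyd.not_ge hdy

theorem theorem2p2 (q : ℝ) (hq0 : 0 < q) (hq1 : q < 1) (D : ℝ) (hD : 0 < D) :
    ∃ A : ℝ, ∀ (lam : ℕ → ℂ) (a b : ℕ → ℝ),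
      (∀ n, 1 ≤ n → lam n ≠ 0) →
      (∀ n, 1 ≤ n → 0 < a n ∧ a n < b n) →
      IsAdmissible lam a b q →
      Tendsto (fun n : ℕ => (∏ k ∈ Finset.Icc 1 n, a k) ^ ((1 : ℝ) / (n : ℝ))) atTop atTop →
      (∀ n, 1 ≤ n → D < annulusModulus a b n) →
      (A : EReal) < liminf (fun n : ℕ => (a n : EReal)) atTop →
      ((1 : EReal) + (⨅ x ∈ seqBox a b, liminf (fun n : ℕ => (phiRatio a b n x : EReal)) atTop)
          ≤ (dimH (escapeRateSet lam a b) : EReal) ∧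
        (dimH (escapeRateSet lam a b) : EReal)
          ≤ 1 + (⨆ x ∈ seqBox a b, liminf (fun n : ℕ => (phiRatio a b n x : EReal)) atTop)) ∧
      ((1 : EReal) + (⨅ x ∈ seqBox a b, limsup (fun n : ℕ => (psiRatio a b n x : EReal)) atTop)
          ≤ (packingDim (escapeRateSet lam a b) : EReal) ∧
        (packingDim (escapeRateSet lam a b) : EReal)
          ≤ 1 + (⨆ x ∈ seqBox a b, limsup (fun n : ℕ => (psiRatio a b n x : EReal)) atTop)) := by
  obtain ⟨s, c, C, A, hB⟩ := exists_hasBoxes hq0 hq1 hD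
  refine ⟨A, fun lam a b hlam hab hadm hgrowth hmod hliminf => ?_⟩
  have hA : ∀ᶠ n in atTop, A ≤ a n :=
    (eventually_lt_of_lt_liminf hliminf).mono fun n hn => by exact_mod_cast hn.le
  have h : AnnulusData lam a b D := .of_tendsto hD hlam hab hgrowth hmod
    (hA.mono fun n hn => hB.one_le.trans hn)
  refine ⟨⟨one_add_le_of_forall_lt fun t t' htt ht' ht => ?_,
    le_one_add_of_forall_lt ?_ fun t t' ht₀ htt ht => ?_⟩,
    one_add_le_of_forall_lt fun t t' htt _ ht => ?_,
    le_one_add_of_forall_lt ?_ fun t t' ht₀ htt ht => ?_⟩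
  · exact h.le_dimH_escapeRateSet hq0 hB hadm hA htt ht' fun x hx => ht.trans_le (iInf₂_le x hx)
  · exact (h.liminf_phiRatio_nonneg h.mem_seqBox_left).trans
      (le_iSup₂_of_le a h.mem_seqBox_left le_rfl)
  · exact h.dimH_escapeRateSet_le htt (ht₀.trans htt) fun x hx =>
      (le_iSup₂_of_le x hx le_rfl).trans_lt ht
  · exact h.le_packingDim_escapeRateSet hq0 hB hadm hA htt fun x hx => ht.trans_le (iInf₂_le x hx)
  · exact (h.limsup_psiRatio_nonneg h.mem_seqBox_left).trans
      (le_iSup₂_of_le a h.mem_seqBox_left le_rfl)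
  · exact h.packingDim_escapeRateSet_le ht₀ htt fun x hx =>
      (le_iSup₂_of_le x hx le_rfl).trans_lt ht
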